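/- Let $\Omega=(0,1)\times(0,1)\subset\mathbb{R}^2$, $\alpha_1,\alpha_2\in(0,\tfrac12)$, $2\le p<\infty$, $V\in L^p(\Omega)$ with $V\ge 0$ a.e., and $f\in L^2(\Omega)$ (all functions are real-valued). Let $\mathcal{H}^1(\Omega)$ be the space of $u\in L^2(\Omega)$ with weak derivatives such that $y^{\alpha_1}\partial_xu,\;x^{\alpha_2}\partial_yu\in L^2(\Omega)$, with the norm $$\|u\|_{\mathcal{H}^1(\Omega)}=\left(\|u\|_{L^2(\Omega)}^2+\|y^{\alpha_1}\partial_xu\|_{L^2(\Omega)}^2+\|x^{\alpha_2}\partial_yu\|_{L^2(\Omega)}^2\right)^{1/2},$$ let $\mathcal{H}^1_0(\Omega)$ be the closure of $C_0^\infty(\Omega)$ in $\mathcal{H}^1(\Omega)$, and let $H_0(\Omega)=\{u\in\mathcal{H}^1_0(\Omega):\iint_\Omega Vu^2\,dx\,dy<\infty\}$. Let $u\in H_0(\Omega)$ be the weak solution of the Dirichlet problem $$-\left(y^{2\alpha_1}\partial_x^2u+x^{2\alpha_2}\partial_y^2u\right)+Vu=f\ \text{ in }\Omega,\qquad u=0\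 \text{ on }\partial\Omega,$$ that is, $$\iint_\Omega \left(y^{2\alpha_1}\,\partial_xu\,\partial_xv+x^{2\alpha_2}\,\partial_yu\,\partial_yv+Vuv\right)dx\,dy=\iint_\Omega fv\,dx\,dy\qquad\text{for all }v\in H_0(\Omega).$$ Then $u\in H^2_{\rm loc}(\Omega)$, that is, $u\in H^2(\Omega')$ for every open $\Omega'\subset\subset\Omega$. Furthermore, after modification on a null set, $u\in C^{0,\alpha}(\overline{\Omega'})$ for every $\alpha\in(0,1)$ and every $\Omega'\subset\subset\Omega$. -/

import Mathlib

open MeasureTheory Filter Topology Set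
open scoped NNReal ENNReal ContDiff

namespace SubElliptic

noncomputable section

/-- The open unit square `Ω = {(x, y) | 0 < x < 1, 0 < y < 1}`. A point is `z = (x, y)`, so that
`x = z.1` and `y = z.2`. -/
def unitSquare : Set (ℝ × ℝ) := Ioo (0 : ℝ) 1 ×ˢ Ioo (0 : ℝ) 1

/-- `φ ∈ C₀^∞(U)`: smooth, with compact support contained in `U`. -/
def IsTestFunction (U : Set (ℝ × ℝ)) (φ : ℝ × ℝ → ℝ) : Prop :=
  ContDiff ℝ ∞ φ ∧ HasCompactSupport φ ∧ tsupport φ ⊆ U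

/-- The classical derivative `∂ₓφ`. -/
def partialX (φ : ℝ × ℝ → ℝ) (z : ℝ × ℝ) : ℝ := fderiv ℝ φ z (1, 0)

/-- The classical derivative `∂_yφ`. -/
def partialY (φ : ℝ × ℝ → ℝ) (z : ℝ × ℝ) : ℝ := fderiv ℝ φ z (0, 1)

/-- `g` is the weak derivative `∂ₓu` on the open set `U`. -/
def HasWeakPartialX (U : Set (ℝ × ℝ)) (u g : ℝ × ℝ → ℝ) : Prop :=
  LocallyIntegrableOn u U ∧ LocallyIntegrableOn g U ∧
    ∀ φ : ℝ × ℝ → ℝ, IsTestFunction U φ →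
      ∫ z in U, u z * partialX φ z = -∫ z in U, g z * φ z

/-- `g` is the weak derivative `∂_yu` on the open set `U`. -/
def HasWeakPartialY (U : Set (ℝ × ℝ)) (u g : ℝ × ℝ → ℝ) : Prop :=
  LocallyIntegrableOn u U ∧ LocallyIntegrableOn g U ∧
    ∀ φ : ℝ × ℝ → ℝ, IsTestFunction U φ →
      ∫ z in U, u z * partialY φ z = -∫ z in U, g z * φ z

/-- `w ∈ L²(U)`. -/
def InL2 (U : Set (ℝ × ℝ)) (w : ℝ × ℝ → ℝ) : Prop := MemLp w 2 (volume.restrict U)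

/-- `u ∈ 𝓗¹(Ω)`, with weak derivatives `ux = ∂ₓu` and `uy = ∂_yu` (which are unique up to null
sets): `u`, `y^α₁ ∂ₓu` and `x^α₂ ∂_yu` belong to `L²(Ω)`. -/
structure InWeightedH1 (α₁ α₂ : ℝ) (u ux uy : ℝ × ℝ → ℝ) : Prop where
  memL2 : InL2 unitSquare u
  weakX : HasWeakPartialX unitSquare u ux
  weakY : HasWeakPartialY unitSquare u uy
  memL2_x : InL2 unitSquare (fun z => z.2 ^ α₁ * ux z)
  memL2_y : InL2 unitSquare (fun z => z.1 ^ α₂ * uy z)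

/-- The norm of `𝓗¹(Ω)` of a function `u` whose weak derivatives are `ux` and `uy`. -/
def weightedH1Norm (α₁ α₂ : ℝ) (u ux uy : ℝ × ℝ → ℝ) : ℝ :=
  Real.sqrt ((∫ z in unitSquare, u z ^ 2) + (∫ z in unitSquare, (z.2 ^ α₁ * ux z) ^ 2) +
    ∫ z in unitSquare, (z.1 ^ α₂ * uy z) ^ 2)

/-- `u ∈ 𝓗₀¹(Ω)`, the closure of `C₀^∞(Ω)` in `𝓗¹(Ω)`, with weak derivatives `ux`, `uy`. -/
structure InWeightedH10 (α₁ α₂ : ℝ) (u ux uy : ℝ × ℝ → ℝ) : Prop where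
  memH1 : InWeightedH1 α₁ α₂ u ux uy
  approx : ∃ φ : ℕ → ℝ × ℝ → ℝ, (∀ n, IsTestFunction unitSquare (φ n)) ∧
    Tendsto (fun n => weightedH1Norm α₁ α₂ (fun z => u z - φ n z)
      (fun z => ux z - partialX (φ n) z) (fun z => uy z - partialY (φ n) z)) atTop (𝓝 0)

/-- `u ∈ H₀(Ω)`: `u ∈ 𝓗₀¹(Ω)`, with weak derivatives `ux`, `uy`, and `∬ V u² < ∞`. -/
structure InH0 (α₁ α₂ : ℝ) (V u ux uy : ℝ × ℝ → ℝ) : Prop where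
  memH10 : InWeightedH10 α₁ α₂ u ux uy
  integrable_potential : IntegrableOn (fun z => V z * u z ^ 2) unitSquare

/-- The bilinear form `a(u, v)`, where `ux`, `uy`, `vx`, `vy` are the weak derivatives. -/
def bilinForm (α₁ α₂ : ℝ) (V u ux uy v vx vy : ℝ × ℝ → ℝ) : ℝ :=
  ∫ z in unitSquare, ((z.2 ^ α₁ * ux z) * (z.2 ^ α₁ * vx z) +
    (z.1 ^ α₂ * uy z) * (z.1 ^ α₂ * vy z) + V z * u z * v z)

/-- `u ∈ H₀(Ω)` is a weak solution of `-(y^{2α₁} ∂ₓ²u + x^{2α₂} ∂_y²u) + V u = f` in `Ω`, `u = 0`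
on `∂Ω`: `a(u, v) = (f, v)` for all `v ∈ H₀(Ω)`. -/
def IsWeakSolution (α₁ α₂ : ℝ) (V f u : ℝ × ℝ → ℝ) : Prop :=
  ∃ ux uy : ℝ × ℝ → ℝ, InH0 α₁ α₂ V u ux uy ∧
    ∀ v vx vy : ℝ × ℝ → ℝ, InH0 α₁ α₂ V v vx vy →
      bilinForm α₁ α₂ V u ux uy v vx vy = ∫ z in unitSquare, f z * v z

/-- The classical Sobolev space `H^k(U)`: all weak derivatives of order at most `k` exist and
belong to `L²(U)`. -/
def InSobolevH (U : Set (ℝ × ℝ)) : ℕ → (ℝ × ℝ → ℝ) → Prop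
  | 0, u => InL2 U u
  | k + 1, u => InL2 U u ∧ ∃ ux uy : ℝ × ℝ → ℝ,
      HasWeakPartialX U u ux ∧ HasWeakPartialY U u uy ∧
        InSobolevH U k ux ∧ InSobolevH U k uy

/-- `U ⊂⊂ W`: the closure of `U` is compact and contained in `W`. -/
def CompactlyContained (U W : Set (ℝ × ℝ)) : Prop := IsCompact (closure U) ∧ closure U ⊆ W

/-- `u ∈ H^k_loc(W)`: `u ∈ H^k(U)` for every open `U ⊂⊂ W`. -/
def InSobolevHLoc (W : Set (ℝ × ℝ)) (k : ℕ) (u : ℝ × ℝ → ℝ) : Prop :=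
  ∀ U : Set (ℝ × ℝ), IsOpen U → CompactlyContained U W → InSobolevH U k u

end

end SubElliptic

/-! On a square `innerSquare κ` away from the boundary the weights are smooth and bounded below, so
`u` solves there a uniformly elliptic equation `-(A(y)² u_xx + B(x)² u_yy) = F` with `F = f - V u`.
The obstacle is `V u`: a priori it is only a product of two `L²` functions.

Since `A` depends on `y` alone and `B` on `x` alone, the coordinates `X = ∫ B dx`, `Y = ∫ A dy` turn
the principal part, divided by `A B`, into `A B` times a Laplacian up to first order terms. The
logarithm of the distance in these coordinates is thus an explicit fundamental solution.
Regularising it by `δ`, integrating by parts against a cut-off `u η` and letting `δ → 0` represents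
`u η` as the logarithmic potential of a compactly supported `H` built from `u`, its gradient and `F`
(`LocalSolution.representation`). If `H` lies in `L^r` with `1 < r ≤ 2`, then `u η` is bounded; if
`H` lies in `L²`, then `u η` is Hölder continuous of every order below `1`.

The bootstrap has two rounds. Finite energy puts `√V u` in `L²`, and `√V` is in `L⁴`, so `V u` is in
`L^(4/3)` (`InH0.memLp_potential_term`). Hence `u` is locally bounded, `V u` is locally in `L²`, and
the second round gives Hölder continuity.

With the right side in `L²`, second derivatives come from mollification. Dividing `(a W_xx + b
W_yy)²` by `a b` gives the mixed product the constant coefficient `2`, and `∫ W_xx W_yy = ∫ W_xy²`,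
so all second derivatives of a test function `W` are controlled (`integral_sq_le_of_elliptic`).
Friedrichs commutators make this bound uniform in the mollification length
(`exists_uniform_bound_smear`), and weak limits in `L²` are the second derivatives of `u η`. -/

namespace SubElliptic

/-! ### Directional derivatives and test functions. -/

/-- The derivative of `φ` in the direction `e`. -/
noncomputable def dirDeriv (e : ℝ × ℝ) (φ : ℝ × ℝ → ℝ) (z : ℝ × ℝ) : ℝ := fderiv ℝ φ z e

theorem partialX_eq_dirDeriv : partialX = dirDeriv (1, 0) := rfl

theorem partialY_eq_dirDeriv : partialY = dirDeriv (0, 1) := rfl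

theorem contDiff_dirDeriv {φ : ℝ × ℝ → ℝ} (h : ContDiff ℝ ∞ φ) (e : ℝ × ℝ) :
    ContDiff ℝ ∞ (dirDeriv e φ) :=
  (h.fderiv_right (m := ∞) (by simp)).clm_apply contDiff_const

theorem _root_.ContDiff.differentiableAt_infty {φ : ℝ × ℝ → ℝ} (h : ContDiff ℝ ∞ φ)
    (z : ℝ × ℝ) : DifferentiableAt ℝ φ z := h.differentiable (by simp) z

theorem dirDeriv_mul {φ ψ : ℝ × ℝ → ℝ} {z : ℝ × ℝ} (hφ : DifferentiableAt ℝ φ z)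
    (hψ : DifferentiableAt ℝ ψ z) (e : ℝ × ℝ) :
    dirDeriv e (fun z => φ z * ψ z) z = φ z * dirDeriv e ψ z + dirDeriv e φ z * ψ z := by
  simp [dirDeriv, fderiv_fun_mul hφ hψ, mul_comm]

theorem dirDeriv_comm {φ : ℝ × ℝ → ℝ} (h : ContDiff ℝ ∞ φ) (e e' : ℝ × ℝ) (z : ℝ × ℝ) :
    dirDeriv e (dirDeriv e' φ) z = dirDeriv e' (dirDeriv e φ) z := by
  have hs : IsSymmSndFDerivAt ℝ φ z := h.contDiffAt.isSymmSndFDerivAt (by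
    rw [minSmoothness_of_isRCLikeNormedField]; exact WithTop.coe_le_coe.2 (le_top : (2 : ℕ∞) ≤ ⊤))
  have hd : DifferentiableAt ℝ (fderiv ℝ φ) z :=
    (h.fderiv_right (m := ∞) (by simp)).differentiable (by simp) z
  have key : ∀ a b : ℝ × ℝ, dirDeriv a (dirDeriv b φ) z = fderiv ℝ (fderiv ℝ φ) z a b := by
    intro a b
    have : HasFDerivAt (dirDeriv b φ) ((fderiv ℝ (fderiv ℝ φ) z).flip b) z := by
      have h := hd.hasFDerivAt.clm_apply (hasFDerivAt_const b z)
      simp only [ContinuousLinearMap.comp_zero, zero_add] at h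
      exact h
    rw [dirDeriv, this.fderiv, ContinuousLinearMap.flip_apply]
  rw [key, key, hs.eq]

theorem partialX_eq_of_hasDerivAt {φ : ℝ × ℝ → ℝ} {z : ℝ × ℝ} {d : ℝ}
    (hφ : DifferentiableAt ℝ φ z) (h : HasDerivAt (fun t => φ (t, z.2)) d z.1) :
    dirDeriv (1, 0) φ z = d := by
  have h1 : HasDerivAt (fun t : ℝ => (t, z.2)) ((1 : ℝ), (0 : ℝ)) z.1 :=
    (hasDerivAt_id _).prodMk (hasDerivAt_const _ _)
  exact (HasFDerivAt.comp_hasDerivAt z.1 (f := fun t : ℝ => (t, z.2)) hφ.hasFDerivAt h1).unique h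

theorem partialY_eq_of_hasDerivAt {φ : ℝ × ℝ → ℝ} {z : ℝ × ℝ} {d : ℝ}
    (hφ : DifferentiableAt ℝ φ z) (h : HasDerivAt (fun t => φ (z.1, t)) d z.2) :
    dirDeriv (0, 1) φ z = d := by
  have h1 : HasDerivAt (fun t : ℝ => (z.1, t)) ((0 : ℝ), (1 : ℝ)) z.2 :=
    (hasDerivAt_const _ _).prodMk (hasDerivAt_id _)
  exact (HasFDerivAt.comp_hasDerivAt z.2 (f := fun t : ℝ => (z.1, t)) hφ.hasFDerivAt h1).unique h

theorem tsupport_dirDeriv_subset (e : ℝ × ℝ) (φ : ℝ × ℝ → ℝ) :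
    tsupport (dirDeriv e φ) ⊆ tsupport φ := by
  refine closure_minimal (fun z hz => ?_) (isClosed_tsupport φ)
  refine support_fderiv_subset ℝ (f := φ) ?_
  intro h0
  exact hz (by simp [dirDeriv, h0])

namespace IsTestFunction

variable {U : Set (ℝ × ℝ)} {φ ψ : ℝ × ℝ → ℝ}

theorem continuous (h : IsTestFunction U φ) : Continuous φ := h.1.continuous

theorem mono {W : Set (ℝ × ℝ)} (h : IsTestFunction U φ) (hUW : U ⊆ W) : IsTestFunction W φ :=
  ⟨h.1, h.2.1, h.2.2.trans hUW⟩

theorem mul_smooth (h : IsTestFunction U φ) (hψ : ContDiff ℝ ∞ ψ) :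
    IsTestFunction U (fun z => φ z * ψ z) :=
  ⟨h.1.mul hψ, h.2.1.mul_right, (tsupport_mul_subset_left (f := φ) (g := ψ)).trans h.2.2⟩

theorem smooth_mul (h : IsTestFunction U φ) (hψ : ContDiff ℝ ∞ ψ) :
    IsTestFunction U (fun z => ψ z * φ z) := by
  simpa only [mul_comm] using h.mul_smooth hψ

theorem dirDeriv (h : IsTestFunction U φ) (e : ℝ × ℝ) : IsTestFunction U (dirDeriv e φ) :=
  ⟨contDiff_dirDeriv h.1 e, h.2.1.mono' (subset_closure.trans (tsupport_dirDeriv_subset e φ)),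
    (tsupport_dirDeriv_subset e φ).trans h.2.2⟩

theorem add (h : IsTestFunction U φ) (h' : IsTestFunction U ψ) :
    IsTestFunction U (fun z => φ z + ψ z) :=
  ⟨h.1.add h'.1, h.2.1.add h'.2.1,
    (tsupport_add φ ψ).trans (union_subset h.2.2 h'.2.2)⟩

theorem exists_bound (h : IsTestFunction U φ) : ∃ C : ℝ, ∀ z, ‖φ z‖ ≤ C :=
  h.2.1.exists_bound_of_continuous h.continuous

theorem eq_zero (h : IsTestFunction U φ) {z : ℝ × ℝ} (hz : z ∉ U) : φ z = 0 :=
  image_eq_zero_of_notMem_tsupport fun h' => hz (h.2.2 h')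

theorem integrable_mul (h : IsTestFunction U φ) {g : ℝ × ℝ → ℝ}
    (hg : LocallyIntegrable g) : Integrable (fun z => g z * φ z) := by
  simpa [mul_comm] using hg.integrable_smul_left_of_hasCompactSupport h.continuous h.2.1

theorem memLp_mul (h : IsTestFunction U φ) {g : ℝ × ℝ → ℝ} {r : ℝ≥0∞} (hg : MemLp g r) :
    MemLp (fun z => g z * φ z) r := by
  obtain ⟨C, hC⟩ := h.exists_bound
  refine hg.of_le_mul (c := C) (hg.1.mul h.continuous.aestronglyMeasurable)
    (Eventually.of_forall fun z => ?_)
  rw [norm_mul, mul_comm]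
  gcongr
  exact hC z

theorem memLp (h : IsTestFunction U φ) (r : ℝ≥0∞) : MemLp φ r :=
  h.continuous.memLp_of_hasCompactSupport h.2.1

end IsTestFunction

/-! ### Local weak solutions and the adjoint identity for a cut-off solution. -/

/-- `ue` is a weak derivative of `u` in the direction `e` on `U`, for functions which are integrated
over the whole plane. -/
def IsWeakDir (e : ℝ × ℝ) (U : Set (ℝ × ℝ)) (u ue : ℝ × ℝ → ℝ) : Prop :=
  ∀ φ, IsTestFunction U φ → ∫ z, u z * dirDeriv e φ z = -∫ z, ue z * φ z

/-- One integration by parts brings in `ue`; `a ζ = η p` then turns its leading term into `a ∂ₑ(ζ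
φ)`, the form in which the weak equation can be used. The remaining term, with `∂ₑη p ∂ₑφ`, is
integrated by parts again, so that otherwise no derivative falls on `φ`. -/
theorem integral_cutoff_mul_dirDeriv {U : Set (ℝ × ℝ)} {e : ℝ × ℝ}
    {u ue a p η ζ : ℝ × ℝ → ℝ} (hu : LocallyIntegrable u) (hue : LocallyIntegrable ue)
    (hw : IsWeakDir e U u ue) (ha : ContDiff ℝ ∞ a) (hp : ContDiff ℝ ∞ p)
    (hη : IsTestFunction U η) (hζ : IsTestFunction U ζ) (heq : ∀ z, a z * ζ z = η z * p z)
    {φ : ℝ × ℝ → ℝ} (hφ : ContDiff ℝ ∞ φ) :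
    ∫ z, u z * (η z * dirDeriv e (fun z => p z * dirDeriv e φ z) z) =
      -(∫ z, ue z * (a z * dirDeriv e (fun z => ζ z * φ z) z)) +
      (∫ z, ue z * ((a z * dirDeriv e ζ z + dirDeriv e η z * p z) * φ z)) +
      ∫ z, u z * (dirDeriv e (fun z => dirDeriv e η z * p z) z * φ z) := by
  have hφe := contDiff_dirDeriv hφ e
  have hpφ : ContDiff ℝ ∞ (fun z => p z * dirDeriv e φ z) := hp.mul hφe
  have hηp := (hη.dirDeriv e).mul_smooth hp
  have h1 := hw _ (hη.mul_smooth hpφ)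
  have h2 := hw _ (hηp.mul_smooth hφ)
  have i1 := (hη.mul_smooth (contDiff_dirDeriv hpφ e)).integrable_mul hu
  have i2 := ((hη.dirDeriv e).mul_smooth hpφ).integrable_mul hu
  have i3 := (hηp.mul_smooth hφe).integrable_mul hu
  have i4 := ((hηp.dirDeriv e).mul_smooth hφ).integrable_mul hu
  have i5 := ((hζ.mul_smooth hφ).dirDeriv e |>.smooth_mul ha).integrable_mul hue
  have i6 := ((((hζ.dirDeriv e).smooth_mul ha).add hηp).mul_smooth hφ).integrable_mul hue
  have i7 := (hη.mul_smooth hpφ).integrable_mul hue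
  have i8 := (hηp.mul_smooth hφ).integrable_mul hue
  have e1 : ∫ z, u z * dirDeriv e (fun z => η z * (p z * dirDeriv e φ z)) z =
      (∫ z, u z * (η z * dirDeriv e (fun z => p z * dirDeriv e φ z) z)) +
      ∫ z, u z * (dirDeriv e η z * p z * dirDeriv e φ z) := by
    rw [← integral_add i1 i3]
    congr 1 with z
    rw [dirDeriv_mul (hη.1.differentiableAt_infty z) (hpφ.differentiableAt_infty z)]
    ring
  have e2 : ∫ z, u z * dirDeriv e (fun z => dirDeriv e η z * p z * φ z) z =
      (∫ z, u z * (dirDeriv e η z * p z * dirDeriv e φ z)) +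
      ∫ z, u z * (dirDeriv e (fun z => dirDeriv e η z * p z) z * φ z) := by
    rw [← integral_add i3 i4]
    congr 1 with z
    rw [dirDeriv_mul (hηp.1.differentiableAt_infty z) (hφ.differentiableAt_infty z)]
    ring
  have e3 : (∫ z, ue z * ((a z * dirDeriv e ζ z + dirDeriv e η z * p z) * φ z)) +
      (∫ z, ue z * (η z * (p z * dirDeriv e φ z))) =
      (∫ z, ue z * (a z * dirDeriv e (fun z => ζ z * φ z) z)) +
      ∫ z, ue z * (dirDeriv e η z * p z * φ z) := by
    rw [← integral_add i6 i7, ← integral_add i5 i8]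
    congr 1 with z
    rw [dirDeriv_mul (hζ.1.differentiableAt_infty z) (hφ.differentiableAt_infty z)]
    linear_combination (-ue z * dirDeriv e φ z) * heq z
  linarith

/-- `u`, with weak derivatives `ux` and `uy`, is a weak solution in `U` of
`-∂ₓ(a ∂ₓu) - ∂_y(b ∂_yu) = F`. -/
structure LocalSolution (U : Set (ℝ × ℝ)) (a b u ux uy F : ℝ × ℝ → ℝ) : Prop where
  memLp : MemLp u 2
  memLp_x : MemLp ux 2
  memLp_y : MemLp uy 2
  integrable_F : ∀ ζ, IsTestFunction U ζ → Integrable (fun z => F z * ζ z)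
  weakX : IsWeakDir (1, 0) U u ux
  weakY : IsWeakDir (0, 1) U u uy
  eqn : ∀ φ, IsTestFunction U φ → (∫ z, ux z * (a z * dirDeriv (1, 0) φ z)) +
    (∫ z, uy z * (b z * dirDeriv (0, 1) φ z)) = ∫ z, F z * φ z

namespace LocalSolution

variable {U : Set (ℝ × ℝ)} {a b u ux uy F : ℝ × ℝ → ℝ}

/-- The leading terms of the two directions add up to the weak equation tested with `ζ φ`; `φ`
itself needs no compact support. Allowing `ζ ≠ η` amounts to multiplying the operator by `ζ / η`:
the kernel identity takes `ζ = η / (A B)`, the second derivative estimate `ζ = η`. -/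
theorem adjoint (h : LocalSolution U a b u ux uy F) (ha : ContDiff ℝ ∞ a) (hb : ContDiff ℝ ∞ b)
    {p q η ζ : ℝ × ℝ → ℝ} (hp : ContDiff ℝ ∞ p) (hq : ContDiff ℝ ∞ q)
    (hη : IsTestFunction U η) (hζ : IsTestFunction U ζ)
    (hpa : ∀ z, a z * ζ z = η z * p z) (hqb : ∀ z, b z * ζ z = η z * q z) :
    ∃ c₀ c₁ c₂ : ℝ × ℝ → ℝ, IsTestFunction U c₀ ∧ IsTestFunction U c₁ ∧ IsTestFunction U c₂ ∧
      ∀ φ : ℝ × ℝ → ℝ, ContDiff ℝ ∞ φ →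
        ∫ z, (u z * η z) * (dirDeriv (1, 0) (fun z => p z * dirDeriv (1, 0) φ z) z +
            dirDeriv (0, 1) (fun z => q z * dirDeriv (0, 1) φ z) z) =
          ∫ z, (u z * c₀ z + ux z * c₁ z + uy z * c₂ z - F z * ζ z) * φ z := by
  have hx := (hη.dirDeriv (1, 0)).mul_smooth hp
  have hy := (hη.dirDeriv (0, 1)).mul_smooth hq
  refine ⟨_, _, _, (hx.dirDeriv (1, 0)).add (hy.dirDeriv (0, 1)),
    ((hζ.dirDeriv (1, 0)).smooth_mul ha).add hx, ((hζ.dirDeriv (0, 1)).smooth_mul hb).add hy,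
    fun φ hφ => ?_⟩
  have lu := h.memLp.locallyIntegrable (by norm_num)
  have lx := h.memLp_x.locallyIntegrable (by norm_num)
  have ly := h.memLp_y.locallyIntegrable (by norm_num)
  have k1 := integral_cutoff_mul_dirDeriv lu lx h.weakX ha hp hη hζ hpa hφ
  have k2 := integral_cutoff_mul_dirDeriv lu ly h.weakY hb hq hη hζ hqb hφ
  have k3 := h.eqn _ (hζ.mul_smooth hφ)
  have hp1 := contDiff_dirDeriv (hp.mul (contDiff_dirDeriv hφ (1, 0))) (1, 0)
  have hq1 := contDiff_dirDeriv (hq.mul (contDiff_dirDeriv hφ (0, 1))) (0, 1)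
  have i1 := (hη.mul_smooth hp1).integrable_mul lu
  have i2 := (hη.mul_smooth hq1).integrable_mul lu
  have i3 := ((hx.dirDeriv (1, 0)).mul_smooth hφ).integrable_mul lu
  have i4 := ((hy.dirDeriv (0, 1)).mul_smooth hφ).integrable_mul lu
  have i5 := ((((hζ.dirDeriv (1, 0)).smooth_mul ha).add hx).mul_smooth hφ).integrable_mul lx
  have i6 := ((((hζ.dirDeriv (0, 1)).smooth_mul hb).add hy).mul_smooth hφ).integrable_mul ly
  have i7 := h.integrable_F _ (hζ.mul_smooth hφ)
  have e1 := integral_add i1 i2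
  have e2 := integral_add i3 i4
  have e3 := integral_add (i3.add i4) i5
  have e4 := integral_add ((i3.add i4).add i5) i6
  have e5 := integral_sub (((i3.add i4).add i5).add i6) i7
  simp only [Pi.add_apply] at e2 e3 e4 e5
  trans ∫ z, (u z * (η z * dirDeriv (1, 0) (fun z => p z * dirDeriv (1, 0) φ z) z) +
      u z * (η z * dirDeriv (0, 1) (fun z => q z * dirDeriv (0, 1) φ z) z))
  · congr 1 with z
    ring
  rw [e1, k1, k2]
  refine Eq.trans ?_ (e5.symm.trans ?_)
  · linarith
  · congr 1 with z
    ring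

end LocalSolution

/-! ### Coefficients of one variable and the regularised logarithmic kernel. -/

/-- A smooth function of one variable which is Lipschitz and lies between the positive constants `c`
and `C`. -/
structure EllipticCoeff (A : ℝ → ℝ) (c C : ℝ) : Prop where
  smooth : ContDiff ℝ ∞ A
  pos : 0 < c
  lower : ∀ t, c ≤ A t
  upper : ∀ t, A t ≤ C
  lipschitz : ∃ L : ℝ≥0, LipschitzWith L A

/-- The primitive of `A` which vanishes at `0`. -/
noncomputable def primitive (A : ℝ → ℝ) (x : ℝ) : ℝ := ∫ t in (0 : ℝ)..x, A t

namespace EllipticCoeff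

variable {A : ℝ → ℝ} {c C : ℝ}

theorem coeff_pos (h : EllipticCoeff A c C) (t : ℝ) : 0 < A t := h.pos.trans_le (h.lower t)

theorem upper_pos (h : EllipticCoeff A c C) : 0 < C := (h.coeff_pos 0).trans_le (h.upper 0)

theorem continuous (h : EllipticCoeff A c C) : Continuous A := h.smooth.continuous

theorem hasDerivAt_primitive (h : EllipticCoeff A c C) (x : ℝ) :
    HasDerivAt (primitive A) (A x) x :=
  intervalIntegral.integral_hasDerivAt_right (h.continuous.intervalIntegrable _ _)
    (h.continuous.stronglyMeasurableAtFilter _ _) h.continuous.continuousAt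

theorem contDiff_primitive (h : EllipticCoeff A c C) : ContDiff ℝ ∞ (primitive A) := by
  rw [contDiff_infty_iff_deriv]
  refine ⟨fun x => (h.hasDerivAt_primitive x).differentiableAt, ?_⟩
  rw [show deriv (primitive A) = A from funext fun x => (h.hasDerivAt_primitive x).deriv]
  exact h.smooth

theorem continuous_primitive (h : EllipticCoeff A c C) : Continuous (primitive A) :=
  h.contDiff_primitive.continuous

theorem mul_sub_le_primitive (h : EllipticCoeff A c C) {x y : ℝ} (hxy : x ≤ y) :
    c * (y - x) ≤ primitive A y - primitive A x :=
  mul_sub_le_image_sub_of_le_deriv (fun z => (h.hasDerivAt_primitive z).differentiableAt)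
    (fun z => by rw [(h.hasDerivAt_primitive z).deriv]; exact h.lower z) hxy

theorem primitive_le_mul_sub (h : EllipticCoeff A c C) {x y : ℝ} (hxy : x ≤ y) :
    primitive A y - primitive A x ≤ C * (y - x) :=
  image_sub_le_mul_sub_of_deriv_le (fun z => (h.hasDerivAt_primitive z).differentiableAt)
    (fun z => by rw [(h.hasDerivAt_primitive z).deriv]; exact h.upper z) hxy

theorem mul_abs_le_primitive (h : EllipticCoeff A c C) (x y : ℝ) :
    c * |x - y| ≤ |primitive A x - primitive A y| := by
  rcases le_total x y with hxy | hxy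
  · have := h.mul_sub_le_primitive hxy
    rw [abs_sub_comm x, abs_sub_comm (primitive A x), abs_of_nonneg (sub_nonneg.2 hxy)]
    exact this.trans (le_abs_self _)
  · have := h.mul_sub_le_primitive hxy
    rw [abs_of_nonneg (sub_nonneg.2 hxy)]
    exact this.trans (le_abs_self _)

theorem strictMono_primitive (h : EllipticCoeff A c C) : StrictMono (primitive A) := fun _ _ hxy =>
  sub_pos.1 ((mul_pos h.pos (sub_pos.2 hxy)).trans_le (h.mul_sub_le_primitive hxy.le))

theorem abs_primitive_le (h : EllipticCoeff A c C) (x y : ℝ) :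
    |primitive A x - primitive A y| ≤ C * |x - y| := by
  rcases le_total x y with hxy | hxy
  · have := h.primitive_le_mul_sub hxy
    rw [abs_sub_comm x, abs_sub_comm (primitive A x), abs_of_nonneg (sub_nonneg.2 hxy),
      abs_of_nonneg (sub_nonneg.2 (h.strictMono_primitive.monotone hxy))]
    exact this
  · have := h.primitive_le_mul_sub hxy
    rw [abs_of_nonneg (sub_nonneg.2 hxy),
      abs_of_nonneg (sub_nonneg.2 (h.strictMono_primitive.monotone hxy))]
    exact this

theorem surjective_primitive (h : EllipticCoeff A c C) : Function.Surjective (primitive A) := by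
  have h0 : primitive A 0 = 0 := by simp [primitive]
  refine h.continuous_primitive.surjective ?_ ?_
  · refine tendsto_atTop_mono' _ ?_ (tendsto_id.const_mul_atTop h.pos)
    filter_upwards [eventually_ge_atTop 0] with x hx
    simpa [h0] using h.mul_sub_le_primitive hx
  · refine tendsto_atBot_mono' _ ?_ (tendsto_id.const_mul_atBot h.pos)
    filter_upwards [eventually_le_atBot 0] with x hx
    have := h.mul_sub_le_primitive hx
    rw [h0] at this
    simp only [id]
    linarith

/-- The primitive, as a homeomorphism of the line. -/
noncomputable def primitiveHomeomorph (h : EllipticCoeff A c C) : ℝ ≃ₜ ℝ :=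
  (h.strictMono_primitive.orderIsoOfSurjective _ h.surjective_primitive).toHomeomorph

end EllipticCoeff

/-- The regularised squared distance between the images of `z` and `w` under the change of
variables `(x, y) ↦ (primitive B x, primitive A y)`. -/
noncomputable def kerQ (A B : ℝ → ℝ) (δ : ℝ) (z w : ℝ × ℝ) : ℝ :=
  (primitive B z.1 - primitive B w.1) ^ 2 + (primitive A z.2 - primitive A w.2) ^ 2 + δ ^ 2

section

variable {A B : ℝ → ℝ} {c C : ℝ}

theorem kerQ_pos {δ : ℝ} (hδ : 0 < δ) (z w : ℝ × ℝ) : 0 < kerQ A B δ z w := by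
  unfold kerQ; positivity

theorem contDiff_kerQ_left (hA : EllipticCoeff A c C) (hB : EllipticCoeff B c C) (δ : ℝ)
    (w : ℝ × ℝ) : ContDiff ℝ ∞ (fun z => kerQ A B δ z w) := by
  have := hA.contDiff_primitive
  have := hB.contDiff_primitive
  unfold kerQ
  fun_prop

theorem contDiff_log_kerQ (hA : EllipticCoeff A c C) (hB : EllipticCoeff B c C) {δ : ℝ}
    (hδ : 0 < δ) (w : ℝ × ℝ) : ContDiff ℝ ∞ (fun z => Real.log (kerQ A B δ z w) / 2) :=
  ((contDiff_kerQ_left hA hB δ w).log fun z => (kerQ_pos hδ z w).ne').div_const 2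

theorem hasDerivAt_kerQ_fst (hB : EllipticCoeff B c C) (δ : ℝ) (w z : ℝ × ℝ) :
    HasDerivAt (fun t => kerQ A B δ (t, z.2) w)
      (2 * (primitive B z.1 - primitive B w.1) * B z.1) z.1 := by
  have := (((hB.hasDerivAt_primitive z.1).sub_const (primitive B w.1)).pow 2).add_const
    ((primitive A z.2 - primitive A w.2) ^ 2 + δ ^ 2)
  simpa [kerQ, add_assoc] using this

theorem hasDerivAt_kerQ_snd (hA : EllipticCoeff A c C) (δ : ℝ) (w z : ℝ × ℝ) :
    HasDerivAt (fun t => kerQ A B δ (z.1, t) w)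
      (2 * (primitive A z.2 - primitive A w.2) * A z.2) z.2 := by
  have := ((((hA.hasDerivAt_primitive z.2).sub_const (primitive A w.2)).pow 2).const_add
    ((primitive B z.1 - primitive B w.1) ^ 2)).add_const (δ ^ 2)
  simpa [kerQ, add_assoc] using this

theorem flux_log_kerQ_fst (hA : EllipticCoeff A c C) (hB : EllipticCoeff B c C) {δ : ℝ}
    (hδ : 0 < δ) (w z : ℝ × ℝ) :
    A z.2 / B z.1 * dirDeriv (1, 0) (fun z => Real.log (kerQ A B δ z w) / 2) z =
      A z.2 * (primitive B z.1 - primitive B w.1) / kerQ A B δ z w := by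
  have hp := kerQ_pos (A := A) (B := B) hδ z w
  have hd : HasDerivAt (fun t => Real.log (kerQ A B δ (t, z.2) w) / 2)
      (2 * (primitive B z.1 - primitive B w.1) * B z.1 / kerQ A B δ z w / 2) z.1 :=
    ((hasDerivAt_kerQ_fst hB δ w z).log hp.ne').div_const 2
  rw [partialX_eq_of_hasDerivAt ((contDiff_log_kerQ hA hB hδ w).differentiableAt_infty z) hd]
  have := (hB.coeff_pos z.1).ne'
  field_simp

theorem flux_log_kerQ_snd (hA : EllipticCoeff A c C) (hB : EllipticCoeff B c C) {δ : ℝ}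
    (hδ : 0 < δ) (w z : ℝ × ℝ) :
    B z.1 / A z.2 * dirDeriv (0, 1) (fun z => Real.log (kerQ A B δ z w) / 2) z =
      B z.1 * (primitive A z.2 - primitive A w.2) / kerQ A B δ z w := by
  have hp := kerQ_pos (A := A) (B := B) hδ z w
  have hd : HasDerivAt (fun t => Real.log (kerQ A B δ (z.1, t) w) / 2)
      (2 * (primitive A z.2 - primitive A w.2) * A z.2 / kerQ A B δ z w / 2) z.2 :=
    ((hasDerivAt_kerQ_snd hA δ w z).log hp.ne').div_const 2
  rw [partialY_eq_of_hasDerivAt ((contDiff_log_kerQ hA hB hδ w).differentiableAt_infty z) hd]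
  have := (hA.coeff_pos z.2).ne'
  field_simp

/-- In the coordinates `X = primitive B x`, `Y = primitive A y` one has `∂ₓ = B ∂_X` and `∂_y = A
∂_Y`, so the operator is `A B (∂_X² + ∂_Y²)`; and the planar Laplacian of `½ log (R² + δ²)` is `2 δ²
/ (R² + δ²)²`. -/
theorem divergence_log_kerQ (hA : EllipticCoeff A c C) (hB : EllipticCoeff B c C) {δ : ℝ}
    (hδ : 0 < δ) (w z : ℝ × ℝ) :
    dirDeriv (1, 0) (fun z => A z.2 / B z.1 *
        dirDeriv (1, 0) (fun z => Real.log (kerQ A B δ z w) / 2) z) z +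
      dirDeriv (0, 1) (fun z => B z.1 / A z.2 *
        dirDeriv (0, 1) (fun z => Real.log (kerQ A B δ z w) / 2) z) z =
    A z.2 * B z.1 * (2 * δ ^ 2 / kerQ A B δ z w ^ 2) := by
  have hQ := contDiff_kerQ_left hA hB δ w
  have hAs := hA.smooth
  have hBs := hB.smooth
  have hPA := hA.contDiff_primitive
  have hPB := hB.contDiff_primitive
  simp_rw [flux_log_kerQ_fst hA hB hδ w, flux_log_kerQ_snd hA hB hδ w]
  have hp := kerQ_pos (A := A) (B := B) hδ z w
  have sx : ContDiff ℝ ∞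
      (fun z => A z.2 * (primitive B z.1 - primitive B w.1) / kerQ A B δ z w) :=
    ContDiff.div (by fun_prop) hQ fun z => (kerQ_pos hδ z w).ne'
  have sy : ContDiff ℝ ∞
      (fun z => B z.1 * (primitive A z.2 - primitive A w.2) / kerQ A B δ z w) :=
    ContDiff.div (by fun_prop) hQ fun z => (kerQ_pos hδ z w).ne'
  have dx : HasDerivAt
      (fun t => A z.2 * (primitive B t - primitive B w.1) / kerQ A B δ (t, z.2) w)
      ((A z.2 * B z.1 * kerQ A B δ z w - A z.2 * (primitive B z.1 - primitive B w.1) *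
        (2 * (primitive B z.1 - primitive B w.1) * B z.1)) / kerQ A B δ z w ^ 2) z.1 :=
    (((hB.hasDerivAt_primitive z.1).sub_const (primitive B w.1)).const_mul (A z.2)).fun_div
      (hasDerivAt_kerQ_fst hB δ w z) hp.ne'
  have dy : HasDerivAt
      (fun t => B z.1 * (primitive A t - primitive A w.2) / kerQ A B δ (z.1, t) w)
      ((B z.1 * A z.2 * kerQ A B δ z w - B z.1 * (primitive A z.2 - primitive A w.2) *
        (2 * (primitive A z.2 - primitive A w.2) * A z.2)) / kerQ A B δ z w ^ 2) z.2 :=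
    (((hA.hasDerivAt_primitive z.2).sub_const (primitive A w.2)).const_mul (B z.1)).fun_div
      (hasDerivAt_kerQ_snd hA δ w z) hp.ne'
  rw [partialX_eq_of_hasDerivAt (sx.differentiableAt_infty z) dx,
    partialY_eq_of_hasDerivAt (sy.differentiableAt_infty z) dy]
  have hd : kerQ A B δ z w = (primitive B z.1 - primitive B w.1) ^ 2 +
    (primitive A z.2 - primitive A w.2) ^ 2 + δ ^ 2 := rfl
  rw [← add_div, ← mul_div_assoc]
  congr 1
  rw [hd]
  ring

theorem LocalSolution.kernel_identity {U : Set (ℝ × ℝ)} {u ux uy F : ℝ × ℝ → ℝ}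
    (hA : EllipticCoeff A c C) (hB : EllipticCoeff B c C)
    (h : LocalSolution U (fun z => A z.2 ^ 2) (fun z => B z.1 ^ 2) u ux uy F)
    {η : ℝ × ℝ → ℝ} (hη : IsTestFunction U η) :
    ∃ c₀ c₁ c₂ ζ : ℝ × ℝ → ℝ, IsTestFunction U c₀ ∧ IsTestFunction U c₁ ∧ IsTestFunction U c₂ ∧
      IsTestFunction U ζ ∧ ∀ (δ : ℝ), 0 < δ → ∀ w : ℝ × ℝ,
        ∫ z, (u z * η z) * (A z.2 * B z.1 * (2 * δ ^ 2 / kerQ A B δ z w ^ 2)) =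
          ∫ z, (u z * c₀ z + ux z * c₁ z + uy z * c₂ z - F z * ζ z) *
            (Real.log (kerQ A B δ z w) / 2) := by
  have hAs := hA.smooth
  have hBs := hB.smooth
  have hA0 : ∀ z : ℝ × ℝ, A z.2 ≠ 0 := fun z => (hA.coeff_pos z.2).ne'
  have hB0 : ∀ z : ℝ × ℝ, B z.1 ≠ 0 := fun z => (hB.coeff_pos z.1).ne'
  -- Division by `A B` changes the coefficients `A²`, `B²` into `A / B`, `B / A`, those of the
  -- Laplacian in the flattened coordinates.
  have hζ : IsTestFunction U (fun z => η z * (1 / (A z.2 * B z.1))) :=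
    hη.mul_smooth (ContDiff.div (by fun_prop) (by fun_prop) fun z => mul_ne_zero (hA0 z) (hB0 z))
  obtain ⟨c₀, c₁, c₂, h0, h1, h2, H⟩ := h.adjoint (by fun_prop) (by fun_prop)
    (p := fun z => A z.2 / B z.1) (q := fun z => B z.1 / A z.2)
    (ContDiff.div (by fun_prop) (by fun_prop) hB0) (ContDiff.div (by fun_prop) (by fun_prop) hA0)
    hη hζ
    (fun z => by have := hA0 z; have := hB0 z; field_simp)
    (fun z => by have := hA0 z; have := hB0 z; field_simp)
  refine ⟨c₀, c₁, c₂, _, h0, h1, h2, hζ, fun δ hδ w => ?_⟩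
  rw [← H _ (contDiff_log_kerQ hA hB hδ w)]
  congr 1 with z
  rw [divergence_log_kerQ hA hB hδ w z]

end

/-! ### Bounds for the logarithmic kernel by products of one-dimensional powers. -/

theorem exists_lintegral_abs_sub_rpow_le {β : ℝ} (h0 : 0 < β) (h1 : β < 1) :
    ∃ C : ℝ≥0∞, C ≠ ⊤ ∧ ∀ a ∈ Ioo (0 : ℝ) 1,
      ∫⁻ x in Ioo (0 : ℝ) 1, ENNReal.ofReal (|x - a| ^ (-β)) ≤ C := by
  let g : ℝ → ℝ≥0∞ := (Ioo (0 : ℝ) 1).indicator fun s => ENNReal.ofReal (s ^ (-β))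
  have hg : Measurable g :=
    (Measurable.ennreal_ofReal (by fun_prop)).indicator measurableSet_Ioo
  have hfin : ∫⁻ s, g s ≠ ⊤ := by
    have h := (intervalIntegral.integrableOn_Ioo_rpow_iff (s := -β) one_pos).2 (by linarith)
    have h2 := h.lintegral_lt_top
    simp only [g]
    rw [lintegral_indicator measurableSet_Ioo]
    exact h2.ne
  refine ⟨(∫⁻ s, g s) + ∫⁻ s, g s, by simp [hfin], fun a ha => ?_⟩
  calc ∫⁻ x in Ioo (0 : ℝ) 1, ENNReal.ofReal (|x - a| ^ (-β))
      ≤ ∫⁻ x in Ioo (0 : ℝ) 1, (g (x - a) + g (a - x)) := by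
        refine setLIntegral_mono' measurableSet_Ioo fun x hx => ?_
        rcases lt_trichotomy x a with h | h | h
        · have : a - x ∈ Ioo (0 : ℝ) 1 := ⟨by linarith, by linarith [hx.1, ha.2]⟩
          rw [show g (a - x) = _ from indicator_of_mem this _, abs_of_neg (by linarith), neg_sub]
          exact le_add_self
        -- On the diagonal the real power `0 ^ (-β)` is `0` by convention.
        · rw [h, sub_self, abs_zero, Real.zero_rpow (by linarith)]
          simp
        · have : x - a ∈ Ioo (0 : ℝ) 1 := ⟨by linarith, by linarith [hx.2, ha.1]⟩
          rw [show g (x - a) = _ from indicator_of_mem this _, abs_of_pos (by linarith)]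
          exact le_self_add
    _ ≤ ∫⁻ x, (g (x - a) + g (a - x)) := setLIntegral_le_lintegral _ _
    _ = _ := by
        rw [lintegral_add_left (by fun_prop), lintegral_sub_right_eq_self g,
          lintegral_sub_left_eq_self g]

/-- The product of powers which dominates the logarithmic kernel. -/
noncomputable def singKer (β : ℝ) (z w : ℝ × ℝ) : ℝ := |z.1 - w.1| ^ (-β) * |z.2 - w.2| ^ (-β)

theorem singKer_nonneg (β : ℝ) (z w : ℝ × ℝ) : 0 ≤ singKer β z w := by
  unfold singKer; positivity

theorem measurable_singKer (β : ℝ) (w : ℝ × ℝ) : Measurable fun z => singKer β z w := by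
  unfold singKer
  fun_prop

theorem singKer_rpow (β r : ℝ) (z w : ℝ × ℝ) : singKer β z w ^ r = singKer (β * r) z w := by
  unfold singKer
  rw [Real.mul_rpow (by positivity) (by positivity), ← Real.rpow_mul (abs_nonneg _),
    ← Real.rpow_mul (abs_nonneg _), neg_mul]

theorem exists_lintegral_singKer_le {β : ℝ} (h0 : 0 < β) (h1 : β < 1) :
    ∃ C : ℝ≥0∞, C ≠ ⊤ ∧ ∀ w ∈ unitSquare,
      ∫⁻ z in unitSquare, ENNReal.ofReal (singKer β z w) ≤ C := by
  obtain ⟨C, hC, h⟩ := exists_lintegral_abs_sub_rpow_le h0 h1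
  refine ⟨C * C, ENNReal.mul_ne_top hC hC, fun w hw => ?_⟩
  have e : ∀ z : ℝ × ℝ, ENNReal.ofReal (singKer β z w) =
      ENNReal.ofReal (|z.1 - w.1| ^ (-β)) * ENNReal.ofReal (|z.2 - w.2| ^ (-β)) := fun z =>
    ENNReal.ofReal_mul (by positivity)
  simp_rw [e]
  rw [unitSquare, Measure.volume_eq_prod, ← Measure.prod_restrict,
    lintegral_prod_mul (f := fun x => ENNReal.ofReal (|x - w.1| ^ (-β)))
      (g := fun x => ENNReal.ofReal (|x - w.2| ^ (-β))) (by fun_prop) (by fun_prop)]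
  exact mul_le_mul' (h _ hw.1) (h _ hw.2)

/-- Hölder's inequality: the `s`-th power of `singKer β` is `singKer (β * s)`, whose integral is
bounded uniformly in the pole when `β * s < 1`. -/
theorem exists_lintegral_mul_singKer_le {r s β : ℝ} (hrs : r.HolderConjugate s) (h0 : 0 < β)
    (h1 : β * s < 1) {H : ℝ × ℝ → ℝ} (hH : MemLp H (ENNReal.ofReal r)) :
    ∃ C : ℝ≥0∞, C ≠ ⊤ ∧ ∀ w ∈ unitSquare,
      ∫⁻ z in unitSquare, ‖H z‖ₑ * ENNReal.ofReal (singKer β z w) ≤ C := by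
  have hs := hrs.symm.pos
  have hr := hrs.pos
  obtain ⟨C, hC, h⟩ := exists_lintegral_singKer_le (mul_pos h0 hs) h1
  have hHr := (hH.restrict unitSquare).eLpNorm_lt_top
  rw [eLpNorm_eq_lintegral_rpow_enorm_toReal (by simpa using hr) ENNReal.ofReal_ne_top,
    ENNReal.toReal_ofReal hr.le] at hHr
  refine ⟨_, ENNReal.mul_ne_top hHr.ne (ENNReal.rpow_ne_top_of_nonneg (y := 1 / s)
    (by positivity) hC), fun w hw => ?_⟩
  refine (ENNReal.lintegral_mul_le_Lp_mul_Lq (volume.restrict unitSquare) hrs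
    (f := fun z => ‖H z‖ₑ) (g := fun z => ENNReal.ofReal (singKer β z w))
    hH.1.restrict.enorm (measurable_singKer β w).ennreal_ofReal.aemeasurable).trans ?_
  gcongr
  refine le_trans (le_of_eq ?_) (h w hw)
  congr 1 with z
  rw [ENNReal.ofReal_rpow_of_nonneg (singKer_nonneg _ _ _) hs.le, singKer_rpow]

theorem ae_ne_and_ne (w : ℝ × ℝ) :
    ∀ᵐ z ∂(volume.restrict unitSquare), z ∈ unitSquare ∧ z.1 ≠ w.1 ∧ z.2 ≠ w.2 := by
  have hS : MeasurableSet unitSquare := measurableSet_Ioo.prod measurableSet_Ioo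
  have h1 : ∀ᵐ z : ℝ × ℝ, z.1 ≠ w.1 :=
    (Measure.quasiMeasurePreserving_fst (μ := (volume : Measure ℝ))
      (ν := (volume : Measure ℝ))).ae (Measure.ae_ne volume w.1)
  have h2 : ∀ᵐ z : ℝ × ℝ, z.2 ≠ w.2 :=
    (Measure.quasiMeasurePreserving_snd (μ := (volume : Measure ℝ))
      (ν := (volume : Measure ℝ))).ae (Measure.ae_ne volume w.2)
  filter_upwards [ae_restrict_mem hS, ae_restrict_of_ae h1, ae_restrict_of_ae h2] with z a b d
  exact ⟨a, b, d⟩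

theorem abs_log_le_rpow_add {x β : ℝ} (hx : 0 < x) (hβ : 0 < β) :
    |Real.log x| ≤ (x ^ β + x ^ (-β)) / β := by
  have h1 := Real.log_le_rpow_div hx.le hβ
  have h2 := Real.log_le_rpow_div (inv_pos.2 hx).le hβ
  rw [Real.log_inv, Real.inv_rpow hx.le, ← Real.rpow_neg hx.le] at h2
  have p1 : 0 ≤ x ^ β / β := by positivity
  have p2 : 0 ≤ x ^ (-β) / β := by positivity
  rw [add_div, abs_le]
  constructor <;> linarith

/-- For `s ≤ t`, `log (t / s) = log ((t / s) ^ α) / α ≤ ((t / s) ^ α - 1) / α`, and `t ^ α - s ^ α ≤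
(t - s) ^ α` by subadditivity of the power. The term with `t` is added only for symmetry. -/
theorem abs_log_sub_log_le {s t α : ℝ} (hs : 0 < s) (ht : 0 < t) (h0 : 0 < α) (h1 : α ≤ 1) :
    |Real.log s - Real.log t| ≤ |s - t| ^ α * (s ^ (-α) + t ^ (-α)) / α := by
  wlog hst : s ≤ t generalizing s t
  · rw [abs_sub_comm, abs_sub_comm s t, add_comm]
    exact this ht hs (le_of_not_ge hst)
  have hlog : Real.log s ≤ Real.log t := Real.log_le_log hs hst
  rw [abs_sub_comm, abs_sub_comm s t, abs_of_nonneg (sub_nonneg.2 hlog),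
    abs_of_nonneg (sub_nonneg.2 hst), ← Real.log_div ht.ne' hs.ne']
  have e1 : Real.log (t / s) = Real.log ((t / s) ^ α) / α := by
    rw [Real.log_rpow (by positivity)]; field_simp
  have e2 : (t / s) ^ α - 1 ≤ (t - s) ^ α * s ^ (-α) := by
    have := Real.rpow_add_le_add_rpow (sub_nonneg.2 hst) hs.le h0.le h1
    rw [sub_add_cancel] at this
    rw [Real.div_rpow ht.le hs.le, Real.rpow_neg hs.le, ← div_eq_mul_inv, sub_le_iff_le_add,
      div_add_one (by positivity)]
    gcongr
  rw [e1]
  gcongr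
  have e3 := Real.log_le_sub_one_of_pos (x := (t / s) ^ α) (by positivity)
  have e4 : 0 ≤ (t - s) ^ α * t ^ (-α) :=
    mul_nonneg (Real.rpow_nonneg (sub_nonneg.2 hst) _) (by positivity)
  linarith

section

variable {A B : ℝ → ℝ} {c C : ℝ}

/-- From `X² + Y² ≥ 2 |X| |Y|` and the fact that the primitives stretch by at least `c`. The product
form separates the variables, and the bound does not involve `δ`. -/
theorem mul_abs_le_kerQ (hA : EllipticCoeff A c C) (hB : EllipticCoeff B c C) (δ : ℝ)
    (z w : ℝ × ℝ) : 2 * c ^ 2 * (|z.1 - w.1| * |z.2 - w.2|) ≤ kerQ A B δ z w := by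
  have h1 := hB.mul_abs_le_primitive z.1 w.1
  have h2 := hA.mul_abs_le_primitive z.2 w.2
  have hc := hA.pos
  unfold kerQ
  rw [← sq_abs (primitive B z.1 - _), ← sq_abs (primitive A z.2 - _)]
  have h3 := mul_le_mul h1 h2 (by positivity) (abs_nonneg _)
  nlinarith [sq_nonneg (|primitive B z.1 - primitive B w.1| -
    |primitive A z.2 - primitive A w.2|), sq_nonneg δ]

theorem kerQ_rpow_neg_le (hA : EllipticCoeff A c C) (hB : EllipticCoeff B c C) (δ : ℝ) {β : ℝ}
    (hβ : 0 < β) {z w : ℝ × ℝ} (h1 : z.1 ≠ w.1) (h2 : z.2 ≠ w.2) :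
    kerQ A B δ z w ^ (-β) ≤ (2 * c ^ 2) ^ (-β) * singKer β z w := by
  have hc := hA.pos
  have p1 := abs_pos.2 (sub_ne_zero.2 h1)
  have p2 := abs_pos.2 (sub_ne_zero.2 h2)
  unfold singKer
  rw [← Real.mul_rpow (by positivity) (by positivity),
    ← Real.mul_rpow (by positivity) (by positivity)]
  exact Real.rpow_le_rpow_of_nonpos (by positivity) (mul_abs_le_kerQ hA hB δ z w) (by linarith)

theorem kerQ_pos_of_ne (hA : EllipticCoeff A c C) (hB : EllipticCoeff B c C) (δ : ℝ)
    {z w : ℝ × ℝ} (h1 : z.1 ≠ w.1) (h2 : z.2 ≠ w.2) : 0 < kerQ A B δ z w := by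
  have hc := hA.pos
  have p1 := abs_pos.2 (sub_ne_zero.2 h1)
  have p2 := abs_pos.2 (sub_ne_zero.2 h2)
  exact lt_of_lt_of_le (by positivity) (mul_abs_le_kerQ hA hB δ z w)

theorem abs_sub_lt_one_of_mem {x y : ℝ} (hx : x ∈ Ioo (0 : ℝ) 1) (hy : y ∈ Ioo (0 : ℝ) 1) :
    |x - y| < 1 := by
  rw [abs_lt]
  constructor <;> linarith [hx.1, hx.2, hy.1, hy.2]

theorem one_le_singKer {β : ℝ} (hβ : 0 < β) {z w : ℝ × ℝ} (hz : z ∈ unitSquare)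
    (hw : w ∈ unitSquare) (h1 : z.1 ≠ w.1) (h2 : z.2 ≠ w.2) : 1 ≤ singKer β z w := by
  refine one_le_mul_of_one_le_of_one_le ?_ ?_
  · exact Real.one_le_rpow_of_pos_of_le_one_of_nonpos (abs_pos.2 (sub_ne_zero.2 h1))
      (abs_sub_lt_one_of_mem hz.1 hw.1).le (by linarith)
  · exact Real.one_le_rpow_of_pos_of_le_one_of_nonpos (abs_pos.2 (sub_ne_zero.2 h2))
      (abs_sub_lt_one_of_mem hz.2 hw.2).le (by linarith)

theorem kerQ_le (hA : EllipticCoeff A c C) (hB : EllipticCoeff B c C) {δ : ℝ} (h0 : 0 ≤ δ)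
    (h1 : δ ≤ 1) {z w : ℝ × ℝ} (hz : z ∈ unitSquare) (hw : w ∈ unitSquare) :
    kerQ A B δ z w ≤ 2 * C ^ 2 + 1 := by
  have hC := hA.upper_pos
  have a1 := hB.abs_primitive_le z.1 w.1
  have a2 := hA.abs_primitive_le z.2 w.2
  have b1 := (abs_sub_lt_one_of_mem hz.1 hw.1).le
  have b2 := (abs_sub_lt_one_of_mem hz.2 hw.2).le
  have c1 : |primitive B z.1 - primitive B w.1| ≤ C := a1.trans (by nlinarith)
  have c2 : |primitive A z.2 - primitive A w.2| ≤ C := a2.trans (by nlinarith)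
  have d1 := sq_le_sq' (by linarith [abs_nonneg (primitive B z.1 - primitive B w.1)]) c1
  have d2 := sq_le_sq' (by linarith [abs_nonneg (primitive A z.2 - primitive A w.2)]) c2
  unfold kerQ
  rw [← sq_abs (primitive B z.1 - _), ← sq_abs (primitive A z.2 - _)]
  nlinarith

/-- The logarithm is bounded by a positive and a negative power of `kerQ`; the positive one is
bounded on the square and is absorbed because `singKer` is at least `1` there. Uniformity in `δ`,
with `δ = 0` included, provides the majorant for the limit `δ → 0`. -/
theorem exists_abs_log_kerQ_le (hA : EllipticCoeff A c C) (hB : EllipticCoeff B c C) {β : ℝ}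
    (hβ : 0 < β) : ∃ K : ℝ, 0 ≤ K ∧ ∀ δ : ℝ, 0 ≤ δ → δ ≤ 1 → ∀ z ∈ unitSquare, ∀ w ∈ unitSquare,
      z.1 ≠ w.1 → z.2 ≠ w.2 → |Real.log (kerQ A B δ z w) / 2| ≤ K * singKer β z w := by
  refine ⟨((2 * C ^ 2 + 1) ^ β + (2 * c ^ 2) ^ (-β)) / β / 2, by positivity,
    fun δ h0 h1 z hz w hw e1 e2 => ?_⟩
  have hp := kerQ_pos_of_ne hA hB δ e1 e2
  have k1 := abs_log_le_rpow_add hp hβ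
  have k2 := kerQ_rpow_neg_le hA hB δ hβ e1 e2
  have k3 : kerQ A B δ z w ^ β ≤ (2 * C ^ 2 + 1) ^ β * singKer β z w :=
    (Real.rpow_le_rpow hp.le (kerQ_le hA hB h0 h1 hz hw) hβ.le).trans
      (le_mul_of_one_le_right (by positivity) (one_le_singKer hβ hz hw e1 e2))
  rw [abs_div, abs_of_pos (two_pos : (0 : ℝ) < 2)]
  calc _ ≤ (kerQ A B δ z w ^ β + kerQ A B δ z w ^ (-β)) / β / 2 := by gcongr
    _ ≤ ((2 * C ^ 2 + 1) ^ β * singKer β z w + (2 * c ^ 2) ^ (-β) * singKer β z w) / β / 2 := by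
      gcongr
    _ = _ := by ring

/-- The complex modulus supplies the Euclidean norm and its triangle inequality, since the norm of
`ℝ × ℝ` is the maximum norm. -/
theorem sqrt_kerQ_zero_eq (z w : ℝ × ℝ) :
    √(kerQ A B 0 z w) = ‖((primitive B z.1 : ℂ) + primitive A z.2 * Complex.I) -
      (primitive B w.1 + primitive A w.2 * Complex.I)‖ := by
  have : ((primitive B z.1 : ℂ) + primitive A z.2 * Complex.I) -
      (primitive B w.1 + primitive A w.2 * Complex.I) =
      ((primitive B z.1 - primitive B w.1 : ℝ) : ℂ) +
        ((primitive A z.2 - primitive A w.2 : ℝ) : ℂ) * Complex.I := by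
    push_cast; ring
  rw [this, Complex.norm_add_mul_I]
  simp [kerQ]

theorem abs_sqrt_kerQ_sub_le (hA : EllipticCoeff A c C) (hB : EllipticCoeff B c C)
    (z w w' : ℝ × ℝ) : |√(kerQ A B 0 z w) - √(kerQ A B 0 z w')| ≤ 2 * C * dist w w' := by
  rw [sqrt_kerQ_zero_eq, sqrt_kerQ_zero_eq]
  refine (abs_norm_sub_norm_le _ _).trans ?_
  rw [sub_sub_sub_cancel_left, ← sqrt_kerQ_zero_eq]
  have hC := hA.upper_pos
  have a1 := hB.abs_primitive_le w'.1 w.1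
  have a2 := hA.abs_primitive_le w'.2 w.2
  have b1 : |w'.1 - w.1| ≤ dist w w' := by
    rw [dist_comm, Prod.dist_eq, ← Real.dist_eq]; exact le_max_left _ _
  have b2 : |w'.2 - w.2| ≤ dist w w' := by
    rw [dist_comm, Prod.dist_eq, ← Real.dist_eq]; exact le_max_right _ _
  have c1 : |primitive B w'.1 - primitive B w.1| ≤ C * dist w w' := a1.trans (by gcongr)
  have c2 : |primitive A w'.2 - primitive A w.2| ≤ C * dist w w' := a2.trans (by gcongr)
  have hd : 0 ≤ C * dist w w' := by positivity
  refine Real.sqrt_le_iff.2 ⟨by positivity, ?_⟩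
  have d1 := sq_le_sq' (by linarith [abs_nonneg (primitive B w'.1 - primitive B w.1)]) c1
  have d2 := sq_le_sq' (by linarith [abs_nonneg (primitive A w'.2 - primitive A w.2)]) c2
  unfold kerQ
  rw [← sq_abs (primitive B w'.1 - _), ← sq_abs (primitive A w'.2 - _)]
  nlinarith

/-- Half the logarithm of `kerQ` is the logarithm of the distance `√kerQ`, which is Lipschitz in the
pole. The power `-α` of the distance is the power `-α / 2` of `kerQ`; the resulting `singKer (α /
2)` is square integrable exactly because `α < 1`. -/
theorem exists_abs_log_kerQ_sub_le (hA : EllipticCoeff A c C) (hB : EllipticCoeff B c C) {α : ℝ}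
    (h0 : 0 < α) (h1 : α ≤ 1) : ∃ K : ℝ, 0 ≤ K ∧ ∀ z w w' : ℝ × ℝ,
      z.1 ≠ w.1 → z.2 ≠ w.2 → z.1 ≠ w'.1 → z.2 ≠ w'.2 →
      |Real.log (kerQ A B 0 z w) / 2 - Real.log (kerQ A B 0 z w') / 2| ≤
        K * dist w w' ^ α * (singKer (α / 2) z w + singKer (α / 2) z w') := by
  have hC := hA.upper_pos
  refine ⟨(2 * C) ^ α * (2 * c ^ 2) ^ (-(α / 2)) / α, by positivity,
    fun z w w' e1 e2 e3 e4 => ?_⟩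
  have hp := kerQ_pos_of_ne hA hB 0 e1 e2
  have hp' := kerQ_pos_of_ne hA hB 0 e3 e4
  rw [← Real.log_sqrt hp.le, ← Real.log_sqrt hp'.le]
  refine (abs_log_sub_log_le (Real.sqrt_pos.2 hp) (Real.sqrt_pos.2 hp') h0 h1).trans ?_
  have hr : ∀ x : ℝ, 0 < x → √x ^ (-α) = x ^ (-(α / 2)) := fun x hx => by
    rw [Real.sqrt_eq_rpow, ← Real.rpow_mul hx.le]
    congr 1
    ring
  have k1 := kerQ_rpow_neg_le hA hB 0 (half_pos h0) e1 e2
  have k2 := kerQ_rpow_neg_le hA hB 0 (half_pos h0) e3 e4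
  have k3 : |√(kerQ A B 0 z w) - √(kerQ A B 0 z w')| ^ α ≤ (2 * C) ^ α * dist w w' ^ α := by
    rw [← Real.mul_rpow (by positivity) dist_nonneg]
    exact Real.rpow_le_rpow (abs_nonneg _) (abs_sqrt_kerQ_sub_le hA hB z w w') h0.le
  rw [hr _ hp, hr _ hp']
  calc _ ≤ ((2 * C) ^ α * dist w w' ^ α) * ((2 * c ^ 2) ^ (-(α / 2)) * singKer (α / 2) z w +
        (2 * c ^ 2) ^ (-(α / 2)) * singKer (α / 2) z w') / α := by gcongr
    _ = _ := by ring

end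

/-! ### The flattening change of variables and the approximate identity. -/

section

variable {A B : ℝ → ℝ} {c C : ℝ}

/-- The change of variables which turns the operator into a Laplacian. -/
noncomputable def flatten (A B : ℝ → ℝ) (z : ℝ × ℝ) : ℝ × ℝ := (primitive B z.1, primitive A z.2)

/-- The change of variables as a homeomorphism. -/
noncomputable def flattenHomeomorph (hA : EllipticCoeff A c C) (hB : EllipticCoeff B c C) :
    ℝ × ℝ ≃ₜ ℝ × ℝ :=
  hB.primitiveHomeomorph.prodCongr hA.primitiveHomeomorph

theorem flattenHomeomorph_apply (hA : EllipticCoeff A c C) (hB : EllipticCoeff B c C)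
    (z : ℝ × ℝ) : flattenHomeomorph hA hB z = flatten A B z := rfl

theorem integral_comp_flatten (hA : EllipticCoeff A c C) (hB : EllipticCoeff B c C)
    (g : ℝ × ℝ → ℝ) : ∫ w, (A w.2 * B w.1) * g (flatten A B w) = ∫ Z, g Z := by
  have hd : ∀ z ∈ (univ : Set (ℝ × ℝ)), HasFDerivWithinAt (flatten A B)
      ((B z.1 • ContinuousLinearMap.id ℝ ℝ).prodMap (A z.2 • ContinuousLinearMap.id ℝ ℝ))
      univ z := by
    intro z _
    have h1 : HasFDerivAt (primitive B) (B z.1 • ContinuousLinearMap.id ℝ ℝ) z.1 := by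
      exact (hB.hasDerivAt_primitive z.1).hasFDerivAt.congr_fderiv (by ext; simp)
    have h2 : HasFDerivAt (primitive A) (A z.2 • ContinuousLinearMap.id ℝ ℝ) z.2 := by
      exact (hA.hasDerivAt_primitive z.2).hasFDerivAt.congr_fderiv (by ext; simp)
    exact (HasFDerivAt.prodMap z h1 h2).hasFDerivWithinAt
  have hinj : InjOn (flatten A B) univ := (flattenHomeomorph hA hB).injective.injOn
  have himg : flatten A B '' univ = univ := by
    rw [image_univ]; exact (flattenHomeomorph hA hB).surjective.range_eq
  have := integral_image_eq_integral_abs_det_fderiv_smul volume MeasurableSet.univ hd hinj g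
  rw [himg, setIntegral_univ, setIntegral_univ] at this
  rw [this]
  congr 1 with z
  rw [ContinuousLinearMap.det, ContinuousLinearMap.coe_prodMap, LinearMap.det_prodMap]
  simp [abs_of_pos (hA.coeff_pos z.2), abs_of_pos (hB.coeff_pos z.1), mul_comm]

/-- The profile of the approximate identity obtained from the regularised logarithm. -/
noncomputable def profile (Z : ℝ × ℝ) : ℝ := 2 / (Z.1 ^ 2 + Z.2 ^ 2 + 1) ^ 2

theorem profile_pos (Z : ℝ × ℝ) : 0 < profile Z := by unfold profile; positivity

theorem continuous_profile : Continuous profile := by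
  unfold profile
  exact continuous_const.div (by fun_prop) fun Z => by positivity

/-- Comparison with a product of one-variable functions, from `(1 + X²) (1 + Y²) ≤ (1 + X² + Y²)²`.
-/
theorem integrable_profile : Integrable profile := by
  have h := (integrable_inv_one_add_sq.mul_prod integrable_inv_one_add_sq).const_mul 2
  rw [← Measure.volume_eq_prod] at h
  refine h.mono' continuous_profile.aestronglyMeasurable (Eventually.of_forall fun Z => ?_)
  rw [Real.norm_of_nonneg (profile_pos Z).le, profile, ← mul_inv, div_eq_mul_inv]
  gcongr
  nlinarith [sq_nonneg Z.1, sq_nonneg Z.2, mul_nonneg (sq_nonneg Z.1) (sq_nonneg Z.2)]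

/-- The mass of the profile. -/
noncomputable def profileMass : ℝ := ∫ Z, profile Z

theorem profileMass_pos : 0 < profileMass := by
  refine (integral_pos_iff_support_of_nonneg (fun Z => (profile_pos Z).le)
    integrable_profile).2 ?_
  rw [show Function.support profile = univ from
    eq_univ_of_forall fun Z => (profile_pos Z).ne']
  simp

/-- The weight `A B` is the Jacobian of `flatten`. In the new coordinates the kernel is `δ⁻² profile
(· / δ)`, centred at the image of `z`, and the substitution `flatten A B z - δ • Y` removes the
scale. -/
theorem integral_mul_kernel (hA : EllipticCoeff A c C) (hB : EllipticCoeff B c C) {δ : ℝ}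
    (hδ : 0 < δ) (ψ : ℝ × ℝ → ℝ) (z : ℝ × ℝ) :
    ∫ w, (A w.2 * B w.1) * (ψ w * (2 * δ ^ 2 / kerQ A B δ z w ^ 2)) =
      ∫ Y, profile Y * ψ ((flattenHomeomorph hA hB).symm (flatten A B z - δ • Y)) := by
  set Φ := flattenHomeomorph hA hB
  let g : ℝ × ℝ → ℝ := fun Z => ψ (Φ.symm Z) * (2 * δ ^ 2 /
    (((flatten A B z).1 - Z.1) ^ 2 + ((flatten A B z).2 - Z.2) ^ 2 + δ ^ 2) ^ 2)
  have h1 := integral_comp_flatten hA hB g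
  have h2 : ∫ w, (A w.2 * B w.1) * (ψ w * (2 * δ ^ 2 / kerQ A B δ z w ^ 2)) = ∫ Z, g Z := by
    rw [← h1]
    congr 1 with w
    have : Φ.symm (flatten A B w) = w := Φ.symm_apply_apply w
    simp only [g, this]
    rfl
  have h3 : ∫ Z, g Z = ∫ Z, g (flatten A B z - Z) :=
    (integral_sub_left_eq_self g volume (flatten A B z)).symm
  have h4 := Measure.integral_comp_smul (volume : Measure (ℝ × ℝ))
    (fun Z => g (flatten A B z - Z)) δ
  rw [h2, h3]
  have h5 : ∫ Z, g (flatten A B z - Z) = δ ^ 2 * ∫ Y, g (flatten A B z - δ • Y) := by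
    rw [h4]
    simp only [Module.finrank_prod, Module.finrank_self, smul_eq_mul]
    rw [abs_of_pos (by positivity)]
    field_simp
  rw [h5, ← integral_const_mul]
  congr 1 with Y
  simp only [g, profile, Prod.fst_sub, Prod.snd_sub, sub_sub_cancel, Prod.smul_fst, Prod.smul_snd,
    smul_eq_mul]
  have : (δ * Y.1) ^ 2 + (δ * Y.2) ^ 2 + δ ^ 2 = δ ^ 2 * (Y.1 ^ 2 + Y.2 ^ 2 + 1) := by ring
  rw [this]
  have hp : Y.1 ^ 2 + Y.2 ^ 2 + 1 ≠ 0 := by positivity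
  field_simp

theorem _root_.Continuous.kerQ {X : Type*} [TopologicalSpace X] {f g : X → ℝ × ℝ}
    (hA : EllipticCoeff A c C) (hB : EllipticCoeff B c C) (δ : ℝ) (hf : Continuous f)
    (hg : Continuous g) : Continuous fun x => kerQ A B δ (f x) (g x) := by
  have := hA.continuous_primitive
  have := hB.continuous_primitive
  unfold SubElliptic.kerQ
  fun_prop

theorem _root_.Continuous.kernel {X : Type*} [TopologicalSpace X] {f g : X → ℝ × ℝ}
    (hA : EllipticCoeff A c C) (hB : EllipticCoeff B c C) {δ : ℝ} (hδ : 0 < δ)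
    (hf : Continuous f) (hg : Continuous g) :
    Continuous fun x => 2 * δ ^ 2 / kerQ A B δ (f x) (g x) ^ 2 :=
  continuous_const.div ((hf.kerQ hA hB δ hg).pow 2) fun _ => (pow_pos (kerQ_pos hδ _ _) 2).ne'

theorem kernel_le {δ : ℝ} (hδ : 0 < δ) (z w : ℝ × ℝ) :
    |2 * δ ^ 2 / kerQ A B δ z w ^ 2| ≤ 2 * δ ^ 2 / (δ ^ 2) ^ 2 := by
  have := kerQ_pos (A := A) (B := B) hδ z w
  rw [abs_of_nonneg (by positivity)]
  gcongr
  unfold kerQ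
  nlinarith [sq_nonneg (primitive B z.1 - primitive B w.1),
    sq_nonneg (primitive A z.2 - primitive A w.2)]

/-- Fubini moves the kernel from the merely integrable `h` to the continuous `ψ`, where the averages
converge pointwise and stay bounded; dominated convergence does the rest. -/
theorem tendsto_integral_kernel (hA : EllipticCoeff A c C) (hB : EllipticCoeff B c C)
    {h ψ : ℝ × ℝ → ℝ} (hh : Integrable h) (hψ : Continuous ψ) (hψc : HasCompactSupport ψ)
    {δ : ℕ → ℝ} (hδ : ∀ n, 0 < δ n) (hlim : Tendsto δ atTop (𝓝 0)) :
    Tendsto (fun n => ∫ w, (A w.2 * B w.1) * ψ w *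
      ∫ z, h z * (2 * δ n ^ 2 / kerQ A B (δ n) z w ^ 2)) atTop
      (𝓝 (∫ z, h z * (profileMass * ψ z))) := by
  obtain ⟨K, hK⟩ := hψc.exists_bound_of_continuous hψ
  have hm : Continuous fun w : ℝ × ℝ => A w.2 * B w.1 * ψ w := by
    have := hA.continuous
    have := hB.continuous
    fun_prop
  have hmi : Integrable fun w : ℝ × ℝ => A w.2 * B w.1 * ψ w :=
    hm.integrable_of_hasCompactSupport hψc.mul_left
  have e : ∀ n, ∫ w, (A w.2 * B w.1) * ψ w *
      ∫ z, h z * (2 * δ n ^ 2 / kerQ A B (δ n) z w ^ 2) =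
      ∫ z, h z * ∫ Y, profile Y *
        ψ ((flattenHomeomorph hA hB).symm (flatten A B z - δ n • Y)) := by
    intro n
    have hint : Integrable (Function.uncurry fun (w z : ℝ × ℝ) =>
        (A w.2 * B w.1) * ψ w * (h z * (2 * δ n ^ 2 / kerQ A B (δ n) z w ^ 2)))
        (volume.prod volume) := by
      have h1 : Integrable (fun p : (ℝ × ℝ) × ℝ × ℝ => (A p.1.2 * B p.1.1 * ψ p.1) * h p.2)
          (volume.prod volume) := hmi.mul_prod hh
      have h2 : AEStronglyMeasurable (fun p : (ℝ × ℝ) × ℝ × ℝ =>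
          2 * δ n ^ 2 / kerQ A B (δ n) p.2 p.1 ^ 2) (volume.prod volume) :=
        (continuous_snd.kernel hA hB (hδ n) continuous_fst).aestronglyMeasurable
      have h3 := h1.mul_bdd h2 (Eventually.of_forall fun p => kernel_le (hδ n) p.2 p.1)
      refine h3.congr (Eventually.of_forall fun p => ?_)
      simp only [Function.uncurry]
      ring
    simp_rw [← integral_const_mul]
    rw [integral_integral_swap hint]
    congr 1 with z
    rw [integral_const_mul, ← integral_mul_kernel hA hB (hδ n), ← integral_const_mul]
    congr 1 with w
    ring
  simp_rw [e]
  have hcont : ∀ n (z : ℝ × ℝ), Continuous fun Y : ℝ × ℝ =>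
      ψ ((flattenHomeomorph hA hB).symm (flatten A B z - δ n • Y)) := fun n z =>
    hψ.comp ((flattenHomeomorph hA hB).symm.continuous.comp (by fun_prop))
  have hJ : ∀ z, Tendsto (fun n => ∫ Y, profile Y *
      ψ ((flattenHomeomorph hA hB).symm (flatten A B z - δ n • Y))) atTop
      (𝓝 (profileMass * ψ z)) := by
    intro z
    have : profileMass * ψ z = ∫ Y, profile Y * ψ z := by rw [integral_mul_const, profileMass]
    rw [this]
    refine tendsto_integral_of_dominated_convergence (fun Y => profile Y * K)
      (fun n => (continuous_profile.mul (hcont n z)).aestronglyMeasurable)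
      (integrable_profile.mul_const K) (fun n => Eventually.of_forall fun Y => ?_)
      (Eventually.of_forall fun Y => ?_)
    · rw [norm_mul, Real.norm_of_nonneg (profile_pos Y).le]
      have := profile_pos Y
      gcongr
      exact hK _
    · refine Tendsto.const_mul _ ?_
      have hz : ψ z = ψ ((flattenHomeomorph hA hB).symm (flatten A B z - (0 : ℝ) • Y)) := by
        rw [zero_smul, sub_zero, ← flattenHomeomorph_apply hA hB, Homeomorph.symm_apply_apply]
      rw [hz]
      have hc : Continuous fun s : ℝ =>
          ψ ((flattenHomeomorph hA hB).symm (flatten A B z - s • Y)) :=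
        hψ.comp ((flattenHomeomorph hA hB).symm.continuous.comp (by fun_prop))
      exact (hc.tendsto 0).comp hlim
  have hcJ : ∀ n, Continuous fun z => ∫ Y, profile Y *
      ψ ((flattenHomeomorph hA hB).symm (flatten A B z - δ n • Y)) := by
    intro n
    have hfl : Continuous (flatten A B) := (flattenHomeomorph hA hB).continuous
    refine continuous_of_dominated (bound := fun Y => profile Y * K)
      (fun z => (continuous_profile.mul (hcont n z)).aestronglyMeasurable)
      (fun z => Eventually.of_forall fun Y => ?_) (integrable_profile.mul_const K)
      (Eventually.of_forall fun Y => ?_)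
    · rw [norm_mul, Real.norm_of_nonneg (profile_pos Y).le]
      have := profile_pos Y
      gcongr
      exact hK _
    · exact continuous_const.mul
        (hψ.comp ((flattenHomeomorph hA hB).symm.continuous.comp (by fun_prop)))
  refine tendsto_integral_of_dominated_convergence (fun z => ‖h z‖ * (profileMass * K))
    (fun n => hh.1.mul (hcJ n).aestronglyMeasurable)
    (hh.norm.mul_const _) (fun n => Eventually.of_forall fun z => ?_)
    (Eventually.of_forall fun z => (hJ z).const_mul _)
  rw [norm_mul]
  gcongr
  rw [profileMass, ← integral_mul_const]
  refine norm_integral_le_of_norm_le (integrable_profile.mul_const K)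
    (Eventually.of_forall fun Y => ?_)
  rw [norm_mul, Real.norm_of_nonneg (profile_pos Y).le]
  have := profile_pos Y
  gcongr
  exact hK _

end

/-! ### Logarithmic potentials and the representation of a cut-off solution. -/

theorem measurableSet_unitSquare : MeasurableSet unitSquare :=
  measurableSet_Ioo.prod measurableSet_Ioo

theorem isOpen_unitSquare : IsOpen unitSquare := isOpen_Ioo.prod isOpen_Ioo

theorem volume_unitSquare_ne_top : volume unitSquare ≠ ⊤ := by
  rw [unitSquare, Measure.volume_eq_prod, Measure.prod_prod]
  simp

instance : IsFiniteMeasure (volume.restrict unitSquare) :=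
  ⟨by simpa using volume_unitSquare_ne_top.lt_top⟩

theorem abs_integral_mul_le_of_lintegral_le {X : Type*} [MeasurableSpace X] {μ : Measure X}
    {H f g : X → ℝ} {K : ℝ} {I : ℝ≥0∞} (hI : I ≠ ⊤) (hK : 0 ≤ K)
    (hg : ∫⁻ z, ‖H z‖ₑ * ENNReal.ofReal (g z) ∂μ ≤ I) (hf : ∀ᵐ z ∂μ, |f z| ≤ K * g z) :
    |∫ z, H z * f z ∂μ| ≤ K * I.toReal := by
  have h1 : ∫⁻ z, ‖H z * f z‖ₑ ∂μ ≤ ENNReal.ofReal K * I := by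
    calc ∫⁻ z, ‖H z * f z‖ₑ ∂μ
        ≤ ∫⁻ z, ENNReal.ofReal K * (‖H z‖ₑ * ENNReal.ofReal (g z)) ∂μ := by
          refine lintegral_mono_ae (hf.mono fun z hz => ?_)
          rw [enorm_mul, mul_left_comm, ← ENNReal.ofReal_mul hK]
          gcongr
          rw [Real.enorm_eq_ofReal_abs]
          exact ENNReal.ofReal_le_ofReal hz
      _ = ENNReal.ofReal K * ∫⁻ z, ‖H z‖ₑ * ENNReal.ofReal (g z) ∂μ :=
          lintegral_const_mul' _ _ ENNReal.ofReal_ne_top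
      _ ≤ _ := by gcongr
  have h2 := (enorm_integral_le_lintegral_enorm (μ := μ) fun z => H z * f z).trans h1
  rw [Real.enorm_eq_ofReal_abs] at h2
  have h3 := (ENNReal.ofReal_le_iff_le_toReal
    (ENNReal.mul_ne_top ENNReal.ofReal_ne_top hI)).1 h2
  rwa [ENNReal.toReal_mul, ENNReal.toReal_ofReal hK] at h3

section

variable {A B : ℝ → ℝ} {c C : ℝ}

/-- The logarithmic potential of `H`. -/
noncomputable def logPotential (A B : ℝ → ℝ) (δ : ℝ) (H : ℝ × ℝ → ℝ) (w : ℝ × ℝ) : ℝ :=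
  ∫ z in unitSquare, H z * (Real.log (kerQ A B δ z w) / 2)

theorem exists_abs_logPotential_le (hA : EllipticCoeff A c C) (hB : EllipticCoeff B c C)
    {r s : ℝ} (hrs : r.HolderConjugate s) {H : ℝ × ℝ → ℝ} (hH : MemLp H (ENNReal.ofReal r)) :
    ∃ M : ℝ, ∀ δ : ℝ, 0 ≤ δ → δ ≤ 1 → ∀ w ∈ unitSquare, |logPotential A B δ H w| ≤ M := by
  have hs := hrs.symm.pos
  -- This exponent gives `β * s = 1 / 2`, inside the range of integrability.
  have hβ : (0 : ℝ) < 1 / (2 * s) := by positivity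
  obtain ⟨I, hI, h⟩ := exists_lintegral_mul_singKer_le hrs hβ
    (by rw [div_mul_eq_mul_div, one_mul, div_lt_one (by positivity)]; linarith) hH
  obtain ⟨K, hK, hker⟩ := exists_abs_log_kerQ_le hA hB hβ
  refine ⟨K * I.toReal, fun δ h0 h1 w hw => ?_⟩
  refine abs_integral_mul_le_of_lintegral_le hI hK (h w hw) ?_
  filter_upwards [ae_ne_and_ne w] with z hz
  exact hker δ h0 h1 z hz.1 w hw hz.2.1 hz.2.2

theorem tendsto_logPotential (hA : EllipticCoeff A c C) (hB : EllipticCoeff B c C)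
    {r s : ℝ} (hrs : r.HolderConjugate s) {H : ℝ × ℝ → ℝ} (hH : MemLp H (ENNReal.ofReal r))
    {δ : ℕ → ℝ} (h0 : ∀ n, 0 < δ n) (h1 : ∀ n, δ n ≤ 1) (hlim : Tendsto δ atTop (𝓝 0))
    {w : ℝ × ℝ} (hw : w ∈ unitSquare) :
    Tendsto (fun n => logPotential A B (δ n) H w) atTop (𝓝 (logPotential A B 0 H w)) := by
  have hs := hrs.symm.pos
  have hβ : (0 : ℝ) < 1 / (2 * s) := by positivity
  obtain ⟨I, hI, h⟩ := exists_lintegral_mul_singKer_le hrs hβ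
    (by rw [div_mul_eq_mul_div, one_mul, div_lt_one (by positivity)]; linarith) hH
  obtain ⟨K, hK, hker⟩ := exists_abs_log_kerQ_le hA hB hβ
  have hint : Integrable (fun z => ‖H z‖ * singKer (1 / (2 * s)) z w)
      (volume.restrict unitSquare) := by
    refine ⟨hH.1.restrict.norm.mul (measurable_singKer _ _).aestronglyMeasurable, ?_⟩
    refine lt_of_le_of_lt (lintegral_mono fun z => ?_) ((h w hw).trans_lt hI.lt_top)
    rw [enorm_mul, enorm_norm, Real.enorm_of_nonneg (singKer_nonneg _ _ _)]
  refine tendsto_integral_of_dominated_convergence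
    (fun z => K * (‖H z‖ * singKer (1 / (2 * s)) z w)) (fun n => ?_) (hint.const_mul K)
    (fun n => ?_) ?_
  · exact hH.1.restrict.mul
      (contDiff_log_kerQ hA hB (h0 n) w).continuous.aestronglyMeasurable
  · filter_upwards [ae_ne_and_ne w] with z hz
    rw [norm_mul, mul_left_comm]
    gcongr
    exact hker _ (h0 n).le (h1 n) z hz.1 w hw hz.2.1 hz.2.2
  · filter_upwards [ae_ne_and_ne w] with z hz
    refine Tendsto.const_mul _ (Tendsto.div_const ?_ 2)
    have hc : Continuous fun d => kerQ A B d z w := by unfold kerQ; fun_prop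
    exact (((Real.continuousAt_log (kerQ_pos_of_ne hA hB 0 hz.2.1 hz.2.2).ne').comp
      (f := fun d => kerQ A B d z w) hc.continuousAt).tendsto).comp hlim

theorem exists_logPotential_sub_le (hA : EllipticCoeff A c C) (hB : EllipticCoeff B c C)
    {H : ℝ × ℝ → ℝ} (hH : MemLp H 2) {α : ℝ} (h0 : 0 < α) (h1 : α < 1) :
    ∃ M : ℝ, 0 ≤ M ∧ ∀ w ∈ unitSquare, ∀ w' ∈ unitSquare,
      |logPotential A B 0 H w - logPotential A B 0 H w'| ≤ M * dist w w' ^ α := by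
  have h22 : (2 : ℝ).HolderConjugate 2 := Real.HolderConjugate.two_two
  have hH2 : MemLp H (ENNReal.ofReal 2) := by simpa using hH
  obtain ⟨I, hI, h⟩ := exists_lintegral_mul_singKer_le h22 (half_pos h0) (by linarith) hH2
  -- The exponent `1 / 4` serves only to show that each potential is an integrable expression, so
  -- that their difference is one integral; the Hölder estimate itself uses `α / 2`.
  obtain ⟨I', hI', h'⟩ := exists_lintegral_mul_singKer_le h22 (β := 1 / 4) (by norm_num)
    (by norm_num) hH2
  obtain ⟨K, hK, hker⟩ := exists_abs_log_kerQ_sub_le hA hB h0 h1.le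
  obtain ⟨K', hK', hker'⟩ := exists_abs_log_kerQ_le hA hB (β := 1 / 4) (by norm_num)
  have hmeas : ∀ w : ℝ × ℝ, Measurable fun z => Real.log (kerQ A B 0 z w) / 2 := fun w =>
    (Real.measurable_log.comp
      (continuous_id.kerQ hA hB 0 continuous_const).measurable).div_const 2
  have hint : ∀ w ∈ unitSquare, Integrable (fun z => H z * (Real.log (kerQ A B 0 z w) / 2))
      (volume.restrict unitSquare) := by
    intro w hw
    refine ⟨hH.1.restrict.mul (hmeas w).aestronglyMeasurable, ?_⟩
    refine lt_of_le_of_lt (b := ENNReal.ofReal K' * I') ?_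
      (ENNReal.mul_lt_top ENNReal.ofReal_lt_top hI'.lt_top)
    refine le_trans ?_ (mul_le_mul_right (h' w hw) (ENNReal.ofReal K'))
    rw [← lintegral_const_mul' _ _ ENNReal.ofReal_ne_top]
    refine lintegral_mono_ae ((ae_ne_and_ne w).mono fun z hz => ?_)
    rw [enorm_mul, mul_left_comm, ← ENNReal.ofReal_mul hK', Real.enorm_eq_ofReal_abs (_ / 2)]
    gcongr
    exact hker' 0 le_rfl zero_le_one z hz.1 w hw hz.2.1 hz.2.2
  refine ⟨K * (I + I).toReal, by positivity, fun w hw w' hw' => ?_⟩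
  unfold logPotential
  rw [← integral_sub (hint w hw) (hint w' hw')]
  simp_rw [← mul_sub]
  have key := abs_integral_mul_le_of_lintegral_le (μ := volume.restrict unitSquare) (H := H)
    (f := fun z => Real.log (kerQ A B 0 z w) / 2 - Real.log (kerQ A B 0 z w') / 2)
    (g := fun z => singKer (α / 2) z w + singKer (α / 2) z w') (K := K * dist w w' ^ α)
    (I := I + I) (by simp [hI]) (by positivity) ?_ ?_
  · refine key.trans (le_of_eq ?_)
    ring
  · simp_rw [ENNReal.ofReal_add (singKer_nonneg _ _ _) (singKer_nonneg _ _ _), mul_add]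
    have hm : AEMeasurable (fun z => ‖H z‖ₑ * ENNReal.ofReal (singKer (α / 2) z w))
        (volume.restrict unitSquare) :=
      hH.1.restrict.enorm.mul (measurable_singKer _ w).ennreal_ofReal.aemeasurable
    rw [lintegral_add_left' hm]
    exact add_le_add (h w hw) (h w' hw')
  · filter_upwards [ae_ne_and_ne w, ae_ne_and_ne w'] with z hz hz'
    exact hker z w w' hz.2.1 hz.2.2 hz'.2.1 hz'.2.2

theorem aestronglyMeasurable_logPotential (hA : EllipticCoeff A c C) (hB : EllipticCoeff B c C)
    {H : ℝ × ℝ → ℝ} (hH : AEStronglyMeasurable H) {δ : ℝ} (hδ : 0 < δ) :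
    AEStronglyMeasurable (logPotential A B δ H) := by
  have hc : Continuous fun p : (ℝ × ℝ) × ℝ × ℝ => Real.log (kerQ A B δ p.2 p.1) / 2 :=
    ((continuous_snd.kerQ hA hB δ continuous_fst).log fun p => (kerQ_pos hδ _ _).ne').div_const 2
  have h1 : AEStronglyMeasurable (fun p : (ℝ × ℝ) × ℝ × ℝ =>
      H p.2 * (Real.log (kerQ A B δ p.2 p.1) / 2))
      ((volume : Measure (ℝ × ℝ)).prod (volume.restrict unitSquare)) :=
    hH.restrict.comp_snd.mul hc.aestronglyMeasurable
  exact h1.integral_prod_right'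

/-- The kernel identity is integrated against `A B ψ` for a test function `ψ`. As `δ → 0` its left
side tends to `profileMass` times `u η` by the approximate identity, its right side to the potential
with `δ = 0` by domination uniform in `δ`. As `ψ` is arbitrary and `A B` is positive, the two
functions agree almost everywhere. -/
theorem LocalSolution.representation {U : Set (ℝ × ℝ)} {u ux uy F : ℝ × ℝ → ℝ}
    (hA : EllipticCoeff A c C) (hB : EllipticCoeff B c C)
    (h : LocalSolution U (fun z => A z.2 ^ 2) (fun z => B z.1 ^ 2) u ux uy F)
    (hU : U ⊆ unitSquare) {r s : ℝ} (hrs : r.HolderConjugate s) (hr : r ≤ 2)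
    (hF : ∀ ζ, IsTestFunction U ζ → MemLp (fun z => F z * ζ z) (ENNReal.ofReal r))
    {η : ℝ × ℝ → ℝ} (hη : IsTestFunction U η) :
    ∃ H : ℝ × ℝ → ℝ, MemLp H (ENNReal.ofReal r) ∧ ∀ᵐ w ∂(volume.restrict unitSquare),
      profileMass * (u w * η w) = logPotential A B 0 H w := by
  have hAc := hA.continuous
  have hBc := hB.continuous
  obtain ⟨c₀, c₁, c₂, ζ, t0, t1, t2, tζ, hid⟩ := h.kernel_identity hA hB hη
  -- On a set of finite measure `L²` is contained in `L^r`, as `r ≤ 2`.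
  have low : ∀ {g φ : ℝ × ℝ → ℝ}, MemLp g 2 → IsTestFunction U φ →
      MemLp (fun z => g z * φ z) (ENNReal.ofReal r) := fun hg hφ =>
    (hφ.memLp_mul hg).mono_exponent_of_measure_support_ne_top (s := unitSquare)
      (fun z hz => by rw [hφ.eq_zero fun hz' => hz (hU hz'), mul_zero]) volume_unitSquare_ne_top
      (by simpa using ENNReal.ofReal_le_ofReal hr)
  set H : ℝ × ℝ → ℝ := fun z => u z * c₀ z + ux z * c₁ z + uy z * c₂ z - F z * ζ z with hHdef
  have hH : MemLp H (ENNReal.ofReal r) :=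
    (((low h.memLp t0).add (low h.memLp_x t1)).add (low h.memLp_y t2)).sub (hF ζ tζ)
  have hH0 : ∀ z, z ∉ unitSquare → H z = 0 := fun z hz => by
    have hz' : z ∉ U := fun h' => hz (hU h')
    simp [hHdef, t0.eq_zero hz', t1.eq_zero hz', t2.eq_zero hz', tζ.eq_zero hz']
  have hid' : ∀ δ : ℝ, 0 < δ → ∀ w, ∫ z, (u z * η z * (A z.2 * B z.1)) *
      (2 * δ ^ 2 / kerQ A B δ z w ^ 2) = logPotential A B δ H w := by
    intro δ hδ w
    rw [logPotential, setIntegral_eq_integral_of_forall_compl_eq_zero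
      (fun z hz => by rw [hH0 z hz, zero_mul]), ← hid δ hδ w]
    congr 1 with z
    ring
  refine ⟨H, hH, ?_⟩
  let δ : ℕ → ℝ := fun n => 1 / ((n : ℝ) + 1)
  have d0 : ∀ n, 0 < δ n := fun n => by positivity
  have d1 : ∀ n, δ n ≤ 1 := fun n => by
    rw [div_le_one (by positivity)]; linarith [(Nat.cast_nonneg n : (0 : ℝ) ≤ n)]
  have dlim : Tendsto δ atTop (𝓝 0) := tendsto_one_div_add_atTop_nhds_zero_nat
  obtain ⟨M, hM⟩ := exists_abs_logPotential_le hA hB hrs hH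
  have huη : Integrable fun z => u z * η z :=
    hη.integrable_mul (h.memLp.locallyIntegrable (by norm_num))
  have hmη : Integrable fun z => u z * η z * (A z.2 * B z.1) := by
    have hABc : Continuous fun z : ℝ × ℝ => A z.2 * B z.1 := by fun_prop
    refine huη.mul_bdd (c := C * C) hABc.aestronglyMeasurable (Eventually.of_forall fun z => ?_)
    have a1 := hA.coeff_pos z.2
    have b1 := hB.coeff_pos z.1
    rw [Real.norm_of_nonneg (by positivity)]
    exact mul_le_mul (hA.upper _) (hB.upper _) b1.le hA.upper_pos.le
  have hmeas0 : AEStronglyMeasurable (logPotential A B 0 H) (volume.restrict unitSquare) := by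
    refine aestronglyMeasurable_of_tendsto_ae atTop
      (fun n => (aestronglyMeasurable_logPotential hA hB hH.1 (d0 n)).restrict)
      ((ae_restrict_mem measurableSet_unitSquare).mono fun w hw =>
        tendsto_logPotential hA hB hrs hH d0 d1 dlim hw)
  have hint0 : IntegrableOn (logPotential A B 0 H) unitSquare :=
    Integrable.of_bound hmeas0 M ((ae_restrict_mem measurableSet_unitSquare).mono fun w hw =>
      hM 0 le_rfl zero_le_one w hw)
  have hloc : LocallyIntegrableOn
      (fun w => A w.2 * B w.1 * (profileMass * (u w * η w) - logPotential A B 0 H w))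
      unitSquare := by
    refine LocallyIntegrableOn.continuousOn_mul
      ((huη.const_mul profileMass).integrableOn.sub hint0).locallyIntegrableOn
      (Continuous.continuousOn (by fun_prop)) isOpen_unitSquare.isLocallyClosed
  have hmain := isOpen_unitSquare.ae_eq_zero_of_integral_contDiff_smul_eq_zero hloc ?_
  · refine (ae_restrict_iff' measurableSet_unitSquare).2 (hmain.mono fun w hw hwS => ?_)
    have := hw hwS
    have a1 := hA.coeff_pos w.2
    have b1 := hB.coeff_pos w.1
    rcases mul_eq_zero.1 this with h' | h'
    · exact absurd h' (by positivity)
    · exact sub_eq_zero.1 h'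
  · intro ψ hψ hψc hψS
    have hψ0 : ∀ w, w ∉ unitSquare → ψ w = 0 := fun w hw =>
      image_eq_zero_of_notMem_tsupport fun h' => hw (hψS h')
    have hmψ : Continuous fun w : ℝ × ℝ => A w.2 * B w.1 * ψ w := by
      have := hψ.continuous
      fun_prop
    have hmψi : Integrable fun w : ℝ × ℝ => A w.2 * B w.1 * ψ w :=
      hmψ.integrable_of_hasCompactSupport hψc.mul_left
    have L1 := tendsto_integral_kernel hA hB hmη hψ.continuous hψc d0 dlim
    simp_rw [fun n w => hid' (δ n) (d0 n) w] at L1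
    have L2 : Tendsto (fun n => ∫ w, A w.2 * B w.1 * ψ w * logPotential A B (δ n) H w) atTop
        (𝓝 (∫ w, A w.2 * B w.1 * ψ w * logPotential A B 0 H w)) := by
      refine tendsto_integral_of_dominated_convergence
        (fun w => ‖A w.2 * B w.1 * ψ w‖ * M)
        (fun n => hmψi.1.mul (aestronglyMeasurable_logPotential hA hB hH.1 (d0 n)))
        (hmψi.norm.mul_const M)
        (fun n => Eventually.of_forall fun w => ?_) (Eventually.of_forall fun w => ?_)
      · by_cases hw : w ∈ unitSquare
        · rw [norm_mul]
          gcongr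
          exact hM _ (d0 n).le (d1 n) w hw
        · simp [hψ0 w hw]
      · by_cases hw : w ∈ unitSquare
        · exact (tendsto_logPotential hA hB hrs hH d0 d1 dlim hw).const_mul _
        · simp [hψ0 w hw]
    have heq := tendsto_nhds_unique L1 L2
    have j1 : Integrable fun w => u w * η w * (A w.2 * B w.1) * (profileMass * ψ w) := by
      have := hmη.mul_bdd (g := fun w => profileMass * ψ w) (c := _)
        (hψ.continuous.const_smul profileMass).aestronglyMeasurable
        (Eventually.of_forall (hψc.mul_left (f := fun _ => profileMass)
          |>.exists_bound_of_continuous (hψ.continuous.const_smul profileMass)).choose_spec)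
      exact this
    have j2 : Integrable fun w => A w.2 * B w.1 * ψ w * logPotential A B 0 H w := by
      have h1 : IntegrableOn (fun w => A w.2 * B w.1 * ψ w * logPotential A B 0 H w)
          unitSquare := by
        have := hmψi.integrableOn (s := unitSquare) |>.mul_bdd (c := M) hmeas0
          ((ae_restrict_mem measurableSet_unitSquare).mono fun w hw =>
            hM 0 le_rfl zero_le_one w hw)
        exact this
      refine (integrableOn_iff_integrable_of_support_subset fun w hw => ?_).1 h1
      by_contra hwS
      exact hw (by simp [hψ0 w hwS])
    have j3 := integral_sub j1 j2
    rw [heq, sub_self] at j3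
    refine Eq.trans ?_ j3
    congr 1 with w
    simp only [smul_eq_mul]
    ring

end

section

variable {A B : ℝ → ℝ} {c C : ℝ} {U : Set (ℝ × ℝ)} {u ux uy F η : ℝ × ℝ → ℝ}

/-- First round of the bootstrap. `4 / 3` is the exponent in which `V u` is known a priori; as the
logarithmic kernel has every finite integrability exponent, any exponent above `1` would give
boundedness. -/
theorem LocalSolution.exists_ae_bound (hA : EllipticCoeff A c C) (hB : EllipticCoeff B c C)
    (h : LocalSolution U (fun z => A z.2 ^ 2) (fun z => B z.1 ^ 2) u ux uy F)
    (hU : U ⊆ unitSquare)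
    (hF : ∀ ζ, IsTestFunction U ζ → MemLp (fun z => F z * ζ z) (ENNReal.ofReal (4 / 3)))
    (hη : IsTestFunction U η) : ∃ M : ℝ, ∀ᵐ w, |u w * η w| ≤ M := by
  have hrs : (4 / 3 : ℝ).HolderConjugate 4 := by
    rw [Real.holderConjugate_iff]; norm_num
  obtain ⟨H, hH, hrep⟩ := h.representation hA hB hU hrs (by norm_num) hF hη
  obtain ⟨M, hM⟩ := exists_abs_logPotential_le hA hB hrs hH
  refine ⟨|M| / profileMass, ?_⟩
  filter_upwards [(ae_restrict_iff' measurableSet_unitSquare).1 hrep] with w hw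
  have hm := profileMass_pos
  by_cases hwS : w ∈ unitSquare
  · have h1 := (hM 0 le_rfl zero_le_one w hwS).trans (le_abs_self M)
    rw [← hw hwS, abs_mul, abs_of_pos hm] at h1
    rwa [le_div_iff₀ hm, mul_comm]
  · rw [hη.eq_zero fun h' => hwS (hU h'), mul_zero, abs_zero]
    positivity

/-- The version `v` is the potential itself, divided by the mass; it does not depend on `α`, which
is why it can be chosen before `α`. -/
theorem LocalSolution.exists_holder (hA : EllipticCoeff A c C) (hB : EllipticCoeff B c C)
    (h : LocalSolution U (fun z => A z.2 ^ 2) (fun z => B z.1 ^ 2) u ux uy F)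
    (hU : U ⊆ unitSquare) (hF : ∀ ζ, IsTestFunction U ζ → MemLp (fun z => F z * ζ z) 2)
    (hη : IsTestFunction U η) :
    ∃ v : ℝ × ℝ → ℝ, (∀ᵐ w ∂(volume.restrict unitSquare), v w = u w * η w) ∧
      ∀ α : ℝ, 0 < α → α < 1 → ∃ M : ℝ, 0 ≤ M ∧ ∀ w ∈ unitSquare, ∀ w' ∈ unitSquare,
        |v w - v w'| ≤ M * dist w w' ^ α := by
  have hm := profileMass_pos
  obtain ⟨H, hH, hrep⟩ := h.representation hA hB hU Real.HolderConjugate.two_two le_rfl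
    (by simpa using hF) hη
  have hH2 : MemLp H 2 := by simpa using hH
  refine ⟨fun w => logPotential A B 0 H w / profileMass, ?_, fun α h0 h1 => ?_⟩
  · filter_upwards [hrep] with w hw
    rw [← hw]
    field_simp
  · obtain ⟨M, hM0, hM⟩ := exists_logPotential_sub_le hA hB hH2 h0 h1
    refine ⟨M / profileMass, by positivity, fun w hw w' hw' => ?_⟩
    rw [← sub_div, abs_div, abs_of_pos hm, div_mul_eq_mul_div]
    gcongr
    exact hM w hw w' hw'

end

/-! ### Tools in `L²`: Young's inequality, the elliptic estimate, weak limits. -/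

theorem eLpNorm_two_le_of_enorm_le_lintegral {h g k : ℝ × ℝ → ℝ} (hh : AEStronglyMeasurable h)
    (hk : Measurable k)
    (hg : ∀ w, ‖g w‖ₑ ≤ ∫⁻ z, ‖h z‖ₑ * ‖k (w - z)‖ₑ) :
    eLpNorm g 2 ≤ (∫⁻ z, ‖k z‖ₑ) * eLpNorm h 2 := by
  set I := ∫⁻ z, ‖k z‖ₑ
  have hkI : ∀ w, ∫⁻ z, ‖k (w - z)‖ₑ = I := fun w =>
    lintegral_sub_left_eq_self (fun z => ‖k z‖ₑ) w
  have sq : ∀ f : ℝ × ℝ → ℝ, eLpNorm f 2 = (∫⁻ z, ‖f z‖ₑ ^ (2 : ℝ)) ^ (1 / 2 : ℝ) := fun f => by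
    rw [eLpNorm_eq_lintegral_rpow_enorm_toReal two_ne_zero ENNReal.ofNat_ne_top]
    simp
  -- Cauchy–Schwarz with the kernel split as `k^(1/2) k^(1/2)`. Only a pointwise bound of `g` by a
  -- convolution is needed, so commutators are covered too.
  have hpt : ∀ w, ‖g w‖ₑ ^ (2 : ℝ) ≤ I * ∫⁻ z, ‖h z‖ₑ ^ (2 : ℝ) * ‖k (w - z)‖ₑ := by
    intro w
    have hkm : AEMeasurable (fun z => ‖k (w - z)‖ₑ ^ (1 / 2 : ℝ)) :=
      ((hk.comp (measurable_const.sub measurable_id)).enorm.pow_const _).aemeasurable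
    have hCS := ENNReal.lintegral_mul_le_Lp_mul_Lq volume Real.HolderConjugate.two_two
      (f := fun z => ‖h z‖ₑ * ‖k (w - z)‖ₑ ^ (1 / 2 : ℝ))
      (g := fun z => ‖k (w - z)‖ₑ ^ (1 / 2 : ℝ)) (hh.enorm.mul hkm) hkm
    have e0 : ∀ x : ℝ≥0∞, x ^ (1 / 2 : ℝ) * x ^ (1 / 2 : ℝ) = x := fun x => by
      rw [← ENNReal.rpow_add_of_nonneg _ _ (by norm_num) (by norm_num)]; norm_num
    have e1 : ∀ x : ℝ≥0∞, (x ^ (1 / 2 : ℝ)) ^ (2 : ℝ) = x := fun x => by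
      rw [← ENNReal.rpow_mul]; norm_num
    simp only [Pi.mul_apply, mul_assoc, e0, e1, ENNReal.mul_rpow_of_nonneg _ _
      (zero_le_two : (0 : ℝ) ≤ 2), hkI] at hCS
    calc ‖g w‖ₑ ^ (2 : ℝ) ≤ ((∫⁻ z, ‖h z‖ₑ ^ (2 : ℝ) * ‖k (w - z)‖ₑ) ^ (1 / 2 : ℝ) *
          I ^ (1 / 2 : ℝ)) ^ (2 : ℝ) := by gcongr; exact (hg w).trans hCS
      _ = _ := by rw [ENNReal.mul_rpow_of_nonneg _ _ zero_le_two, e1, e1, mul_comm]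
  have hmeas : AEMeasurable (Function.uncurry fun w z : ℝ × ℝ => ‖h z‖ₑ ^ (2 : ℝ) * ‖k (w - z)‖ₑ)
      (volume.prod volume) :=
    (hh.enorm.pow_const _).comp_snd.mul
      (hk.comp (measurable_fst.sub measurable_snd)).enorm.aemeasurable
  have hint : ∫⁻ w, ‖g w‖ₑ ^ (2 : ℝ) ≤ I ^ (2 : ℝ) * ∫⁻ z, ‖h z‖ₑ ^ (2 : ℝ) := by
    calc ∫⁻ w, ‖g w‖ₑ ^ (2 : ℝ) ≤ ∫⁻ w, I * ∫⁻ z, ‖h z‖ₑ ^ (2 : ℝ) * ‖k (w - z)‖ₑ :=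
          lintegral_mono hpt
      _ = I * ∫⁻ w, ∫⁻ z, ‖h z‖ₑ ^ (2 : ℝ) * ‖k (w - z)‖ₑ :=
          lintegral_const_mul'' _ hmeas.lintegral_prod_right'
      _ = I * ∫⁻ z, ∫⁻ w, ‖h z‖ₑ ^ (2 : ℝ) * ‖k (w - z)‖ₑ := by
          rw [lintegral_lintegral_swap hmeas]
      _ = I * ∫⁻ z, ‖h z‖ₑ ^ (2 : ℝ) * I := by
          congr 2 with z
          have hkz : Measurable fun w => ‖k (w - z)‖ₑ :=
            (hk.comp (measurable_id.sub measurable_const)).enorm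
          rw [lintegral_const_mul _ hkz,
            show ∫⁻ w, ‖k (w - z)‖ₑ = I from lintegral_sub_right_eq_self (fun z => ‖k z‖ₑ) z]
      _ = _ := by
          rw [lintegral_mul_const'' _ (hh.enorm.pow_const _), ENNReal.rpow_two]
          ring
  rw [sq, sq]
  calc _ ≤ (I ^ (2 : ℝ) * ∫⁻ z, ‖h z‖ₑ ^ (2 : ℝ)) ^ (1 / 2 : ℝ) := by gcongr
    _ = _ := by
      rw [ENNReal.mul_rpow_of_nonneg _ _ (by norm_num), ← ENNReal.rpow_mul]
      norm_num

theorem integral_mul_dirDeriv {f g : ℝ × ℝ → ℝ} (hf : IsTestFunction univ f)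
    (hg : ContDiff ℝ ∞ g) (e : ℝ × ℝ) :
    ∫ z, f z * dirDeriv e g z = -∫ z, dirDeriv e f z * g z := by
  have cs : ∀ {φ ψ : ℝ × ℝ → ℝ}, IsTestFunction univ φ → ContDiff ℝ ∞ ψ →
      Integrable fun z => φ z * ψ z := fun hφ hψ =>
    (hφ.mul_smooth hψ).continuous.integrable_of_hasCompactSupport (hφ.mul_smooth hψ).2.1
  exact integral_mul_fderiv_eq_neg_fderiv_mul_of_integrable (cs (hf.dirDeriv e) hg)
    (cs hf (contDiff_dirDeriv hg e)) (cs hf hg) (fun z _ => hf.1.differentiableAt_infty z)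
    (fun z _ => hg.differentiableAt_infty z)

/-- Two integrations by parts exchange one derivative between the factors; the signs cancel. -/
theorem integral_dirDeriv_mul_dirDeriv {W : ℝ × ℝ → ℝ} (hW : IsTestFunction univ W)
    (e e' : ℝ × ℝ) :
    ∫ z, dirDeriv e (dirDeriv e W) z * dirDeriv e' (dirDeriv e' W) z =
      ∫ z, dirDeriv e (dirDeriv e' W) z ^ 2 := by
  have h1 := integral_mul_dirDeriv (hW.dirDeriv e) ((hW.dirDeriv e').dirDeriv e').1 e
  have h2 := integral_mul_dirDeriv (hW.dirDeriv e) ((hW.dirDeriv e').dirDeriv e).1 e'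
  have h3 : ∀ z, dirDeriv e (dirDeriv e' (dirDeriv e' W)) z =
      dirDeriv e' (dirDeriv e (dirDeriv e' W)) z := fun z =>
    dirDeriv_comm (hW.dirDeriv e').1 e e' z
  simp_rw [h3] at h1
  rw [h1] at h2
  rw [neg_inj] at h2
  rw [h2]
  congr 1 with z
  rw [dirDeriv_comm hW.1 e' e, sq]

/-- The a priori estimate for the second derivatives. -/
theorem integral_sq_le_of_elliptic {a b W : ℝ × ℝ → ℝ} {m M : ℝ} (hm : 0 < m)
    (ha : ∀ z, m ≤ a z) (hb : ∀ z, m ≤ b z) (ha' : ∀ z, a z ≤ M) (hb' : ∀ z, b z ≤ M)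
    (hac : Continuous a) (hbc : Continuous b) (hW : IsTestFunction univ W) :
    (m / M * ∫ z, dirDeriv (1, 0) (dirDeriv (1, 0) W) z ^ 2) +
      (m / M * ∫ z, dirDeriv (0, 1) (dirDeriv (0, 1) W) z ^ 2) +
      2 * (∫ z, dirDeriv (1, 0) (dirDeriv (0, 1) W) z ^ 2) ≤
    (m ^ 2)⁻¹ * ∫ z, (a z * dirDeriv (1, 0) (dirDeriv (1, 0) W) z +
      b z * dirDeriv (0, 1) (dirDeriv (0, 1) W) z) ^ 2 := by
  have hX := (hW.dirDeriv (1, 0)).dirDeriv (1, 0)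
  have hY := (hW.dirDeriv (0, 1)).dirDeriv (0, 1)
  rw [← integral_dirDeriv_mul_dirDeriv hW (1, 0) (0, 1)]
  set X := dirDeriv (1, 0) (dirDeriv (1, 0) W)
  set Y := dirDeriv (0, 1) (dirDeriv (0, 1) W)
  have hXc := hX.continuous
  have hYc := hY.continuous
  have cs : ∀ {φ ψ : ℝ × ℝ → ℝ}, Continuous ψ → IsTestFunction univ φ → Continuous φ →
      Integrable fun z => φ z * ψ z := fun hψ hφ hφc =>
    (hφc.mul hψ).integrable_of_hasCompactSupport hφ.2.1.mul_right
  have iX : Integrable fun z => X z ^ 2 := by simpa [sq] using cs hXc hX hXc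
  have iY : Integrable fun z => Y z ^ 2 := by simpa [sq] using cs hYc hY hYc
  have iXY : Integrable fun z => X z * Y z := cs hYc hX hXc
  have iL : Integrable fun z => (a z * X z + b z * Y z) ^ 2 := by
    have h1 := cs (ψ := fun z => a z ^ 2 * X z) (by fun_prop) hX hXc
    have h2 := cs (ψ := fun z => 2 * a z * b z * Y z) (by fun_prop) hX hXc
    have h3 := cs (ψ := fun z => b z ^ 2 * Y z) (by fun_prop) hY hYc
    refine ((h1.add h2).add h3).congr (Eventually.of_forall fun z => ?_)
    simp only [Pi.add_apply]
    ring
  have iXY' : Integrable fun z => m / M * X z ^ 2 + m / M * Y z ^ 2 :=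
    (iX.const_mul _).add (iY.const_mul _)
  rw [← integral_const_mul, ← integral_const_mul, ← integral_const_mul, ← integral_const_mul,
    ← integral_add (iX.const_mul _) (iY.const_mul _), ← integral_add iXY' (iXY.const_mul _)]
  refine integral_mono (iXY'.add (iXY.const_mul _))
    (iL.const_mul _) fun z => ?_
  have pa := hm.trans_le (ha z)
  have pb := hm.trans_le (hb z)
  have pM := pa.trans_le (ha' z)
  have k1 : m / M ≤ a z / b z := div_le_div₀ pa.le (ha z) pb (hb' z)
  have k2 : m / M ≤ b z / a z := div_le_div₀ pb.le (hb z) pa (ha' z)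
  have k3 : (a z * b z)⁻¹ ≤ (m ^ 2)⁻¹ := by
    gcongr
    rw [sq]
    exact mul_le_mul (ha z) (hb z) hm.le pa.le
  -- Expanding `(a X + b Y)² / (a b)` leaves `X Y` with the constant coefficient `2`. This is what
  -- permits integration by parts without differentiating `a` and `b`.
  calc _ ≤ a z / b z * X z ^ 2 + b z / a z * Y z ^ 2 + 2 * (X z * Y z) := by
        gcongr
    _ = (a z * b z)⁻¹ * (a z * X z + b z * Y z) ^ 2 := by
        field_simp
        ring
    _ ≤ _ := by
        gcongr

theorem inner_toLp_eq {f g : ℝ × ℝ → ℝ} (hf : MemLp f 2) (hg : MemLp g 2) :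
    inner ℝ (hf.toLp f) (hg.toLp g) = ∫ z, f z * g z := by
  rw [L2.inner_def]
  refine integral_congr_ae ?_
  filter_upwards [hf.coeFn_toLp, hg.coeFn_toLp] with z h1 h2
  rw [h1, h2]
  simp [mul_comm]

theorem integral_sq_eq_eLpNorm {f : ℝ × ℝ → ℝ} (hf : MemLp f 2) :
    ∫ z, f z ^ 2 = (eLpNorm f 2).toReal ^ 2 := by
  have := inner_toLp_eq hf hf
  rw [real_inner_self_eq_norm_sq, Lp.norm_toLp] at this
  simp_rw [this, sq]

/-- Banach–Alaoglu and the Riesz representation. A cluster point suffices, with no subsequence: for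
a `y` whose pairings converge, the limit is the only possible cluster value. -/
theorem exists_weak_limit {E : Type*} [NormedAddCommGroup E] [InnerProductSpace ℝ E]
    [CompleteSpace E] {x : ℕ → E} {M : ℝ} (hx : ∀ n, ‖x n‖ ≤ M) :
    ∃ g : E, ∀ (y : E) (r : ℝ), Tendsto (fun n => inner ℝ (x n) y) atTop (𝓝 r) →
      inner ℝ g y = r := by
  let T : ℕ → WeakDual ℝ E := fun n =>
    StrongDual.toWeakDual (InnerProductSpace.toDual ℝ E (x n))
  have hT : ∀ n, T n ∈ ⇑(WeakDual.toStrongDual (𝕜 := ℝ) (E := E)) ⁻¹' Metric.closedBall 0 M := by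
    intro n
    rw [mem_preimage, mem_closedBall_zero_iff]
    calc _ = ‖InnerProductSpace.toDual ℝ E (x n)‖ := rfl
      _ = ‖x n‖ := (InnerProductSpace.toDual ℝ E).norm_map _
      _ ≤ M := hx n
  obtain ⟨l, -, hl⟩ := (WeakDual.isCompact_closedBall (𝕜 := ℝ) (E := E) 0 M).exists_mapClusterPt
    (f := atTop) (u := T) (le_principal_iff.2 (mem_map.2 (Eventually.of_forall hT)))
  refine ⟨(InnerProductSpace.toDual ℝ E).symm (WeakDual.toStrongDual l), fun y r hr => ?_⟩
  rw [InnerProductSpace.toDual_symm_apply]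
  have hc : MapClusterPt (l y) atTop (fun n => inner ℝ (x n) y) :=
    hl.continuousAt_comp (WeakDual.eval_continuous y).continuousAt
  have : (𝓝 (l y) ⊓ 𝓝 r).NeBot := hc.neBot.mono (inf_le_inf_left _ hr)
  exact eq_of_nhds_neBot this

theorem exists_memLp_two_weak_limit {x : ℕ → ℝ × ℝ → ℝ} {M : ℝ} (hx : ∀ n, MemLp (x n) 2)
    (hM : ∀ n, ∫ z, x n z ^ 2 ≤ M) :
    ∃ g : ℝ × ℝ → ℝ, MemLp g 2 ∧ ∀ φ : ℝ × ℝ → ℝ, MemLp φ 2 → ∀ r : ℝ,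
      Tendsto (fun n => ∫ z, x n z * φ z) atTop (𝓝 r) → ∫ z, g z * φ z = r := by
  have hb : ∀ n, ‖(hx n).toLp (x n)‖ ≤ √M := fun n => by
    refine Real.le_sqrt_of_sq_le ?_
    rw [Lp.norm_toLp, ← integral_sq_eq_eLpNorm (hx n)]
    exact hM n
  obtain ⟨g, hg⟩ := exists_weak_limit hb
  refine ⟨g, Lp.memLp g, fun φ hφ r hr => ?_⟩
  rw [← hg (hφ.toLp φ) r (by simpa only [inner_toLp_eq] using hr),
    ← inner_toLp_eq (Lp.memLp g) hφ, Lp.toLp_coeFn]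

/-! ### Mollification, Friedrichs commutators and second derivatives. -/

/-- The convolution of `w` with `g`. -/
noncomputable def smear (w g : ℝ × ℝ → ℝ) (x : ℝ × ℝ) : ℝ := ∫ z, w z * g (x - z)

theorem smear_eq_convolution (w g : ℝ × ℝ → ℝ) :
    smear w g = convolution w g (ContinuousLinearMap.mul ℝ ℝ) volume := rfl

theorem dirDeriv_smear {w g : ℝ × ℝ → ℝ} (hw : LocallyIntegrable w)
    (hg : IsTestFunction univ g) (e : ℝ × ℝ) : dirDeriv e (smear w g) = smear w (dirDeriv e g) := by
  funext x
  have h1 := hg.2.1.hasFDerivAt_convolution_right (ContinuousLinearMap.mul ℝ ℝ) hw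
    (hg.1.of_le (by simp)) x
  rw [dirDeriv, smear_eq_convolution, h1.fderiv, convolution_precompR_apply _ hw
    (hg.2.1.fderiv ℝ) (hg.1.continuous_fderiv (by simp))]
  rfl

theorem isTestFunction_smear {w g : ℝ × ℝ → ℝ} (hw : LocallyIntegrable w)
    (hwc : HasCompactSupport w) (hg : IsTestFunction univ g) :
    IsTestFunction univ (smear w g) := by
  rw [smear_eq_convolution]
  refine ⟨?_, ?_, subset_univ _⟩
  · exact hg.2.1.contDiff_convolution_right (ContinuousLinearMap.mul ℝ ℝ) hw hg.1
  · exact hwc.convolution (ContinuousLinearMap.mul ℝ ℝ) hg.2.1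

theorem isTestFunction_reflect {g : ℝ × ℝ → ℝ} (hg : IsTestFunction univ g) (x : ℝ × ℝ) :
    IsTestFunction univ (fun z => g (x - z)) :=
  ⟨hg.1.comp (contDiff_const.sub contDiff_id), hg.2.1.comp_homeomorph (Homeomorph.subLeft x),
    subset_univ _⟩

theorem dirDeriv_reflect {g : ℝ × ℝ → ℝ} (hg : ContDiff ℝ ∞ g) (e x : ℝ × ℝ) :
    dirDeriv e (fun z => g (x - z)) = fun z => -dirDeriv e g (x - z) := by
  funext z
  have h1 : HasFDerivAt (fun z => x - z) (-ContinuousLinearMap.id ℝ (ℝ × ℝ)) z :=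
    (hasFDerivAt_id z).const_sub x
  have h2 := HasFDerivAt.comp z (hg.differentiableAt_infty (x - z)).hasFDerivAt h1
  rw [dirDeriv, show (fun z => g (x - z)) = g ∘ fun z => x - z from rfl, h2.fderiv]
  simp [dirDeriv]

theorem dirDeriv_neg (e : ℝ × ℝ) (g : ℝ × ℝ → ℝ) :
    dirDeriv e (fun z => -g z) = fun z => -dirDeriv e g z := by
  funext z
  simp [dirDeriv]

theorem dirDeriv_dirDeriv_reflect {g : ℝ × ℝ → ℝ} (hg : ContDiff ℝ ∞ g) (e e' x : ℝ × ℝ) :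
    dirDeriv e (dirDeriv e' (fun z => g (x - z))) =
      fun z => dirDeriv e (dirDeriv e' g) (x - z) := by
  rw [dirDeriv_reflect hg, dirDeriv_neg, dirDeriv_reflect (contDiff_dirDeriv hg e')]
  simp

/-- Since `a` is constant in the direction `e`, `(a x - a z) ∂ₑ²φ(x - z)` is, up to sign, the
`z`-derivative of `(a x - a z) ∂ₑφ(x - z)`. One derivative thus passes to `w`, and the error
contains only a first derivative of the mollifier. -/
theorem commutator_identity {w w₁ a φ : ℝ × ℝ → ℝ} {e : ℝ × ℝ} (hw : LocallyIntegrable w)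
    (h1 : ∀ φ : ℝ × ℝ → ℝ, ContDiff ℝ ∞ φ → ∫ z, w z * dirDeriv e φ z = -∫ z, w₁ z * φ z)
    (ha : ContDiff ℝ ∞ a) (hae : ∀ z, dirDeriv e a z = 0) (hφ : IsTestFunction univ φ)
    (x : ℝ × ℝ) :
    a x * smear w (dirDeriv e (dirDeriv e φ)) x =
      (∫ z, w z * (a z * dirDeriv e (dirDeriv e φ) (x - z))) +
        ∫ z, w₁ z * ((a x - a z) * dirDeriv e φ (x - z)) := by
  have hφe := isTestFunction_reflect (hφ.dirDeriv e) x
  have hφee := isTestFunction_reflect ((hφ.dirDeriv e).dirDeriv e) x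
  have hax : ContDiff ℝ ∞ fun z => a x - a z := contDiff_const.sub ha
  have hd : ∀ z, dirDeriv e (fun z => (a x - a z) * dirDeriv e φ (x - z)) z =
      -((a x - a z) * dirDeriv e (dirDeriv e φ) (x - z)) := by
    intro z
    rw [dirDeriv_mul (hax.differentiableAt_infty z) (hφe.1.differentiableAt_infty z),
      dirDeriv_reflect (hφ.dirDeriv e).1]
    have : dirDeriv e (fun z => a x - a z) z = 0 := by
      have h0 := hae z
      simp only [dirDeriv] at h0 ⊢
      rw [fderiv_const_sub]
      simp [h0]
    rw [this]
    ring
  have h2 := h1 _ (hax.mul hφe.1)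
  simp_rw [hd] at h2
  have i1 := hφee.integrable_mul hw
  have i2 := (hφee.smooth_mul ha).integrable_mul hw
  have h3 : ∫ z, w z * -((a x - a z) * dirDeriv e (dirDeriv e φ) (x - z)) =
      (∫ z, w z * (a z * dirDeriv e (dirDeriv e φ) (x - z))) -
        a x * ∫ z, w z * dirDeriv e (dirDeriv e φ) (x - z) := by
    rw [← integral_const_mul, ← integral_sub i2 (i1.const_mul _)]
    congr 1 with z
    ring
  rw [h3] at h2
  rw [smear]
  linarith

theorem eLpNorm_smear_le {w g : ℝ × ℝ → ℝ} (hw : AEStronglyMeasurable w) (hg : Continuous g) :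
    eLpNorm (smear w g) 2 ≤ (∫⁻ z, ‖g z‖ₑ) * eLpNorm w 2 := by
  refine eLpNorm_two_le_of_enorm_le_lintegral hw hg.measurable fun x => ?_
  refine (enorm_integral_le_lintegral_enorm _).trans (le_of_eq ?_)
  simp_rw [enorm_mul]

theorem eLpNorm_commutator_le {w₁ a g : ℝ × ℝ → ℝ} {L : ℝ≥0} (hw : AEStronglyMeasurable w₁)
    (ha : LipschitzWith L a) (hg : Continuous g) :
    eLpNorm (fun x => ∫ z, w₁ z * ((a x - a z) * g (x - z))) 2 ≤
      (∫⁻ z, ‖(L * ‖z‖) * g z‖ₑ) * eLpNorm w₁ 2 := by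
  refine eLpNorm_two_le_of_enorm_le_lintegral hw (k := fun z => (L * ‖z‖) * g z)
    (by fun_prop) fun x => ?_
  refine (enorm_integral_le_lintegral_enorm _).trans (lintegral_mono fun z => ?_)
  rw [enorm_mul, enorm_mul, enorm_mul]
  gcongr
  rw [enorm_le_iff_norm_le, Real.norm_of_nonneg (r := L * ‖x - z‖) (by positivity),
    ← dist_eq_norm, ← dist_eq_norm]
  exact ha.dist_le_mul x z

theorem aestronglyMeasurable_commutator {w₁ a g : ℝ × ℝ → ℝ} (hw : AEStronglyMeasurable w₁)
    (ha : Continuous a) (hg : Continuous g) :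
    AEStronglyMeasurable (fun x => ∫ z, w₁ z * ((a x - a z) * g (x - z))) := by
  have hc : Continuous fun p : (ℝ × ℝ) × ℝ × ℝ => (a p.1 - a p.2) * g (p.1 - p.2) := by fun_prop
  have h1 : AEStronglyMeasurable (fun p : (ℝ × ℝ) × ℝ × ℝ =>
      w₁ p.2 * ((a p.1 - a p.2) * g (p.1 - p.2)))
      ((volume : Measure (ℝ × ℝ)).prod volume) := hw.comp_snd.mul hc.aestronglyMeasurable
  exact h1.integral_prod_right'

/-- The function `ρ`, rescaled to the length `ε` with its integral kept. -/
noncomputable def rescale (ρ : ℝ × ℝ → ℝ) (ε : ℝ) (z : ℝ × ℝ) : ℝ := (ε ^ 2)⁻¹ * ρ (ε⁻¹ • z)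

theorem isTestFunction_rescale {ρ : ℝ × ℝ → ℝ} (hρ : IsTestFunction univ ρ) {ε : ℝ} (hε : 0 < ε) :
    IsTestFunction univ (rescale ρ ε) := by
  have h1 : ContDiff ℝ ∞ fun z => ρ (ε⁻¹ • z) := hρ.1.comp (contDiff_const_smul _)
  refine ⟨contDiff_const.mul h1, ?_, subset_univ _⟩
  exact (hρ.2.1.comp_smul (inv_ne_zero hε.ne')).mul_left

theorem dirDeriv_rescale {ρ : ℝ × ℝ → ℝ} (hρ : IsTestFunction univ ρ) (ε : ℝ) (e z : ℝ × ℝ) :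
    dirDeriv e (rescale ρ ε) z = (ε ^ 2)⁻¹ * (ε⁻¹ * dirDeriv e ρ (ε⁻¹ • z)) := by
  have h1 : ContDiff ℝ ∞ fun z => ρ (ε⁻¹ • z) := hρ.1.comp (contDiff_const_smul _)
  unfold rescale dirDeriv
  rw [fderiv_const_mul (h1.differentiableAt_infty z), fderiv_comp_smul]
  simp

theorem integral_rescale_mul {ρ g : ℝ × ℝ → ℝ} {ε : ℝ} (hε : 0 < ε) :
    ∫ z, rescale ρ ε z * g z = ∫ z, ρ z * g (ε • z) := by
  have h := Measure.integral_comp_smul (volume : Measure (ℝ × ℝ))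
    (fun z => rescale ρ ε z * g z) ε
  simp only [Module.finrank_prod, Module.finrank_self, smul_eq_mul] at h
  rw [abs_of_pos (by positivity)] at h
  have h2 : ∫ z, rescale ρ ε z * g z = ε ^ 2 * ∫ z, rescale ρ ε (ε • z) * g (ε • z) := by
    rw [h]; field_simp
  rw [h2, ← integral_const_mul]
  congr 1 with z
  rw [rescale, smul_smul, inv_mul_cancel₀ hε.ne', one_smul]
  field_simp

theorem lintegral_enorm_rescale {k : ℝ × ℝ → ℝ} (hk : Continuous k) (hkc : HasCompactSupport k)
    {ε : ℝ} (hε : 0 < ε) : ∫⁻ z, ‖rescale k ε z‖ₑ = ∫⁻ z, ‖k z‖ₑ := by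
  have h1 : Integrable k := hk.integrable_of_hasCompactSupport hkc
  have h2 : Integrable (rescale k ε) := by
    have := (h1.comp_smul (inv_ne_zero hε.ne')).const_mul (ε ^ 2)⁻¹
    exact this
  rw [← ofReal_integral_norm_eq_lintegral_enorm h1, ← ofReal_integral_norm_eq_lintegral_enorm h2]
  congr 1
  have h3 := integral_rescale_mul (ρ := fun z => ‖k z‖) (g := fun _ => (1 : ℝ)) hε
  simp only [mul_one] at h3
  rw [← h3]
  congr 1 with z
  rw [rescale, rescale, norm_mul, Real.norm_of_nonneg (by positivity)]

/-- The factor `‖z‖`, of size `ε` on the support, compensates the `ε⁻¹` produced by differentiation;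
so the commutators are bounded uniformly in `ε`. -/
theorem lintegral_enorm_mul_dirDeriv_rescale {ρ : ℝ × ℝ → ℝ} (hρ : IsTestFunction univ ρ)
    (L : ℝ≥0) (e : ℝ × ℝ) {ε : ℝ} (hε : 0 < ε) :
    ∫⁻ z, ‖(L * ‖z‖) * dirDeriv e (rescale ρ ε) z‖ₑ = ∫⁻ z, ‖(L * ‖z‖) * dirDeriv e ρ z‖ₑ := by
  have hc := (hρ.dirDeriv e).continuous
  have hk : Continuous fun z => (L * ‖z‖) * dirDeriv e ρ z := by fun_prop
  rw [← lintegral_enorm_rescale hk (hρ.dirDeriv e).2.1.mul_left hε]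
  congr 1 with z
  rw [rescale, dirDeriv_rescale hρ, norm_smul, Real.norm_of_nonneg (by positivity)]
  ring_nf

/-- Only weak convergence of the mollifications is needed; Fubini transfers the averaging to the
smooth `ψ`. -/
theorem tendsto_integral_smear_rescale {w ρ ψ : ℝ × ℝ → ℝ} (hw : Integrable w)
    (hρ : IsTestFunction univ ρ) (hρ1 : ∫ z, ρ z = 1) (hψ : IsTestFunction univ ψ)
    {ε : ℕ → ℝ} (hε : ∀ n, 0 < ε n) (hlim : Tendsto ε atTop (𝓝 0)) :
    Tendsto (fun n => ∫ x, smear w (rescale ρ (ε n)) x * ψ x) atTop (𝓝 (∫ z, w z * ψ z)) := by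
  obtain ⟨K, hK⟩ := hψ.exists_bound
  have hρi : Integrable ρ := hρ.continuous.integrable_of_hasCompactSupport hρ.2.1
  have hψi : Integrable ψ := hψ.continuous.integrable_of_hasCompactSupport hψ.2.1
  have hψc := hψ.continuous
  have hρc := hρ.continuous
  have e : ∀ n, ∫ x, smear w (rescale ρ (ε n)) x * ψ x =
      ∫ z, w z * ∫ s, ρ s * ψ (z + ε n • s) := by
    intro n
    have ht := isTestFunction_rescale hρ (hε n)
    obtain ⟨Kρ, hKρ⟩ := ht.exists_bound
    have htc := ht.continuous
    have hint : Integrable (Function.uncurry fun x z : ℝ × ℝ =>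
        w z * rescale ρ (ε n) (x - z) * ψ x) (volume.prod volume) := by
      have h1 : Integrable (fun p : (ℝ × ℝ) × ℝ × ℝ => ψ p.1 * w p.2) (volume.prod volume) :=
        hψi.mul_prod hw
      have hc : Continuous fun p : (ℝ × ℝ) × ℝ × ℝ => rescale ρ (ε n) (p.1 - p.2) := by fun_prop
      have h2 := h1.mul_bdd (c := Kρ) hc.aestronglyMeasurable
        (Eventually.of_forall fun p => hKρ (p.1 - p.2))
      refine h2.congr (Eventually.of_forall fun p => ?_)
      simp only [Function.uncurry]
      ring
    simp_rw [smear, ← integral_mul_const]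
    rw [integral_integral_swap hint]
    congr 1 with z
    have h3 : ∫ s, rescale ρ (ε n) s * ψ (z + s) = ∫ x, rescale ρ (ε n) (x - z) * ψ x := by
      have := integral_add_right_eq_self (μ := volume)
        (fun x => rescale ρ (ε n) (x - z) * ψ x) z
      rw [← this]
      congr 1 with s
      rw [add_sub_cancel_right, add_comm]
    rw [← integral_rescale_mul (g := fun s => ψ (z + s)) (hε n), h3, ← integral_const_mul]
    congr 1 with x
    ring
  simp_rw [e]
  have hbd : ∀ n z, ‖∫ s, ρ s * ψ (z + ε n • s)‖ ≤ ∫ s, ‖ρ s‖ * K := fun n z =>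
    norm_integral_le_of_norm_le (hρi.norm.mul_const K) (Eventually.of_forall fun s => by
      rw [norm_mul]; gcongr; exact hK _)
  refine tendsto_integral_of_dominated_convergence (fun z => ‖w z‖ * ∫ s, ‖ρ s‖ * K)
    (fun n => ?_) (hw.norm.mul_const _) (fun n => Eventually.of_forall fun z => ?_)
    (Eventually.of_forall fun z => Tendsto.const_mul _ ?_)
  · refine hw.1.mul (Continuous.aestronglyMeasurable ?_)
    refine continuous_of_dominated (bound := fun s => ‖ρ s‖ * K)
      (fun z => Continuous.aestronglyMeasurable (by fun_prop))
      (fun z => Eventually.of_forall fun s => ?_) (hρi.norm.mul_const K)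
      (Eventually.of_forall fun s => by fun_prop)
    rw [norm_mul]; gcongr; exact hK _
  · rw [norm_mul]
    gcongr
    exact hbd n z
  · have : ψ z = ∫ s, ρ s * ψ z := by rw [integral_mul_const, hρ1, one_mul]
    rw [this]
    refine tendsto_integral_of_dominated_convergence (fun s => ‖ρ s‖ * K)
      (fun n => Continuous.aestronglyMeasurable (by fun_prop)) (hρi.norm.mul_const K)
      (fun n => Eventually.of_forall fun s => by rw [norm_mul]; gcongr; exact hK _)
      (Eventually.of_forall fun s => Tendsto.const_mul _ ?_)
    have hc : Continuous fun r : ℝ => ψ (z + r • s) := by fun_prop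
    have := (hc.tendsto 0).comp hlim
    simpa [Function.comp_def] using this

theorem exists_mollifier : ∃ ρ : ℝ × ℝ → ℝ, IsTestFunction univ ρ ∧ ∫ z, ρ z = 1 := by
  let b : ContDiffBump (0 : ℝ × ℝ) := ⟨1, 2, by norm_num, by norm_num⟩
  exact ⟨b.normed volume, ⟨b.contDiff_normed, b.hasCompactSupport_normed, subset_univ _⟩,
    b.integral_normed⟩

/-- Testing the equation of `w` with the reflected mollifier shows that the operator applied to
`smear w r` is `smear H r` plus two commutators. Young's inequality bounds all three in `L²` by `N`,
which does not depend on `ε`, and the elliptic estimate converts this into second derivatives. -/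
theorem exists_uniform_bound_smear {w w₁ w₂ H a b ρ : ℝ × ℝ → ℝ} {m M : ℝ} {L : ℝ≥0} (hm : 0 < m)
    (hw : MemLp w 2) (hwc : HasCompactSupport w) (hw₁ : MemLp w₁ 2) (hw₂ : MemLp w₂ 2)
    (hH : MemLp H 2) (has : ContDiff ℝ ∞ a) (hbs : ContDiff ℝ ∞ b)
    (ha : ∀ z, m ≤ a z) (hb : ∀ z, m ≤ b z) (ha' : ∀ z, a z ≤ M) (hb' : ∀ z, b z ≤ M)
    (haL : LipschitzWith L a) (hbL : LipschitzWith L b)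
    (hae : ∀ z, dirDeriv (1, 0) a z = 0) (hbe : ∀ z, dirDeriv (0, 1) b z = 0)
    (h1 : ∀ φ : ℝ × ℝ → ℝ, ContDiff ℝ ∞ φ → ∫ z, w z * dirDeriv (1, 0) φ z = -∫ z, w₁ z * φ z)
    (h2 : ∀ φ : ℝ × ℝ → ℝ, ContDiff ℝ ∞ φ → ∫ z, w z * dirDeriv (0, 1) φ z = -∫ z, w₂ z * φ z)
    (hL : ∀ φ : ℝ × ℝ → ℝ, ContDiff ℝ ∞ φ →
      ∫ z, w z * (a z * dirDeriv (1, 0) (dirDeriv (1, 0) φ) z +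
        b z * dirDeriv (0, 1) (dirDeriv (0, 1) φ) z) = ∫ z, H z * φ z)
    (hρ : IsTestFunction univ ρ) :
    ∃ K : ℝ, ∀ ε : ℝ, 0 < ε →
      ∫ x, dirDeriv (1, 0) (dirDeriv (1, 0) (smear w (rescale ρ ε))) x ^ 2 ≤ K ∧
      ∫ x, dirDeriv (0, 1) (dirDeriv (0, 1) (smear w (rescale ρ ε))) x ^ 2 ≤ K ∧
      ∫ x, dirDeriv (1, 0) (dirDeriv (0, 1) (smear w (rescale ρ ε))) x ^ 2 ≤ K := by
  have hwl := hw.locallyIntegrable (by norm_num)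
  have fin : ∀ {k : ℝ × ℝ → ℝ}, Continuous k → HasCompactSupport k → ∫⁻ z, ‖k z‖ₑ < ⊤ :=
    fun hk hkc => (hk.integrable_of_hasCompactSupport hkc).2
  have hc1 := (hρ.dirDeriv (1, 0)).continuous
  have hc2 := (hρ.dirDeriv (0, 1)).continuous
  set N : ℝ≥0∞ := (∫⁻ z, ‖ρ z‖ₑ) * eLpNorm H 2 +
    (∫⁻ z, ‖(L * ‖z‖) * dirDeriv (1, 0) ρ z‖ₑ) * eLpNorm w₁ 2 +
    (∫⁻ z, ‖(L * ‖z‖) * dirDeriv (0, 1) ρ z‖ₑ) * eLpNorm w₂ 2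
  have hN : N < ⊤ := by
    refine ENNReal.add_lt_top.2 ⟨ENNReal.add_lt_top.2 ⟨?_, ?_⟩, ?_⟩
    · exact ENNReal.mul_lt_top (fin hρ.continuous hρ.2.1) hH.2
    · exact ENNReal.mul_lt_top (fin (by fun_prop) (hρ.dirDeriv (1, 0)).2.1.mul_left) hw₁.2
    · exact ENNReal.mul_lt_top (fin (by fun_prop) (hρ.dirDeriv (0, 1)).2.1.mul_left) hw₂.2
  have hM : 0 < M := (hm.trans_le (ha 0)).trans_le (ha' 0)
  have hmM : 0 < m / M := by positivity
  set J : ℝ := (m ^ 2)⁻¹ * N.toReal ^ 2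
  -- The pure second derivatives enter the elliptic estimate with the factor `m / M`, the mixed one
  -- with `2`.
  refine ⟨max (J / (m / M)) (J / 2), fun ε hε => ?_⟩
  set r := rescale ρ ε
  have hr : IsTestFunction univ r := isTestFunction_rescale hρ hε
  have hW := isTestFunction_smear hwl hwc hr
  have hX : dirDeriv (1, 0) (dirDeriv (1, 0) (smear w r)) =
      smear w (dirDeriv (1, 0) (dirDeriv (1, 0) r)) := by
    rw [dirDeriv_smear hwl hr, dirDeriv_smear hwl (hr.dirDeriv _)]
  have hY : dirDeriv (0, 1) (dirDeriv (0, 1) (smear w r)) =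
      smear w (dirDeriv (0, 1) (dirDeriv (0, 1) r)) := by
    rw [dirDeriv_smear hwl hr, dirDeriv_smear hwl (hr.dirDeriv _)]
  have hid : (fun x => a x * dirDeriv (1, 0) (dirDeriv (1, 0) (smear w r)) x +
      b x * dirDeriv (0, 1) (dirDeriv (0, 1) (smear w r)) x) =
      ((smear H r + fun x => ∫ z, w₁ z * ((a x - a z) * dirDeriv (1, 0) r (x - z))) +
        fun x => ∫ z, w₂ z * ((b x - b z) * dirDeriv (0, 1) r (x - z))) := by
    funext x
    have k1 := commutator_identity hwl h1 has hae hr x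
    have k2 := commutator_identity hwl h2 hbs hbe hr x
    have k3 := hL _ (isTestFunction_reflect hr x).1
    simp_rw [dirDeriv_dirDeriv_reflect hr.1] at k3
    have i1 := ((isTestFunction_reflect ((hr.dirDeriv (1, 0)).dirDeriv (1, 0)) x).smooth_mul
      has).integrable_mul hwl
    have i2 := ((isTestFunction_reflect ((hr.dirDeriv (0, 1)).dirDeriv (0, 1)) x).smooth_mul
      hbs).integrable_mul hwl
    simp_rw [mul_add] at k3
    rw [integral_add i1 i2] at k3
    rw [hX, hY]
    simp only [Pi.add_apply]
    rw [show smear H r x = ∫ z, H z * r (x - z) from rfl]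
    linarith
  have hrc := hr.continuous
  have hr1 := (hr.dirDeriv (1, 0)).continuous
  have hr2 := (hr.dirDeriv (0, 1)).continuous
  have hsm : AEStronglyMeasurable (smear H r) := by
    rw [smear_eq_convolution]
    exact (hr.2.1.continuous_convolution_right (ContinuousLinearMap.mul ℝ ℝ)
      (hH.locallyIntegrable (by norm_num)) hrc).aestronglyMeasurable
  have m1 := aestronglyMeasurable_commutator hw₁.1 has.continuous hr1
  have m2 := aestronglyMeasurable_commutator hw₂.1 hbs.continuous hr2
  have hle : eLpNorm (fun x => a x * dirDeriv (1, 0) (dirDeriv (1, 0) (smear w r)) x +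
      b x * dirDeriv (0, 1) (dirDeriv (0, 1) (smear w r)) x) 2 ≤ N := by
    rw [hid]
    refine (eLpNorm_add_le (hsm.add m1) m2 (by norm_num)).trans (add_le_add
      ((eLpNorm_add_le hsm m1 (by norm_num)).trans (add_le_add ?_ ?_)) ?_)
    · rw [← lintegral_enorm_rescale hρ.continuous hρ.2.1 hε]
      exact eLpNorm_smear_le hH.1 hrc
    · rw [← lintegral_enorm_mul_dirDeriv_rescale hρ L (1, 0) hε]
      exact eLpNorm_commutator_le hw₁.1 haL hr1
    · rw [← lintegral_enorm_mul_dirDeriv_rescale hρ L (0, 1) hε]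
      exact eLpNorm_commutator_le hw₂.1 hbL hr2
  have hmem : MemLp (fun x => a x * dirDeriv (1, 0) (dirDeriv (1, 0) (smear w r)) x +
      b x * dirDeriv (0, 1) (dirDeriv (0, 1) (smear w r)) x) 2 := by
    refine ⟨Continuous.aestronglyMeasurable ?_, hle.trans_lt hN⟩
    have := has.continuous
    have := hbs.continuous
    have := ((hW.dirDeriv (1, 0)).dirDeriv (1, 0)).continuous
    have := ((hW.dirDeriv (0, 1)).dirDeriv (0, 1)).continuous
    fun_prop
  have hsq := integral_sq_eq_eLpNorm hmem
  have hsq' := pow_le_pow_left₀ ENNReal.toReal_nonneg (ENNReal.toReal_mono hN.ne hle) 2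
  rw [← hsq] at hsq'
  have hmain := integral_sq_le_of_elliptic hm ha hb ha' hb' has.continuous hbs.continuous hW
  have hJ : (m ^ 2)⁻¹ * ∫ z, (a z * dirDeriv (1, 0) (dirDeriv (1, 0) (smear w r)) z +
      b z * dirDeriv (0, 1) (dirDeriv (0, 1) (smear w r)) z) ^ 2 ≤ J := by
    simp only [J]
    gcongr
  have n1 : 0 ≤ ∫ x, dirDeriv (1, 0) (dirDeriv (1, 0) (smear w r)) x ^ 2 :=
    integral_nonneg fun x => sq_nonneg _
  have n2 : 0 ≤ ∫ x, dirDeriv (0, 1) (dirDeriv (0, 1) (smear w r)) x ^ 2 :=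
    integral_nonneg fun x => sq_nonneg _
  have n3 : 0 ≤ ∫ x, dirDeriv (1, 0) (dirDeriv (0, 1) (smear w r)) x ^ 2 :=
    integral_nonneg fun x => sq_nonneg _
  have p1 := mul_nonneg hmM.le n1
  have p2 := mul_nonneg hmM.le n2
  refine ⟨le_max_of_le_left ?_, le_max_of_le_left ?_, le_max_of_le_right ?_⟩
  · rw [le_div_iff₀ hmM]; linarith
  · rw [le_div_iff₀ hmM]; linarith
  · linarith

/-- A weak limit of the second derivatives of the mollifications. Paired with a test function, both
derivatives move onto it, and there the weak convergence of the mollifications to `w` identifies the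
limit. -/
theorem exists_second_derivative {w ρ : ℝ × ℝ → ℝ} {K : ℝ} {e e' : ℝ × ℝ} (hw : MemLp w 2)
    (hwc : HasCompactSupport w) (hρ : IsTestFunction univ ρ) (hρ1 : ∫ z, ρ z = 1)
    (hK : ∀ ε : ℝ, 0 < ε → ∫ x, dirDeriv e (dirDeriv e' (smear w (rescale ρ ε))) x ^ 2 ≤ K) :
    ∃ g : ℝ × ℝ → ℝ, MemLp g 2 ∧ ∀ φ : ℝ × ℝ → ℝ, IsTestFunction univ φ →
      ∫ z, w z * dirDeriv e (dirDeriv e' φ) z = ∫ z, g z * φ z := by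
  have hwl := hw.locallyIntegrable (by norm_num)
  have hwi : Integrable w := by
    have := hw.mono_exponent_of_measure_support_ne_top (p := 1) (s := tsupport w)
      (fun x hx => image_eq_zero_of_notMem_tsupport hx) hwc.isCompact.measure_lt_top.ne
      (by norm_num)
    exact memLp_one_iff_integrable.1 this
  let ε : ℕ → ℝ := fun n => 1 / ((n : ℝ) + 1)
  have e0 : ∀ n, 0 < ε n := fun n => by positivity
  have elim : Tendsto ε atTop (𝓝 0) := tendsto_one_div_add_atTop_nhds_zero_nat
  have hW : ∀ n, IsTestFunction univ (smear w (rescale ρ (ε n))) := fun n =>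
    isTestFunction_smear hwl hwc (isTestFunction_rescale hρ (e0 n))
  obtain ⟨g, hg, hlim⟩ := exists_memLp_two_weak_limit
    (x := fun n => dirDeriv e (dirDeriv e' (smear w (rescale ρ (ε n)))))
    (fun n => (((hW n).dirDeriv e').dirDeriv e).memLp 2) (fun n => hK _ (e0 n))
  refine ⟨g, hg, fun φ hφ => (hlim φ (hφ.memLp 2) _ ?_).symm⟩
  have h := tendsto_integral_smear_rescale hwi hρ hρ1 ((hφ.dirDeriv e').dirDeriv e) e0 elim
  refine h.congr fun n => ?_
  rw [integral_mul_dirDeriv (hW n) (hφ.dirDeriv e').1 e,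
    integral_mul_dirDeriv ((hW n).dirDeriv e) hφ.1 e', neg_neg]
  congr 1 with z
  rw [dirDeriv_comm (hW n).1]

section

variable {A B : ℝ → ℝ} {c C : ℝ} {U : Set (ℝ × ℝ)} {u ux uy F η : ℝ × ℝ → ℝ}

theorem EllipticCoeff.exists_lipschitz_sq {A : ℝ → ℝ} (hA : EllipticCoeff A c C) :
    ∃ L : ℝ≥0, LipschitzWith L fun t => A t ^ 2 := by
  obtain ⟨L, hL⟩ := hA.lipschitz
  have hC := hA.upper_pos
  refine ⟨Real.toNNReal (2 * C) * L, LipschitzWith.of_dist_le_mul fun s t => ?_⟩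
  have h1 := hL.dist_le_mul s t
  rw [Real.dist_eq] at h1 ⊢
  have h2 : A s ^ 2 - A t ^ 2 = (A s + A t) * (A s - A t) := by ring
  have p1 := hA.coeff_pos s
  have p2 := hA.coeff_pos t
  rw [h2, abs_mul, abs_of_pos (by positivity), NNReal.coe_mul, mul_assoc]
  have := hA.upper s
  have := hA.upper t
  exact mul_le_mul (by rw [Real.coe_toNNReal _ (by positivity)]; linarith) h1 (abs_nonneg _) (by positivity)

theorem IsWeakDir.cutoff {e : ℝ × ℝ} {ue : ℝ × ℝ → ℝ} (h : IsWeakDir e U u ue)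
    (hu : LocallyIntegrable u) (hη : IsTestFunction U η) {φ : ℝ × ℝ → ℝ} (hφ : ContDiff ℝ ∞ φ)
    (hue : LocallyIntegrable ue) :
    ∫ z, (u z * η z) * dirDeriv e φ z = -∫ z, (ue z * η z + u z * dirDeriv e η z) * φ z := by
  have h1 := h _ (hη.mul_smooth hφ)
  have i1 := (hη.mul_smooth (contDiff_dirDeriv hφ e)).integrable_mul hu
  have i2 := ((hη.dirDeriv e).mul_smooth hφ).integrable_mul hu
  have i3 := (hη.mul_smooth hφ).integrable_mul hue
  have e1 : ∫ z, u z * dirDeriv e (fun z => η z * φ z) z =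
      (∫ z, u z * (η z * dirDeriv e φ z)) + ∫ z, u z * (dirDeriv e η z * φ z) := by
    rw [← integral_add i1 i2]
    congr 1 with z
    rw [dirDeriv_mul (hη.1.differentiableAt_infty z) (hφ.differentiableAt_infty z)]
    ring
  have e2 : ∫ z, (ue z * η z + u z * dirDeriv e η z) * φ z =
      (∫ z, ue z * (η z * φ z)) + ∫ z, u z * (dirDeriv e η z * φ z) := by
    rw [← integral_add i3 i2]
    congr 1 with z
    ring
  rw [e2]
  simp_rw [mul_assoc]
  linarith

theorem LocalSolution.exists_second_derivatives (hA : EllipticCoeff A c C)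
    (hB : EllipticCoeff B c C)
    (h : LocalSolution U (fun z => A z.2 ^ 2) (fun z => B z.1 ^ 2) u ux uy F)
    (hF : ∀ ζ, IsTestFunction U ζ → MemLp (fun z => F z * ζ z) 2) (hη : IsTestFunction U η) :
    ∃ gxx gxy gyy : ℝ × ℝ → ℝ, MemLp gxx 2 ∧ MemLp gxy 2 ∧ MemLp gyy 2 ∧
      ∀ φ : ℝ × ℝ → ℝ, IsTestFunction univ φ →
        ∫ z, (u z * η z) * dirDeriv (1, 0) (dirDeriv (1, 0) φ) z = ∫ z, gxx z * φ z ∧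
        ∫ z, (u z * η z) * dirDeriv (1, 0) (dirDeriv (0, 1) φ) z = ∫ z, gxy z * φ z ∧
        ∫ z, (u z * η z) * dirDeriv (0, 1) (dirDeriv (0, 1) φ) z = ∫ z, gyy z * φ z := by
  have hAs := hA.smooth
  have hBs := hB.smooth
  have has : ContDiff ℝ ∞ fun z : ℝ × ℝ => A z.2 ^ 2 := by fun_prop
  have hbs : ContDiff ℝ ∞ fun z : ℝ × ℝ => B z.1 ^ 2 := by fun_prop
  have hae : ∀ z, dirDeriv (1, 0) (fun z : ℝ × ℝ => A z.2 ^ 2) z = 0 := fun z =>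
    partialX_eq_of_hasDerivAt (has.differentiableAt_infty z) (hasDerivAt_const z.1 (A z.2 ^ 2))
  have hbe : ∀ z, dirDeriv (0, 1) (fun z : ℝ × ℝ => B z.1 ^ 2) z = 0 := fun z =>
    partialY_eq_of_hasDerivAt (hbs.differentiableAt_infty z) (hasDerivAt_const z.2 (B z.1 ^ 2))
  have lu := h.memLp.locallyIntegrable (by norm_num)
  have lx := h.memLp_x.locallyIntegrable (by norm_num)
  have ly := h.memLp_y.locallyIntegrable (by norm_num)
  have hwc : HasCompactSupport fun z => u z * η z := hη.2.1.mul_left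
  obtain ⟨c₀, c₁, c₂, t0, t1, t2, hadj⟩ := h.adjoint has hbs has hbs hη hη
    (fun z => mul_comm _ _) (fun z => mul_comm _ _)
  have hH := (((t0.memLp_mul h.memLp).add (t1.memLp_mul h.memLp_x)).add
    (t2.memLp_mul h.memLp_y)).sub (hF η hη)
  obtain ⟨L₁, hL₁⟩ := hA.exists_lipschitz_sq
  obtain ⟨L₂, hL₂⟩ := hB.exists_lipschitz_sq
  have haL : LipschitzWith (max L₁ L₂) fun z : ℝ × ℝ => A z.2 ^ 2 := by
    simpa [Function.comp_def] using
      (hL₁.weaken (le_max_left L₁ L₂)).comp (LipschitzWith.prod_snd (α := ℝ) (β := ℝ))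
  have hbL : LipschitzWith (max L₁ L₂) fun z : ℝ × ℝ => B z.1 ^ 2 := by
    simpa [Function.comp_def] using
      (hL₂.weaken (le_max_right L₁ L₂)).comp (LipschitzWith.prod_fst (α := ℝ) (β := ℝ))
  have hL : ∀ φ : ℝ × ℝ → ℝ, ContDiff ℝ ∞ φ →
      ∫ z, (u z * η z) * (A z.2 ^ 2 * dirDeriv (1, 0) (dirDeriv (1, 0) φ) z +
        B z.1 ^ 2 * dirDeriv (0, 1) (dirDeriv (0, 1) φ) z) =
      ∫ z, (u z * c₀ z + ux z * c₁ z + uy z * c₂ z - F z * η z) * φ z := by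
    -- As `A(y)²` does not depend on `x` nor `B(x)²` on `y`, divergence and non-divergence form
    -- coincide.
    intro φ hφ
    rw [← hadj φ hφ]
    congr 1 with z
    rw [dirDeriv_mul (has.differentiableAt_infty z)
        ((contDiff_dirDeriv hφ _).differentiableAt_infty z),
      dirDeriv_mul (hbs.differentiableAt_infty z)
        ((contDiff_dirDeriv hφ _).differentiableAt_infty z), hae, hbe]
    ring
  obtain ⟨ρ, hρ, hρ1⟩ := exists_mollifier
  have hw := hη.memLp_mul h.memLp
  obtain ⟨K, hK⟩ := exists_uniform_bound_smear (m := c ^ 2) (M := C ^ 2) (pow_pos hA.pos 2)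
    hw hwc ((hη.memLp_mul h.memLp_x).add ((hη.dirDeriv (1, 0)).memLp_mul h.memLp))
    ((hη.memLp_mul h.memLp_y).add ((hη.dirDeriv (0, 1)).memLp_mul h.memLp))
    hH has hbs
    (fun z => pow_le_pow_left₀ hA.pos.le (hA.lower _) 2)
    (fun z => pow_le_pow_left₀ hB.pos.le (hB.lower _) 2)
    (fun z => pow_le_pow_left₀ (hA.coeff_pos _).le (hA.upper _) 2)
    (fun z => pow_le_pow_left₀ (hB.coeff_pos _).le (hB.upper _) 2)
    haL hbL hae hbe
    (fun φ hφ => h.weakX.cutoff lu hη hφ lx) (fun φ hφ => h.weakY.cutoff lu hη hφ ly) hL hρ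
  obtain ⟨gxx, m1, k1⟩ := exists_second_derivative hw hwc hρ hρ1 fun ε hε => (hK ε hε).1
  obtain ⟨gyy, m2, k2⟩ := exists_second_derivative hw hwc hρ hρ1 fun ε hε => (hK ε hε).2.1
  obtain ⟨gxy, m3, k3⟩ := exists_second_derivative hw hwc hρ hρ1 fun ε hε => (hK ε hε).2.2
  exact ⟨gxx, gxy, gyy, m1, m3, m2, fun φ hφ => ⟨k1 φ hφ, k3 φ hφ, k2 φ hφ⟩⟩

end

/-! ### Localisation: regularised weights, inner squares and cutoffs. -/

theorem exists_ellipticCoeff_eq_rpow {α κ : ℝ} (h0 : 0 < α) (h1 : α < 1) (hκ : 0 < κ)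
    (hκ' : κ < 1 / 2) :
    ∃ A : ℝ → ℝ, EllipticCoeff A (κ / 2) 1 ∧ ∀ t ∈ Ioo κ (1 - κ), A t = t ^ α := by
  let χ : ContDiffBump (1 / 2 : ℝ) :=
    ⟨1 / 2 - κ, 1 / 2 - κ / 2, by linarith, by linarith⟩
  have hsupp : ∀ t, t ∉ Ioo (κ / 2) (1 - κ / 2) → χ t = 0 := by
    intro t ht
    refine χ.zero_of_le_dist ?_
    rw [Real.dist_eq]
    by_contra hlt
    rw [not_le] at hlt
    have : |t - 1 / 2| < 1 / 2 - κ / 2 := hlt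
    rw [abs_lt] at this
    exact ht ⟨by linarith [this.1], by linarith [this.2]⟩
  have hpow : ∀ t, t ∈ Ioo (κ / 2) (1 - κ / 2) → κ / 2 ≤ t ^ α ∧ t ^ α ≤ 1 := by
    intro t ht
    have ht0 : 0 < t := by linarith [ht.1]
    refine ⟨?_, Real.rpow_le_one ht0.le (by linarith [ht.2]) h0.le⟩
    calc κ / 2 ≤ t ^ (1 : ℝ) := by rw [Real.rpow_one]; exact ht.1.le
      _ ≤ t ^ α := Real.rpow_le_rpow_of_exponent_ge ht0 (by linarith [ht.2]) h1.le
  have hsm : ContDiff ℝ ∞ fun t => χ t * (t ^ α - 1) := by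
    rw [contDiff_iff_contDiffAt]
    intro t
    rcases lt_or_ge 0 t with ht | ht
    · exact χ.contDiff.contDiffAt.mul
        ((Real.contDiffAt_rpow_const_of_ne ht.ne').sub contDiffAt_const)
    -- The bump vanishes below `κ / 2`, so the singularity of the power at `0` plays no part.
    · have : (fun t => χ t * (t ^ α - 1)) =ᶠ[𝓝 t] fun _ => 0 := by
        filter_upwards [Iio_mem_nhds (show t < κ / 2 by linarith)] with s hs
        rw [hsupp s fun h => (lt_asymm h.1 hs).elim, zero_mul]
      exact contDiffAt_const.congr_of_eventuallyEq this
  -- A convex combination of `1` and `t ^ α`; where the bump is not zero, `κ / 2 < t < 1` and so `κ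
  -- / 2 ≤ t ≤ t ^ α ≤ 1`.
  refine ⟨fun t => 1 + χ t * (t ^ α - 1), ⟨contDiff_const.add hsm, by linarith, fun t => ?_,
    fun t => ?_, ?_⟩, fun t ht => ?_⟩
  · by_cases ht : t ∈ Ioo (κ / 2) (1 - κ / 2)
    · have := hpow t ht
      nlinarith [χ.nonneg (x := t), χ.le_one (x := t)]
    · simp only [hsupp t ht]; linarith
  · by_cases ht : t ∈ Ioo (κ / 2) (1 - κ / 2)
    · have := hpow t ht
      nlinarith [χ.nonneg (x := t), χ.le_one (x := t)]
    · simp only [hsupp t ht]; linarith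
  · obtain ⟨L, hL⟩ := ContDiff.lipschitzWith_of_hasCompactSupport
      (χ.hasCompactSupport.mul_right (f' := fun t => t ^ α - 1)) hsm (by simp)
    refine ⟨L, fun s t => ?_⟩
    rw [edist_add_left]
    exact hL s t
  · have : χ t = 1 := by
      refine χ.one_of_mem_closedBall ?_
      rw [Metric.mem_closedBall, Real.dist_eq, abs_le]
      constructor
      · show -(1 / 2 - κ) ≤ _
        linarith [ht.1]
      · show _ ≤ (1 / 2 - κ)
        linarith [ht.2]
    simp [this]

/-- The concentric open square at distance `κ` from the boundary of the unit square. -/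
def innerSquare (κ : ℝ) : Set (ℝ × ℝ) := Ioo κ (1 - κ) ×ˢ Ioo κ (1 - κ)

theorem isOpen_innerSquare (κ : ℝ) : IsOpen (innerSquare κ) := isOpen_Ioo.prod isOpen_Ioo

theorem innerSquare_subset {κ : ℝ} (hκ : 0 < κ) : innerSquare κ ⊆ unitSquare :=
  prod_mono (Ioo_subset_Ioo hκ.le (by linarith)) (Ioo_subset_Ioo hκ.le (by linarith))

theorem exists_subset_innerSquare {K : Set (ℝ × ℝ)} (hK : IsCompact K) (hKS : K ⊆ unitSquare) :
    ∃ κ : ℝ, 0 < κ ∧ κ < 1 / 2 ∧ K ⊆ innerSquare κ := by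
  obtain ⟨a, ha, h⟩ := hK.exists_forall_le'
    (f := fun z : ℝ × ℝ => min (min z.1 (1 - z.1)) (min z.2 (1 - z.2)))
    (Continuous.continuousOn (by fun_prop)) (a := 0) fun z hz => by
      have h1 := (hKS hz).1
      have h2 := (hKS hz).2
      simp only [lt_min_iff]
      exact ⟨⟨h1.1, by linarith [h1.2]⟩, h2.1, by linarith [h2.2]⟩
  have hm1 : min (a / 2) (1 / 4) ≤ a / 2 := min_le_left _ _
  refine ⟨min (a / 2) (1 / 4), by positivity, (min_le_right _ _).trans_lt (by norm_num),
    fun z hz => ?_⟩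
  have := h z hz
  simp only [le_min_iff] at this
  exact ⟨⟨by linarith [this.1.1], by linarith [this.1.2]⟩,
    by linarith [this.2.1], by linarith [this.2.2]⟩

/-- The cutoff must equal `1` on an open neighbourhood of `K`, so that test functions supported
there do not see it. -/
theorem exists_cutoff {K : Set (ℝ × ℝ)} {κ : ℝ} (hκ : 0 < κ) (hK : IsClosed K)
    (hKκ : K ⊆ innerSquare κ) :
    ∃ η : ℝ × ℝ → ℝ, IsTestFunction (innerSquare (κ / 2)) η ∧
      ∃ N : Set (ℝ × ℝ), IsOpen N ∧ K ⊆ N ∧ N ⊆ innerSquare κ ∧ ∀ z ∈ N, η z = 1 := by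
  set t : Set (ℝ × ℝ) := Icc κ (1 - κ) ×ˢ Icc κ (1 - κ)
  have ht : IsCompact t := isCompact_Icc.prod isCompact_Icc
  have hsub : innerSquare κ ⊆ interior t :=
    interior_maximal (prod_mono Ioo_subset_Icc_self Ioo_subset_Icc_self) (isOpen_innerSquare κ)
  obtain ⟨η, h1, h2, -⟩ := exists_contMDiffMap_one_nhds_of_subset_interior (n := ⊤)
    (modelWithCornersSelf ℝ (ℝ × ℝ)) hK (hKκ.trans hsub)
  obtain ⟨N, hN, hKN, hN1⟩ := mem_nhdsSet_iff_exists.1 h1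
  have hts : tsupport η ⊆ t := closure_minimal
    (fun z hz => by_contra fun h => hz (h2 z h)) ht.isClosed
  refine ⟨η, ⟨η.contMDiff.contDiff, ht.of_isClosed_subset (isClosed_tsupport _) hts,
    hts.trans ?_⟩, N ∩ innerSquare κ, hN.inter (isOpen_innerSquare κ), subset_inter hKN hKκ,
    inter_subset_right, fun z hz => hN1 hz.1⟩
  exact prod_mono (Icc_subset_Ioo (by linarith) (by linarith))
    (Icc_subset_Ioo (by linarith) (by linarith))

theorem integral_indicator_mul {U : Set (ℝ × ℝ)} (hU : U ⊆ unitSquare) {φ : ℝ × ℝ → ℝ}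
    (hφ : ∀ z, z ∉ U → φ z = 0) (g : ℝ × ℝ → ℝ) :
    ∫ z, U.indicator g z * φ z = ∫ z in unitSquare, g z * φ z := by
  rw [← setIntegral_eq_integral_of_forall_compl_eq_zero (s := unitSquare)
    fun z hz => by rw [hφ z fun h => hz (hU h), mul_zero]]
  congr 1 with z
  by_cases hz : z ∈ U
  · rw [indicator_of_mem hz]
  · rw [hφ z hz, mul_zero, mul_zero]

/-- This makes test functions admissible in the weak formulation; the approximating sequence is
constant. -/
theorem inH0_of_isTestFunction {α₁ α₂ : ℝ} (h₁ : 0 < α₁) (h₂ : 0 < α₂) {V φ : ℝ × ℝ → ℝ}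
    (hV : IntegrableOn V unitSquare) (hφ : IsTestFunction unitSquare φ) :
    InH0 α₁ α₂ V φ (partialX φ) (partialY φ) := by
  have hx := hφ.dirDeriv (1, 0)
  have hy := hφ.dirDeriv (0, 1)
  have weak : ∀ (e : ℝ × ℝ) (ψ : ℝ × ℝ → ℝ), IsTestFunction unitSquare ψ →
      ∫ z in unitSquare, φ z * dirDeriv e ψ z = -∫ z in unitSquare, dirDeriv e φ z * ψ z := by
    intro e ψ hψ
    rw [setIntegral_eq_integral_of_forall_compl_eq_zero fun z hz => by
        rw [hφ.eq_zero hz, zero_mul],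
      setIntegral_eq_integral_of_forall_compl_eq_zero fun z hz => by
        rw [hψ.eq_zero hz, mul_zero]]
    exact integral_mul_dirDeriv (hφ.mono (subset_univ _)) hψ.1 e
  have hc1 : Continuous fun z : ℝ × ℝ => z.2 ^ α₁ :=
    continuous_snd.rpow_const fun _ => Or.inr h₁.le
  have hc2 : Continuous fun z : ℝ × ℝ => z.1 ^ α₂ :=
    continuous_fst.rpow_const fun _ => Or.inr h₂.le
  refine ⟨⟨⟨(hφ.memLp 2).restrict _,
    ⟨hφ.continuous.locallyIntegrable.locallyIntegrableOn _,
      hx.continuous.locallyIntegrable.locallyIntegrableOn _, weak (1, 0)⟩,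
    ⟨hφ.continuous.locallyIntegrable.locallyIntegrableOn _,
      hy.continuous.locallyIntegrable.locallyIntegrableOn _, weak (0, 1)⟩, ?_, ?_⟩,
    fun _ => φ, fun _ => hφ, ?_⟩, ?_⟩
  · exact MemLp.restrict _ ((hc1.mul hx.continuous).memLp_of_hasCompactSupport hx.2.1.mul_left)
  · exact MemLp.restrict _ ((hc2.mul hy.continuous).memLp_of_hasCompactSupport hy.2.1.mul_left)
  · simp [weightedH1Norm]
  · obtain ⟨C, hC⟩ := (hφ.mul_smooth hφ.1).exists_bound
    have h := Integrable.mul_bdd (c := C) (g := fun z => φ z * φ z) hV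
      (hφ.continuous.mul hφ.continuous).aestronglyMeasurable (Eventually.of_forall hC)
    simpa only [IntegrableOn, sq] using h

/-! ### From the weak solution to local regularity: the bootstrap. -/

section

variable {α₁ α₂ κ : ℝ} {V f u ux uy : ℝ × ℝ → ℝ} {A B : ℝ → ℝ}

theorem memLp_indicator_of_weighted {U : Set (ℝ × ℝ)} (hU : IsOpen U) (hUS : U ⊆ unitSquare)
    {g θ : ℝ × ℝ → ℝ} {c : ℝ} (hc : 0 < c) (hθ : ∀ z ∈ U, c ≤ θ z)
    (hg : LocallyIntegrableOn g unitSquare)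
    (h : InL2 unitSquare fun z => θ z * g z) : MemLp (U.indicator g) 2 := by
  rw [memLp_indicator_iff_restrict hU.measurableSet]
  have h1 : MemLp (fun z => θ z * g z) 2 (volume.restrict U) :=
    MemLp.mono_measure (Measure.restrict_mono hUS le_rfl) h
  refine h1.of_le_mul (c := c⁻¹) (hg.aestronglyMeasurable.mono_measure
    (Measure.restrict_mono hUS le_rfl)) ?_
  filter_upwards [ae_restrict_mem hU.measurableSet] with z hz
  rw [norm_mul, ← mul_assoc, Real.norm_of_nonneg (hc.le.trans (hθ z hz))]
  refine le_mul_of_one_le_left (norm_nonneg _) ?_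
  rw [inv_mul_eq_div, one_le_div hc]
  exact hθ z hz

theorem InH0.integrableOn_mul {p : ℝ≥0∞} (hp : 2 ≤ p)
    (hV : MemLp V p (volume.restrict unitSquare)) (hu : InH0 α₁ α₂ V u ux uy) :
    IntegrableOn (fun z => V z * u z) unitSquare :=
  MemLp.integrable_mul (hV.mono_exponent hp) hu.memH10.memH1.memL2

/-- On the inner square the degenerate weights agree with the regular coefficients, and their lower
bound makes the unweighted gradient square integrable. The potential term is moved to the right
side. -/
theorem LocalSolution.of_weak {p : ℝ≥0∞} (hp : 2 ≤ p) (h₁ : 0 < α₁) (h₂ : 0 < α₂)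
    (hA : EllipticCoeff A (κ / 2) 1) (hB : EllipticCoeff B (κ / 2) 1) (hκ : 0 < κ)
    (hAκ : ∀ t ∈ Ioo κ (1 - κ), A t = t ^ α₁) (hBκ : ∀ t ∈ Ioo κ (1 - κ), B t = t ^ α₂)
    (hV : MemLp V p (volume.restrict unitSquare)) (hf : MemLp f 2 (volume.restrict unitSquare))
    (hu : InH0 α₁ α₂ V u ux uy)
    (heq : ∀ v vx vy : ℝ × ℝ → ℝ, InH0 α₁ α₂ V v vx vy →
      bilinForm α₁ α₂ V u ux uy v vx vy = ∫ z in unitSquare, f z * v z) :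
    LocalSolution (innerSquare κ) (fun z => A z.2 ^ 2) (fun z => B z.1 ^ 2)
      ((innerSquare κ).indicator u) ((innerSquare κ).indicator ux) ((innerSquare κ).indicator uy)
      ((innerSquare κ).indicator fun z => f z - V z * u z) := by
  have hUS := innerSquare_subset hκ
  have hUo := isOpen_innerSquare κ
  have hAs := hA.smooth
  have hBs := hB.smooth
  have hVu := hu.integrableOn_mul hp hV
  have hV1 : IntegrableOn V unitSquare :=
    memLp_one_iff_integrable.1 (hV.mono_exponent (le_trans (by norm_num) hp))
  have hf1 : IntegrableOn f unitSquare :=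
    memLp_one_iff_integrable.1 (hf.mono_exponent (by norm_num))
  have mx : MemLp ((innerSquare κ).indicator ux) 2 :=
    memLp_indicator_of_weighted hUo hUS hA.pos
      (fun z hz => by rw [← hAκ _ hz.2]; exact hA.lower _)
      hu.memH10.memH1.weakX.2.1 hu.memH10.memH1.memL2_x
  have my : MemLp ((innerSquare κ).indicator uy) 2 :=
    memLp_indicator_of_weighted hUo hUS hB.pos
      (fun z hz => by rw [← hBκ _ hz.1]; exact hB.lower _)
      hu.memH10.memH1.weakY.2.1 hu.memH10.memH1.memL2_y
  have mVu : Integrable ((innerSquare κ).indicator fun z => V z * u z) :=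
    (integrable_indicator_iff hUo.measurableSet).2 (hVu.mono_set hUS)
  have mF : Integrable ((innerSquare κ).indicator fun z => f z - V z * u z) :=
    (integrable_indicator_iff hUo.measurableSet).2 ((hf1.sub hVu).mono_set hUS)
  refine ⟨?_, mx, my, fun ζ hζ => hζ.integrable_mul mF.locallyIntegrable, fun φ hφ => ?_,
    fun φ hφ => ?_, fun φ hφ => ?_⟩
  · rw [memLp_indicator_iff_restrict hUo.measurableSet]
    exact MemLp.mono_measure (Measure.restrict_mono hUS le_rfl) hu.memH10.memH1.memL2
  · rw [integral_indicator_mul hUS (fun z hz => (hφ.dirDeriv _).eq_zero hz),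
      integral_indicator_mul hUS (fun z hz => hφ.eq_zero hz)]
    exact hu.memH10.memH1.weakX.2.2 φ (hφ.mono hUS)
  · rw [integral_indicator_mul hUS (fun z hz => (hφ.dirDeriv _).eq_zero hz),
      integral_indicator_mul hUS (fun z hz => hφ.eq_zero hz)]
    exact hu.memH10.memH1.weakY.2.2 φ (hφ.mono hUS)
  · have hφS := hφ.mono hUS
    have h := heq _ _ _ (inH0_of_isTestFunction h₁ h₂ hV1 hφS)
    have i1 := ((hφ.dirDeriv (1, 0)).smooth_mul
      (ψ := fun z => A z.2 ^ 2) (by fun_prop)).integrable_mul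
      (mx.locallyIntegrable (by norm_num))
    have i2 := ((hφ.dirDeriv (0, 1)).smooth_mul
      (ψ := fun z => B z.1 ^ 2) (by fun_prop)).integrable_mul
      (my.locallyIntegrable (by norm_num))
    have i3 := hφ.integrable_mul mVu.locallyIntegrable
    have i4 := hφ.integrable_mul mF.locallyIntegrable
    have i12 : Integrable fun z =>
        (innerSquare κ).indicator ux z * (A z.2 ^ 2 * dirDeriv (1, 0) φ z) +
        (innerSquare κ).indicator uy z * (B z.1 ^ 2 * dirDeriv (0, 1) φ z) := i1.add i2
    have hb : bilinForm α₁ α₂ V u ux uy φ (partialX φ) (partialY φ) =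
        ((∫ z, (innerSquare κ).indicator ux z * (A z.2 ^ 2 * dirDeriv (1, 0) φ z)) +
          (∫ z, (innerSquare κ).indicator uy z * (B z.1 ^ 2 * dirDeriv (0, 1) φ z))) +
          ∫ z, (innerSquare κ).indicator (fun z => V z * u z) z * φ z := by
      rw [← integral_add i1 i2, ← integral_add i12 i3, bilinForm, partialX_eq_dirDeriv,
        partialY_eq_dirDeriv]
      rw [setIntegral_eq_integral_of_forall_compl_eq_zero fun z hz => by
        rw [hφS.eq_zero hz, (hφS.dirDeriv _).eq_zero hz, (hφS.dirDeriv _).eq_zero hz]; ring]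
      congr 1 with z
      by_cases hz : z ∈ innerSquare κ
      · simp only [indicator_of_mem hz]
        rw [hAκ _ hz.2, hBκ _ hz.1]
        ring
      · rw [hφ.eq_zero hz, (hφ.dirDeriv _).eq_zero hz, (hφ.dirDeriv _).eq_zero hz]
        ring
    have hF : ∫ z, (innerSquare κ).indicator (fun z => f z - V z * u z) z * φ z =
        (∫ z in unitSquare, f z * φ z) -
          ∫ z, (innerSquare κ).indicator (fun z => V z * u z) z * φ z := by
      have mf : Integrable ((innerSquare κ).indicator f) :=
        (integrable_indicator_iff hUo.measurableSet).2 (hf1.mono_set hUS)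
      rw [← integral_indicator_mul hUS (fun z hz => hφ.eq_zero hz) f,
        ← integral_sub (hφ.integrable_mul mf.locallyIntegrable) i3]
      congr 1 with z
      by_cases hz : z ∈ innerSquare κ
      · simp only [indicator_of_mem hz]
        ring
      · simp only [indicator_of_notMem hz]
        ring
    rw [hF]
    linarith

/-- Write `V u = √V · (√V u)`: the first factor is in `L⁴` because `V` is in `L²`, the second in
`L²` by finiteness of the energy, and `1/4 + 1/2 = 3/4`. The product of an `L²` potential with an
`L²` function alone would give only `L¹`, the excluded endpoint. -/
theorem InH0.memLp_potential_term {p : ℝ≥0∞} (hp : 2 ≤ p)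
    (hV : MemLp V p (volume.restrict unitSquare))
    (hV0 : ∀ᵐ z ∂(volume.restrict unitSquare), 0 ≤ V z) (hu : InH0 α₁ α₂ V u ux uy) :
    MemLp (fun z => V z * u z) (ENNReal.ofReal (4 / 3)) (volume.restrict unitSquare) := by
  have hum := hu.memH10.memH1.memL2.1
  have hV2 : MemLp V 2 (volume.restrict unitSquare) := hV.mono_exponent hp
  have hs : AEStronglyMeasurable (fun z => √(V z)) (volume.restrict unitSquare) :=
    Real.continuous_sqrt.comp_aestronglyMeasurable hV2.1
  have h1 : MemLp (fun z => √(V z)) 4 (volume.restrict unitSquare) := by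
    have h := hV2.norm_rpow_div (ENNReal.ofReal (1 / 2))
    rw [show (2 : ℝ≥0∞) / ENNReal.ofReal (1 / 2) = 4 by
      rw [show ENNReal.ofReal (1 / 2) = 2⁻¹ by
        rw [one_div, ENNReal.ofReal_inv_of_pos two_pos]; simp, div_eq_mul_inv, inv_inv]
      norm_num] at h
    refine h.ae_eq ?_
    filter_upwards [hV0] with z hz
    rw [Real.norm_of_nonneg hz, Real.sqrt_eq_rpow, ENNReal.toReal_ofReal (by norm_num)]
  have h2 : MemLp (fun z => √(V z) * u z) 2 (volume.restrict unitSquare) := by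
    have hm : AEStronglyMeasurable (fun z => √(V z) * u z) (volume.restrict unitSquare) :=
      hs.mul hum
    rw [memLp_two_iff_integrable_sq hm]
    refine hu.integrable_potential.congr ?_
    filter_upwards [hV0] with z hz
    rw [mul_pow, Real.sq_sqrt hz]
  have : ENNReal.HolderTriple 4 2 (ENNReal.ofReal (4 / 3)) := ⟨by
    have e4 : (4 : ℝ≥0∞) = ENNReal.ofReal 4 := by simp
    have e2 : (2 : ℝ≥0∞) = ENNReal.ofReal 2 := by simp
    rw [e4, e2, ← ENNReal.ofReal_inv_of_pos (by norm_num), ← ENNReal.ofReal_inv_of_pos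
      (by norm_num), ← ENNReal.ofReal_inv_of_pos (by norm_num), ← ENNReal.ofReal_add
      (by norm_num) (by norm_num)]
    norm_num⟩
  refine (h2.mul h1).ae_eq ?_
  filter_upwards [hV0] with z hz
  simp only [Pi.mul_apply]
  rw [← mul_assoc, Real.mul_self_sqrt hz]

/-- The regularity of a weak solution near a compact subset of the unit square. -/
theorem exists_regular_near_compact {p : ℝ≥0∞} (hp : 2 ≤ p) (h₁ : α₁ ∈ Ioo (0 : ℝ) (1 / 2))
    (h₂ : α₂ ∈ Ioo (0 : ℝ) (1 / 2)) (hV : MemLp V p (volume.restrict unitSquare))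
    (hV0 : ∀ᵐ z ∂(volume.restrict unitSquare), 0 ≤ V z)
    (hf : MemLp f 2 (volume.restrict unitSquare)) (hu : InH0 α₁ α₂ V u ux uy)
    (heq : ∀ v vx vy : ℝ × ℝ → ℝ, InH0 α₁ α₂ V v vx vy →
      bilinForm α₁ α₂ V u ux uy v vx vy = ∫ z in unitSquare, f z * v z)
    {K : Set (ℝ × ℝ)} (hK : IsCompact K) (hKS : K ⊆ unitSquare) :
    ∃ N : Set (ℝ × ℝ), IsOpen N ∧ K ⊆ N ∧ N ⊆ unitSquare ∧
      MemLp ux 2 (volume.restrict N) ∧ MemLp uy 2 (volume.restrict N) ∧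
      (∃ v : ℝ × ℝ → ℝ, v =ᵐ[volume.restrict N] u ∧ ∀ α : ℝ, 0 < α → α < 1 →
        ∃ M : ℝ, 0 ≤ M ∧ ∀ w ∈ unitSquare, ∀ w' ∈ unitSquare, |v w - v w'| ≤ M * dist w w' ^ α) ∧
      ∃ gxx gxy gyy : ℝ × ℝ → ℝ, MemLp gxx 2 ∧ MemLp gxy 2 ∧ MemLp gyy 2 ∧
        ∀ φ : ℝ × ℝ → ℝ, IsTestFunction N φ →
          ∫ z in unitSquare, u z * dirDeriv (1, 0) (dirDeriv (1, 0) φ) z = ∫ z, gxx z * φ z ∧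
          ∫ z in unitSquare, u z * dirDeriv (1, 0) (dirDeriv (0, 1) φ) z = ∫ z, gxy z * φ z ∧
          ∫ z in unitSquare, u z * dirDeriv (0, 1) (dirDeriv (0, 1) φ) z = ∫ z, gyy z * φ z := by
  obtain ⟨κ', hκ0', hκ1', hKκ⟩ := exists_subset_innerSquare hK hKS
  obtain ⟨η, hη, N, hNo, hKN, hNκ, hN1⟩ := exists_cutoff hκ0' hK.isClosed hKκ
  -- The cutoff for `innerSquare κ'` is supported in the larger square with `κ' / 2`; the
  -- coefficients have to agree with the weights on that one.
  set κ := κ' / 2 with hκdef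
  have hκ : 0 < κ := by positivity
  have hκ' : κ < 1 / 2 := by rw [hκdef]; linarith
  obtain ⟨A, hA, hAκ⟩ := exists_ellipticCoeff_eq_rpow h₁.1 (by linarith [h₁.2]) hκ hκ'
  obtain ⟨B, hB, hBκ⟩ := exists_ellipticCoeff_eq_rpow h₂.1 (by linarith [h₂.2]) hκ hκ'
  have hUS := innerSquare_subset hκ
  have hUm := (isOpen_innerSquare κ).measurableSet
  have hloc := LocalSolution.of_weak hp h₁.1 h₂.1 hA hB hκ hAκ hBκ hV hf hu heq
  have hNS : N ⊆ innerSquare κ := hNκ.trans (prod_mono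
    (Ioo_subset_Ioo (by linarith) (by linarith)) (Ioo_subset_Ioo (by linarith) (by linarith)))
  have toInd : ∀ {g : ℝ × ℝ → ℝ} {r : ℝ≥0∞}, MemLp g r (volume.restrict unitSquare) →
      MemLp ((innerSquare κ).indicator g) r := fun hg =>
    (memLp_indicator_iff_restrict hUm).2
      (MemLp.mono_measure (Measure.restrict_mono hUS le_rfl) hg)
  have hF43 : ∀ ζ, IsTestFunction (innerSquare κ) ζ → MemLp (fun z =>
      (innerSquare κ).indicator (fun z => f z - V z * u z) z * ζ z) (ENNReal.ofReal (4 / 3)) :=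
    fun ζ hζ => hζ.memLp_mul (toInd ((hf.mono_exponent
      (ENNReal.ofReal_le_of_le_toReal (by norm_num))).sub (hu.memLp_potential_term hp hV hV0)))
  -- Second round: the first round, with `ζ` itself as the cutoff, bounds `u ζ`, and therefore `V (u
  -- ζ)` is as integrable as `V`.
  have hF2 : ∀ ζ, IsTestFunction (innerSquare κ) ζ → MemLp (fun z =>
      (innerSquare κ).indicator (fun z => f z - V z * u z) z * ζ z) 2 := by
    intro ζ hζ
    obtain ⟨M, hM⟩ := hloc.exists_ae_bound hA hB hUS hF43 hζ
    have k1 := hζ.memLp_mul (toInd hf)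
    have hVi := toInd (hV.mono_exponent hp)
    have k2 : MemLp (fun z => (innerSquare κ).indicator V z *
        ((innerSquare κ).indicator u z * ζ z)) 2 := by
      refine hVi.of_le_mul (c := M)
        (hVi.1.mul (hloc.memLp.1.mul hζ.continuous.aestronglyMeasurable)) ?_
      filter_upwards [hM] with z hz
      rw [norm_mul, mul_comm]
      gcongr
      exact hz
    refine (k1.sub k2).ae_eq (Eventually.of_forall fun z => ?_)
    by_cases hz : z ∈ innerSquare κ
    · simp only [Pi.sub_apply, indicator_of_mem hz]
      ring
    · simp only [Pi.sub_apply, indicator_of_notMem hz]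
      ring
  have mN : ∀ {g : ℝ × ℝ → ℝ}, MemLp ((innerSquare κ).indicator g) 2 →
      MemLp g 2 (volume.restrict N) := fun hg =>
    MemLp.mono_measure (Measure.restrict_mono hNS le_rfl)
      ((memLp_indicator_iff_restrict hUm).1 hg)
  obtain ⟨v, hv, hvh⟩ := hloc.exists_holder hA hB hUS hF2 hη
  obtain ⟨gxx, gxy, gyy, m1, m2, m3, hg⟩ := hloc.exists_second_derivatives hA hB hF2 hη
  have key : ∀ φ : ℝ × ℝ → ℝ, IsTestFunction N φ →
      ∫ z in unitSquare, u z * φ z = ∫ z, ((innerSquare κ).indicator u z * η z) * φ z := by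
    intro φ hφ
    rw [← integral_indicator_mul hUS (fun z hz => hφ.eq_zero fun h => hz (hNS h))]
    congr 1 with z
    by_cases hz : z ∈ N
    · rw [hN1 z hz, mul_one]
    · rw [hφ.eq_zero hz, mul_zero, mul_zero]
  refine ⟨N, hNo, hKN, hNS.trans hUS, mN hloc.memLp_x, mN hloc.memLp_y, ⟨v, ?_, hvh⟩,
    gxx, gxy, gyy, m1, m2, m3, fun φ hφ => ?_⟩
  · filter_upwards [ae_restrict_of_ae_restrict_of_subset (hNS.trans hUS) hv,
      ae_restrict_mem hNo.measurableSet] with z hz hzN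
    rw [hz, hN1 z hzN, mul_one, indicator_of_mem (hNS hzN)]
  · have := hg φ (hφ.mono (subset_univ _))
    rw [key _ ((hφ.dirDeriv _).dirDeriv _), key _ ((hφ.dirDeriv _).dirDeriv _),
      key _ ((hφ.dirDeriv _).dirDeriv _)]
    exact this

end

/-! ### Membership in `H²` of compactly contained sets. -/

theorem IsTestFunction.setIntegral_mul {U W : Set (ℝ × ℝ)} {φ : ℝ × ℝ → ℝ}
    (hφ : IsTestFunction U φ) (hUW : U ⊆ W) (g : ℝ × ℝ → ℝ) :
    ∫ z in W, g z * φ z = ∫ z, g z * φ z :=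
  setIntegral_eq_integral_of_forall_compl_eq_zero fun z hz => by
    rw [hφ.eq_zero fun h => hz (hUW h), mul_zero]

section

variable {α₁ α₂ : ℝ} {V f u ux uy : ℝ × ℝ → ℝ}

theorem inSobolevH_two_of_weak {p : ℝ≥0∞} (hp : 2 ≤ p) (h₁ : α₁ ∈ Ioo (0 : ℝ) (1 / 2))
    (h₂ : α₂ ∈ Ioo (0 : ℝ) (1 / 2)) (hV : MemLp V p (volume.restrict unitSquare))
    (hV0 : ∀ᵐ z ∂(volume.restrict unitSquare), 0 ≤ V z)
    (hf : MemLp f 2 (volume.restrict unitSquare)) (hu : InH0 α₁ α₂ V u ux uy)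
    (heq : ∀ v vx vy : ℝ × ℝ → ℝ, InH0 α₁ α₂ V v vx vy →
      bilinForm α₁ α₂ V u ux uy v vx vy = ∫ z in unitSquare, f z * v z)
    {U : Set (ℝ × ℝ)} (hU : CompactlyContained U unitSquare) : InSobolevH U 2 u := by
  obtain ⟨N, hNo, hKN, hNS, hx, hy, -, gxx, gxy, gyy, m1, m2, m3, hg⟩ :=
    exists_regular_near_compact hp h₁ h₂ hV hV0 hf hu heq hU.1 hU.2
  have hUN : U ⊆ N := subset_closure.trans hKN
  have hUS : U ⊆ unitSquare := hUN.trans hNS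
  have toU : ∀ {g : ℝ × ℝ → ℝ} {W : Set (ℝ × ℝ)}, U ⊆ W → MemLp g 2 (volume.restrict W) →
      InL2 U g := fun hUW hg => MemLp.mono_measure (Measure.restrict_mono hUW le_rfl) hg
  have hH1 := hu.memH10.memH1
  have lu := hH1.weakX.1.mono_set hUS
  have lx := hH1.weakX.2.1.mono_set hUS
  have ly := hH1.weakY.2.1.mono_set hUS
  have lg : ∀ {g : ℝ × ℝ → ℝ}, MemLp g 2 → LocallyIntegrableOn g U := fun hg =>
    (hg.locallyIntegrable (by norm_num)).locallyIntegrableOn U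
  have first : ∀ {e : ℝ × ℝ} {ue : ℝ × ℝ → ℝ},
      (∀ φ, IsTestFunction unitSquare φ →
        ∫ z in unitSquare, u z * dirDeriv e φ z = -∫ z in unitSquare, ue z * φ z) →
      ∀ φ, IsTestFunction U φ → ∫ z in U, u z * dirDeriv e φ z = -∫ z in U, ue z * φ z := by
    intro e ue h φ hφ
    rw [(hφ.dirDeriv e).setIntegral_mul subset_rfl, hφ.setIntegral_mul subset_rfl,
      ← (hφ.dirDeriv e).setIntegral_mul hUS, ← hφ.setIntegral_mul hUS]
    exact h φ (hφ.mono hUS)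
  have second : ∀ {e e' : ℝ × ℝ} {ue g : ℝ × ℝ → ℝ},
      (∀ φ, IsTestFunction unitSquare φ →
        ∫ z in unitSquare, u z * dirDeriv e φ z = -∫ z in unitSquare, ue z * φ z) →
      (∀ φ, IsTestFunction N φ →
        ∫ z in unitSquare, u z * dirDeriv e (dirDeriv e' φ) z = ∫ z, g z * φ z) →
      ∀ φ, IsTestFunction U φ → ∫ z in U, ue z * dirDeriv e' φ z = -∫ z in U, g z * φ z := by
    intro e e' ue g h hg φ hφ
    have k1 := h _ ((hφ.dirDeriv e').mono hUS)
    have k2 := hg φ (hφ.mono hUN)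
    rw [(hφ.dirDeriv e').setIntegral_mul subset_rfl, hφ.setIntegral_mul subset_rfl,
      ← (hφ.dirDeriv e').setIntegral_mul hUS]
    linarith
  refine ⟨toU hUS hH1.memL2, ux, uy, ⟨lu, lx, first hH1.weakX.2.2⟩,
    ⟨lu, ly, first hH1.weakY.2.2⟩, ⟨toU hUN hx, gxx, gxy, ⟨lx, lg m1, ?_⟩, ⟨lx, lg m2, ?_⟩,
      m1.restrict U, m2.restrict U⟩,
    ⟨toU hUN hy, gxy, gyy, ⟨ly, lg m2, ?_⟩, ⟨ly, lg m3, ?_⟩, m2.restrict U, m3.restrict U⟩⟩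
  · exact second hH1.weakX.2.2 fun φ hφ => (hg φ hφ).1
  · exact second hH1.weakX.2.2 fun φ hφ => (hg φ hφ).2.1
  -- The same `gxy` serves for both mixed derivatives, by symmetry of the second derivative of the
  -- test function.
  · refine second hH1.weakY.2.2 fun φ hφ => ?_
    rw [← (hg φ hφ).2.1]
    congr 1 with z
    rw [dirDeriv_comm hφ.1]
  · exact second hH1.weakY.2.2 fun φ hφ => (hg φ hφ).2.2

/-! ### A single continuous version on the whole square. -/

/-- `v` is a continuous version of `u` near `z`. -/
def IsContVersionAt (u v : ℝ × ℝ → ℝ) (z : ℝ × ℝ) : Prop :=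
  ∃ N : Set (ℝ × ℝ), IsOpen N ∧ z ∈ N ∧ ContinuousOn v N ∧ v =ᵐ[volume.restrict N] u

/-- Continuous functions equal almost everywhere on an open set coincide there. Versions obtained
from different cutoffs therefore glue to one function, chosen before the exponent and the subset. -/
theorem IsContVersionAt.eq {v v' : ℝ × ℝ → ℝ} {z : ℝ × ℝ} (h : IsContVersionAt u v z)
    (h' : IsContVersionAt u v' z) : v z = v' z := by
  obtain ⟨N, hN, hz, hc, he⟩ := h
  obtain ⟨N', hN', hz', hc', he'⟩ := h'
  have h1 := ae_restrict_of_ae_restrict_of_subset (inter_subset_left (s := N) (t := N')) he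
  have h2 := ae_restrict_of_ae_restrict_of_subset (inter_subset_right (s := N) (t := N')) he'
  have h3 : v =ᵐ[volume.restrict (N ∩ N')] v' := by
    filter_upwards [h1, h2] with x k1 k2
    rw [k1, k2]
  exact Measure.eqOn_open_of_ae_eq h3 (hN.inter hN') (hc.mono inter_subset_left)
    (hc'.mono inter_subset_right) ⟨hz, hz'⟩

open scoped Classical in
/-- The value at `z` of a continuous version of `u` near `z`, if there is one. -/
noncomputable def contVersion (u : ℝ × ℝ → ℝ) (z : ℝ × ℝ) : ℝ :=
  if h : ∃ v, IsContVersionAt u v z then h.choose z else u z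

theorem IsContVersionAt.contVersion_eq {v : ℝ × ℝ → ℝ} {z : ℝ × ℝ} (h : IsContVersionAt u v z) :
    contVersion u z = v z := by
  have hex : ∃ v, IsContVersionAt u v z := ⟨v, h⟩
  rw [contVersion, dif_pos hex]
  exact hex.choose_spec.eq h

theorem unitSquare_eq_iUnion : unitSquare = ⋃ n : ℕ, innerSquare (1 / ((n : ℝ) + 3)) := by
  refine Subset.antisymm (fun z hz => ?_)
    (iUnion_subset fun n => innerSquare_subset (by positivity))
  obtain ⟨κ, h0, -, hκ⟩ := exists_subset_innerSquare (isCompact_singleton (x := z))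
    (singleton_subset_iff.2 hz)
  obtain ⟨n, hn⟩ := exists_nat_one_div_lt h0
  have hle : 1 / ((n : ℝ) + 3) ≤ κ := by
    refine le_trans ?_ hn.le
    gcongr
    norm_num
  have hz' := singleton_subset_iff.1 hκ
  exact mem_iUnion.2 ⟨n, ⟨⟨by linarith [hz'.1.1], by linarith [hz'.1.2]⟩,
    by linarith [hz'.2.1], by linarith [hz'.2.2]⟩⟩

theorem holderOnWith_of_abs_sub_le {s : Set (ℝ × ℝ)} {v : ℝ × ℝ → ℝ} {M : ℝ} {α : ℝ≥0} (hM : 0 ≤ M)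
    (h : ∀ w ∈ s, ∀ w' ∈ s, |v w - v w'| ≤ M * dist w w' ^ (α : ℝ)) :
    HolderOnWith M.toNNReal α v s := by
  intro w hw w' hw'
  change _ ≤ ENNReal.ofReal M * _
  rw [edist_dist, edist_dist, Real.dist_eq, ENNReal.ofReal_rpow_of_nonneg dist_nonneg α.coe_nonneg,
    ← ENNReal.ofReal_mul hM]
  exact ENNReal.ofReal_le_ofReal (h w hw w' hw')

theorem exists_holder_contVersion_near_compact {p : ℝ≥0∞} (hp : 2 ≤ p)
    (h₁ : α₁ ∈ Ioo (0 : ℝ) (1 / 2)) (h₂ : α₂ ∈ Ioo (0 : ℝ) (1 / 2))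
    (hV : MemLp V p (volume.restrict unitSquare))
    (hV0 : ∀ᵐ z ∂(volume.restrict unitSquare), 0 ≤ V z)
    (hf : MemLp f 2 (volume.restrict unitSquare)) (hu : InH0 α₁ α₂ V u ux uy)
    (heq : ∀ v vx vy : ℝ × ℝ → ℝ, InH0 α₁ α₂ V v vx vy →
      bilinForm α₁ α₂ V u ux uy v vx vy = ∫ z in unitSquare, f z * v z)
    {K : Set (ℝ × ℝ)} (hK : IsCompact K) (hKS : K ⊆ unitSquare) :
    contVersion u =ᵐ[volume.restrict K] u ∧
      ∀ α : ℝ≥0, 0 < α → α < 1 → ∃ C : ℝ≥0, HolderOnWith C α (contVersion u) K := by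
  obtain ⟨N, hN, hKN, hNS, -, -, ⟨v, hvu, hv⟩, -⟩ :=
    exists_regular_near_compact hp h₁ h₂ hV hV0 hf hu heq hK hKS
  have hol : ∀ α : ℝ≥0, 0 < α → α < 1 → ∃ C : ℝ≥0, HolderOnWith C α v unitSquare := by
    intro α h0 h1
    obtain ⟨M, hM, hMv⟩ := hv α (by exact_mod_cast h0) (by exact_mod_cast h1)
    exact ⟨_, holderOnWith_of_abs_sub_le hM hMv⟩
  -- Any exponent would do here; only the continuity of `v` is wanted.
  obtain ⟨C, hC⟩ := hol 2⁻¹ (by norm_num) (by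
    rw [← NNReal.coe_lt_coe]
    norm_num)
  have hc : ContinuousOn v N :=
    (hC.uniformContinuousOn (by norm_num)).continuousOn.mono hNS
  have hcv : EqOn (contVersion u) v N := fun z hz =>
    IsContVersionAt.contVersion_eq ⟨N, hN, hz, hc, hvu⟩
  constructor
  · refine ae_restrict_of_ae_restrict_of_subset hKN ?_
    filter_upwards [hvu, ae_restrict_mem hN.measurableSet] with z hz hzN
    rw [hcv hzN, hz]
  · intro α h0 h1
    obtain ⟨C, hC⟩ := hol α h0 h1
    refine ⟨C, fun w hw w' hw' => ?_⟩
    rw [hcv (hKN hw), hcv (hKN hw')]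
    exact hC w (hKS hw) w' (hKS hw')

/-- The local statement on compact sets becomes global because countably many inner squares exhaust
the unit square. -/
theorem contVersion_ae_eq {p : ℝ≥0∞} (hp : 2 ≤ p)
    (h₁ : α₁ ∈ Ioo (0 : ℝ) (1 / 2)) (h₂ : α₂ ∈ Ioo (0 : ℝ) (1 / 2))
    (hV : MemLp V p (volume.restrict unitSquare))
    (hV0 : ∀ᵐ z ∂(volume.restrict unitSquare), 0 ≤ V z)
    (hf : MemLp f 2 (volume.restrict unitSquare)) (hu : InH0 α₁ α₂ V u ux uy)
    (heq : ∀ v vx vy : ℝ × ℝ → ℝ, InH0 α₁ α₂ V v vx vy →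
      bilinForm α₁ α₂ V u ux uy v vx vy = ∫ z in unitSquare, f z * v z) :
    contVersion u =ᵐ[volume.restrict unitSquare] u := by
  rw [unitSquare_eq_iUnion, EventuallyEq, ae_restrict_iUnion_iff]
  intro n
  have hκ : (0 : ℝ) < 1 / ((n : ℝ) + 3) := by positivity
  set κ : ℝ := 1 / ((n : ℝ) + 3)
  have hK : IsCompact (Icc κ (1 - κ) ×ˢ Icc κ (1 - κ)) := isCompact_Icc.prod isCompact_Icc
  have hKS : Icc κ (1 - κ) ×ˢ Icc κ (1 - κ) ⊆ unitSquare :=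
    prod_mono (Icc_subset_Ioo hκ (by linarith)) (Icc_subset_Ioo hκ (by linarith))
  exact ae_restrict_of_ae_restrict_of_subset (prod_mono Ioo_subset_Icc_self Ioo_subset_Icc_self)
    (exists_holder_contVersion_near_compact hp h₁ h₂ hV hV0 hf hu heq hK hKS).1

end

end SubElliptic

theorem theorem201301111756 (α₁ α₂ : ℝ) (hα₁ : α₁ ∈ Set.Ioo (0 : ℝ) (1 / 2))
    (hα₂ : α₂ ∈ Set.Ioo (0 : ℝ) (1 / 2)) (p : ℝ≥0∞) (hp : 2 ≤ p) (hp_top : p < ⊤)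
    (V f u : ℝ × ℝ → ℝ)
    (hV : MemLp V p (volume.restrict SubElliptic.unitSquare))
    (hV_nonneg : ∀ᵐ z ∂(volume.restrict SubElliptic.unitSquare), 0 ≤ V z)
    (hf : MemLp f 2 (volume.restrict SubElliptic.unitSquare))
    (hu : SubElliptic.IsWeakSolution α₁ α₂ V f u) :
    SubElliptic.InSobolevHLoc SubElliptic.unitSquare 2 u ∧
      ∃ w : ℝ × ℝ → ℝ, w =ᵐ[volume.restrict SubElliptic.unitSquare] u ∧
        ∀ α : ℝ≥0, 0 < α → α < 1 → ∀ U : Set (ℝ × ℝ),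
          SubElliptic.CompactlyContained U SubElliptic.unitSquare →
            ∃ C : ℝ≥0, HolderOnWith C α w (closure U) := by
  obtain ⟨ux, uy, hu0, heq⟩ := hu
  exact ⟨fun U _ hU => SubElliptic.inSobolevH_two_of_weak hp hα₁ hα₂ hV hV_nonneg hf hu0 heq hU,
    SubElliptic.contVersion u,
    SubElliptic.contVersion_ae_eq hp hα₁ hα₂ hV hV_nonneg hf hu0 heq,
    fun α h0 h1 U hU => (SubElliptic.exists_holder_contVersion_near_compact hp hα₁ hα₂ hV hV_nonneg
      hf hu0 heq hU.1 hU.2).2 α h0 h1⟩
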